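/- Let $\mathbb K$ be a field of characteristic $0$, $n\ge 1$, $V=\bigoplus_{\alpha\in\mathbb Z^n}V^\alpha$ a $\mathbb Z^n$-graded $\mathbb K$-vector space, $\langle A,B\rangle=\sum_iA_iB_i$ on $\mathbb Z^n$, $e_1=(1,0,\dots,0)$. We use the same letter for a homogeneous element and its degree. \emph{Coderivations.} For a $\mathbb Z^n$-graded space $W$ let $T(W)=\bigoplus_{p\ge1}W^{\otimes p}$, with the induced $\mathbb Z^n$-grading and the coproduct $$\Delta(w_1\otimes\dots\otimes w_p)=\sum_{I\sqcup J=\{1,\dots,p-1\},\,I\ne\emptyset}\varepsilon_W(I;J)\;W_I\bigotimes (W_J\otimes w_p),$$ where $W_I$ is the tensor product in increasing order of the $w_i$, $i\in I$, and $\varepsilon_W(I;J)$ is the Koszul sign of $(W_I,W_J)\to W_{I\cup J}$. Let $\mathrm{CoDer}^Q(T(W))$ be the space of weight $Q$ linear maps $f:T(W)\to T(W)$ with $\Delta f=(f\otimes\mathrm{id}+\mathrm{id}\otimes f)\Delta$, where $(\mathrm{id}\otimes f)(x\otimes y)=(-1)^{\langle Q,x\rangle}x\otimes f(y)$, and let $[f,g]=fg-(-1)^{\langle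 f,g\rangle}gf$ be the graded commutator. The corestrictions of $f$ are $f_p:W^{\otimes p}\to T(W)\xrightarrow{f}T(W)\to W$. $\mathrm{CoDer}^Q_p(T(W))$ is the space of those $f\in \mathrm{CoDer}^Q(T(W))$ all of whose corestrictions except possibly $f_p$ vanish. \emph{Multilinear maps.} For $A\in\mathbb Z^n$ and $a\ge0$ let $M^{(A,a)}(V)$ be the space of $(a+1)$-linear maps $V^{\times (a+1)}\to V$ of weight $A$. Put $M^{(A,a)}_r(V)=M^{(A,a)}(V)$ for $a\ge 0$ and $M_r^{(A,a)}(V)=0$ for $a<0$, and $$M_r(V)=\bigoplus_{(A,a)\in\mathbb Z^n\times\mathbb Z}M_r^{(A,a)}(V),\qquad C(V)=\bigoplus_{Q\in\mathbb Z^n}C^Q(V),\quad C^Q(V)=\prod_{p\ge1}M^{(Q+(1-p)e_1,\,p-1)}(V).$$ \emph{Transfer.} Let $\downarrow V$ be $V$ with the grading $(\downarrow V)^\alpha=V^{\alpha+e_1}$, let $\downarrow:V\to\downarrow V$ be the identity and $\uparrow$ its inverse; $\downarrow^{\otimes p}$ and $\uparrow^{\otimes p}$ carry the sign $(-1)^{\sum_s(p-s)\langle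 e_1,x_s\rangle}$ on $x_1\otimes\dots\otimes x_p$. For $\pi=(\pi_p)_{p\ge1}\in C^Q(V)$ put $Q_p=(-1)^{p(p-1)/2}\downarrow\circ\,\pi_p\circ\uparrow^{\otimes p}$ and let $\phi(\pi):T(\downarrow V)\to T(\downarrow V)$ be given by $$\phi(\pi)(w_1\otimes\dots\otimes w_p)=\sum_{I\sqcup J\sqcup K=\{1,\dots,p\},\;K\neq\emptyset,\;I,J<K}\varepsilon(I;J)(-1)^{\langle Q,W_I\rangle}\,W_I\otimes Q_{|J|+1}(W_J\otimes w_{k_1})\otimes W_{K\setminus k_1},$$ where $\varepsilon=\varepsilon_{\downarrow V}$, $k_1=\min K$, and $I,J<K$ means that all elements of $I$ and $J$ are smaller than $k_1$. Write $\phi_{(A,a)}$ for the restriction of $\phi$ to $M_r^{(A,a)}(V)\subset C^{A+ae_1}(V)$ (sequences concentrated in the entry $p=a+1$). \textbf{Theorem.} \begin{enumerate} \item For every $Q\in\mathbb Z^n$, $\phi$ is a linear isomorphism from $C^Q(V)$ onto $\mathrm{CoDer}^Q(T(\downarrow V))$, whose inverse sends $f$ to the sequence $(\uparrow\circ f_p\circ\downarrow^{\otimes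 p})_{p\ge 1}$. It restricts to isomorphisms $\phi_{(A,a)}$ from $M_r^{(A,a)}(V)$ onto $\mathrm{CoDer}^{A+ae_1}_{a+1}(T(\downarrow V))$ (which is $0$ for $a<0$). \item For $A\in M_r^{(A,a)}(V)$ and $B\in M_r^{(B,b)}(V)$ the commutator $[\phi_{(A,a)}(A),\phi_{(B,b)}(B)]$ lies in the image of $\phi_{(A+B,a+b)}$, and the bracket $$[A,B]^{\otimes}=(-1)^{1+\langle ae_1,\,be_1+B\rangle}\,\phi_{(A+B,a+b)}^{-1}\big([\phi_{(A,a)}(A),\phi_{(B,b)}(B)]\big)$$ makes $M_r(V)$ a $\mathbb Z^{n+1}$-graded Lie algebra: it is bilinear of weight $0$, and satisfies $[A,B]^\otimes=-(-1)^{\langle A,B\rangle+ab}[B,A]^\otimes$ and $[A,[B,D]^\otimes]^\otimes=[[A,B]^\otimes,D]^\otimes+(-1)^{\langle A,B\rangle+ab}[B,[A,D]^\otimes]^\otimes$ for all homogeneous $A,B,D$. \item $C(V)$ is a $\mathbb Z^n$-graded Lie algebra (same axioms, with the signs $(-1)^{\langle\pi,\rho\rangle}$) for the bracket $[\pi,\rho]^{\bar\otimes}=\phi^{-1}[\phi\pi,\phi\rho]$,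 and for $\pi=(\pi_s)_s$, $\rho=(\rho_t)_t$ homogeneous $$[\pi,\rho]^{\bar\otimes}=\sum_{q\ge1}\ \sum_{s+t=q+1}(-1)^{1+(s-1)\langle e_1,\rho\rangle}[\pi_s,\rho_t]^{\otimes}$$ ($s,t\ge1$; the inner sum is the $q$-linear component). \end{enumerate} -/

import Mathlib

open scoped TensorProduct DirectSum

namespace Stem

/-- Multidegrees: elements of `ℤⁿ`. -/
abbrev Deg (n : ℕ) : Type := Fin n → ℤ

/-- The degree `e₁ = (1, 0, …, 0)`. -/
def e1 (n : ℕ) [NeZero n] : Deg n := Pi.single 0 1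

/-- The pairing `⟨A, B⟩ = ∑ᵢ AᵢBᵢ` on `ℤⁿ`. -/
def pair {n : ℕ} (A B : Deg n) : ℤ := ∑ i, A i * B i

/-- The pairing on `ℤⁿ⁺¹ = ℤⁿ × ℤ`. -/
def pairSucc {n : ℕ} (d d' : Deg n × ℤ) : ℤ := pair d.1 d'.1 + d.2 * d'.2

/-- `(-1)^e`. -/
abbrev sgn (e : ℤ) : ℤˣ := e.negOnePow

/-- The desuspension `↓V`: the same space `V`, with the grading `(↓V)^α = V^{α + e₁}`. -/
def desusp {n : ℕ} [NeZero n] {K V : Type*} [Field K] [AddCommGroup V] [Module K V]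
    (𝒱 : Deg n → Submodule K V) : Deg n → Submodule K V :=
  fun α => 𝒱 (α + e1 n)

theorem desusp_isInternal {n : ℕ} [NeZero n] {K V : Type*} [Field K] [AddCommGroup V] [Module K V]
    (𝒱 : Deg n → Submodule K V) [DirectSum.Decomposition 𝒱] :
    DirectSum.IsInternal (desusp 𝒱) := by
  have h := DirectSum.Decomposition.isInternal 𝒱
  rw [DirectSum.isInternal_submodule_iff_iSupIndep_and_iSup_eq_top] at h ⊢
  refine ⟨h.1.comp (add_left_injective (e1 n)), ?_⟩
  rw [← h.2]
  exact (Equiv.addRight (e1 n)).iSup_comp (g := 𝒱)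

noncomputable instance {n : ℕ} [NeZero n] {K V : Type*} [Field K] [AddCommGroup V] [Module K V]
    (𝒱 : Deg n → Submodule K V) [DirectSum.Decomposition 𝒱] :
    DirectSum.Decomposition (desusp 𝒱) :=
  (desusp_isInternal 𝒱).chooseDecomposition

section Graded

variable {n : ℕ} {K V : Type*} [Field K] [AddCommGroup V] [Module K V]

/-- `twist 𝒱 s f` is the multilinear map `f` with a sign that depends on the degrees of its
arguments: `v ↦ (-1)^{s(d)} f(v)` for `vᵢ ∈ V^{dᵢ}`, see `twist_apply`. -/
noncomputable def twist (𝒱 : Deg n → Submodule K V) [DirectSum.Decomposition 𝒱]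
    {X : Type*} [AddCommGroup X] [Module K X] {p : ℕ} (s : (Fin p → Deg n) → ℤ)
    (f : MultilinearMap K (fun _ : Fin p => V) X) : MultilinearMap K (fun _ : Fin p => V) X :=
  (MultilinearMap.fromDirectSumEquiv (R := K) (M := fun (_ : Fin p) (α : Deg n) => 𝒱 α)
      (fun d => sgn (s d) • f.compLinearMap (fun i => (𝒱 (d i)).subtype))).compLinearMap
    (fun _ => (DirectSum.decomposeLinearEquiv 𝒱).toLinearMap)

theorem twist_apply (𝒱 : Deg n → Submodule K V) [DirectSum.Decomposition 𝒱]
    {X : Type*} [AddCommGroup X] [Module K X] {p : ℕ} (s : (Fin p → Deg n) → ℤ)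
    (f : MultilinearMap K (fun _ : Fin p => V) X) (d : Fin p → Deg n) (v : Fin p → V)
    (hv : ∀ i, v i ∈ 𝒱 (d i)) : twist 𝒱 s f v = sgn (s d) • f v := by
  have h : (fun i => DirectSum.decomposeLinearEquiv 𝒱 (v i)) =
      fun i => DirectSum.lof K (Deg n) (fun α => 𝒱 α) (d i) ⟨v i, hv i⟩ := by
    funext i
    exact DirectSum.decompose_of_mem 𝒱 (hv i)
  simp only [twist, MultilinearMap.compLinearMap_apply, LinearEquiv.coe_coe]
  rw [h]
  rw [MultilinearMap.fromDirectSumEquiv_lof]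
  rfl

variable (K V)

/-- The reduced tensor space `T(V) = ⨁_{p ≥ 1} V^{⊗p}`; index `c : ℕ` is the summand
`V^{⊗(c+1)}`. -/
abbrev T : Type _ := ⨁ c : ℕ, ⨂[K]^(c + 1) V

/-- Sequences `(F₁, F₂, …)` of multilinear maps `V^{×p} → V`; index `c : ℕ` is the
`(c+1)`-linear map. -/
abbrev MultSeq : Type _ := (c : ℕ) → MultilinearMap K (fun _ : Fin (c + 1) => V) V

/-- The multilinear map `(v₁, …, v_{c+1}) ↦ v₁ ⊗ … ⊗ v_{c+1} ∈ T(V)`. -/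
noncomputable def word (c : ℕ) : MultilinearMap K (fun _ : Fin (c + 1) => V) (T K V) :=
  (DirectSum.lof K ℕ (fun c : ℕ => ⨂[K]^(c + 1) V) c).compMultilinearMap
    (PiTensorProduct.tprod K)

/-- The projection of the full tensor algebra onto `T(V)` along the scalars; it sends a nonempty
product `v₁ ⋯ v_p` to `v₁ ⊗ … ⊗ v_p`. -/
noncomputable def toRed : TensorAlgebra K V →ₗ[K] T K V :=
  (DirectSum.toModule K ℕ (T K V) (fun p : ℕ =>
    match p with
    | 0 => (0 : ⨂[K]^0 V →ₗ[K] T K V)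
    | c + 1 => DirectSum.lof K ℕ (fun c : ℕ => ⨂[K]^(c + 1) V) c)) ∘ₗ
  (TensorAlgebra.equivDirectSum (R := K) (M := V)).toLinearMap

/-- The canonical projection `pr : T(V) → V`. -/
noncomputable def pr : T K V →ₗ[K] V :=
  (PiTensorProduct.subsingletonEquiv (R := K) (s := fun _ : Fin 1 => V) (0 : Fin 1)).toLinearMap ∘ₗ
    DirectSum.component K ℕ (fun c : ℕ => ⨂[K]^(c + 1) V) 0

variable {K V}

/-- The linear map on `T(V)` whose restriction to `V^{⊗(c+1)}` is induced by `f c`. -/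
noncomputable def onWords {X : Type*} [AddCommGroup X] [Module K X]
    (f : (c : ℕ) → MultilinearMap K (fun _ : Fin (c + 1) => V) X) : T K V →ₗ[K] X :=
  DirectSum.toModule K ℕ X (fun c => PiTensorProduct.lift (f c))

theorem onWords_word {X : Type*} [AddCommGroup X] [Module K X]
    (f : (c : ℕ) → MultilinearMap K (fun _ : Fin (c + 1) => V) X) (c : ℕ)
    (v : Fin (c + 1) → V) : onWords f (word K V c v) = f c v := by
  simp [onWords, word]

/-- The multilinear maps `V^{×p} → V` of weight `A`. -/
def Weight (𝒱 : Deg n → Submodule K V) {p : ℕ} (A : Deg n) :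
    Submodule K (MultilinearMap K (fun _ : Fin p => V) V) where
  carrier := {f | ∀ (d : Fin p → Deg n) (v : Fin p → V), (∀ i, v i ∈ 𝒱 (d i)) →
    f v ∈ 𝒱 (A + ∑ i, d i)}
  add_mem' hf hg d v hv := add_mem (hf d v hv) (hg d v hv)
  zero_mem' _ _ _ := zero_mem _
  smul_mem' r _ hf d v hv := Submodule.smul_mem _ r (hf d v hv)

/-- The homogeneous component `T(V)^α`. -/
def TDeg (𝒱 : Deg n → Submodule K V) (α : Deg n) : Submodule K (T K V) :=
  Submodule.span K {x | ∃ (c : ℕ) (d : Fin (c + 1) → Deg n) (v : Fin (c + 1) → V),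
    (∀ i, v i ∈ 𝒱 (d i)) ∧ ∑ i, d i = α ∧ x = word K V c v}

/-- The exponent of the Koszul sign `ε_V(I;J)`: the sum of `⟨dᵢ, dⱼ⟩` over the inversions
`j < i`, `i ∈ I`, `j ∈ J`. -/
def koszul {p : ℕ} (I J : Finset (Fin p)) (d : Fin p → Deg n) : ℤ :=
  ∑ i ∈ I, ∑ j ∈ J with j < i, pair (d i) (d j)

/-- `v ↦ V_I ⊗ V_{Iᶜ} ∈ T(V) ⊗ T(V)` (for `I` and its complement nonempty), as the ordered product
over `i = 1, …, p` of `vᵢ ⊗ 1` for `i ∈ I` and `1 ⊗ vᵢ` for `i ∉ I`. -/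
noncomputable def splitWord {p : ℕ} (I : Finset (Fin p)) :
    MultilinearMap K (fun _ : Fin p => V) (T K V ⊗[K] T K V) :=
  (TensorProduct.map (toRed K V) (toRed K V)).compMultilinearMap
    ((MultilinearMap.mkPiAlgebraFin K p
        (TensorAlgebra K V ⊗[K] TensorAlgebra K V)).compLinearMap (fun i =>
      if i ∈ I then Algebra.TensorProduct.includeLeft.toLinearMap ∘ₗ TensorAlgebra.ι K
      else Algebra.TensorProduct.includeRight.toLinearMap ∘ₗ TensorAlgebra.ι K))

/-- The dual Leibniz coproduct of `T(V)`:
`Δ(v₁ ⊗ … ⊗ v_p) = ∑_{I ∪ J = {1, …, p-1}, I ≠ ∅} ε_V(I;J) V_I ⊗ (V_J ⊗ v_p)`. -/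
noncomputable def coprod (𝒱 : Deg n → Submodule K V) [DirectSum.Decomposition 𝒱] :
    T K V →ₗ[K] T K V ⊗[K] T K V :=
  onWords (X := T K V ⊗[K] T K V) (fun c => ∑ I ∈ (Finset.univ.erase (Fin.last c)).powerset with I.Nonempty,
    twist (X := T K V ⊗[K] T K V) 𝒱 (koszul I (Finset.univ.erase (Fin.last c) \ I)) (splitWord I))

/-- The linear map `x ↦ (-1)^{⟨Q, x⟩} x` on `T(V)`. -/
noncomputable def parity (𝒱 : Deg n → Submodule K V) [DirectSum.Decomposition 𝒱] (Q : Deg n) :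
    T K V →ₗ[K] T K V :=
  onWords (fun c => twist 𝒱 (fun d => pair Q (∑ i, d i)) (word K V c))

/-- The coderivations of weight `Q` of `(T(V), Δ)`: linear maps `f` of weight `Q` such that
`Δ f = (f ⊗ id + id ⊗ f) Δ`, where `(id ⊗ f)(x ⊗ y) = (-1)^{⟨Q, x⟩} x ⊗ f(y)`. -/
def CoDer (𝒱 : Deg n → Submodule K V) [DirectSum.Decomposition 𝒱] (Q : Deg n) :
    Set (Module.End K (T K V)) :=
  {f | (∀ α, ∀ x ∈ TDeg 𝒱 α, f x ∈ TDeg 𝒱 (α + Q)) ∧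
    coprod 𝒱 ∘ₗ f =
      (TensorProduct.map f LinearMap.id + TensorProduct.map (parity 𝒱 Q) f) ∘ₗ coprod 𝒱}

/-- The corestriction maps of an endomorphism of `T(V)`:
`corestr f c` is `V^{⊗(c+1)} → T(V) → T(V) → V`. -/
noncomputable def corestr : Module.End K (T K V) →ₗ[K] MultSeq K V where
  toFun f := fun c => (pr K V ∘ₗ f).compMultilinearMap (word K V c)
  map_add' f g := by ext c v; simp
  map_smul' r f := by ext c v; simp

/-- The weight `Q` coderivations whose only possibly nonzero corestriction map is the
`(a+1)`-linear one. -/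
def CoDerAt (𝒱 : Deg n → Submodule K V) [DirectSum.Decomposition 𝒱] (Q : Deg n) (a : ℤ) :
    Set (Module.End K (T K V)) :=
  {f ∈ CoDer 𝒱 Q | ∀ c : ℕ, (c : ℤ) ≠ a → corestr f c = 0}

/-- The linear map `x ⊗ y ⊗ z ↦ x ⊗ F(y) ⊗ z`, on the triple tensor product of the tensor
algebra. -/
noncomputable def insertMap (F : MultSeq K V) :
    (TensorAlgebra K V ⊗[K] TensorAlgebra K V) ⊗[K] TensorAlgebra K V →ₗ[K] T K V :=
  toRed K V ∘ₗ LinearMap.mul' K (TensorAlgebra K V) ∘ₗ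
    TensorProduct.map
      (LinearMap.mul' K (TensorAlgebra K V) ∘ₗ
        TensorProduct.map LinearMap.id (TensorAlgebra.ι K ∘ₗ onWords F ∘ₗ toRed K V))
      LinearMap.id

/-- `v ↦ V_I ⊗ F_{|J|+1}(V_J ⊗ v_k) ⊗ (v_{k+1} ⊗ … ⊗ v_p)`, where `J` is a set of indices
smaller than `k` and `I` is the set of the other indices smaller than `k`. -/
noncomputable def insertWord (F : MultSeq K V) {p : ℕ} (k : Fin p) (J : Finset (Fin p)) :
    MultilinearMap K (fun _ : Fin p => V) (T K V) :=
  (insertMap F).compMultilinearMap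
    ((MultilinearMap.mkPiAlgebraFin K p
        ((TensorAlgebra K V ⊗[K] TensorAlgebra K V) ⊗[K] TensorAlgebra K V)).compLinearMap
      (fun i =>
        if k < i then Algebra.TensorProduct.includeRight.toLinearMap ∘ₗ TensorAlgebra.ι K
        else if i ∈ J ∨ i = k then
          Algebra.TensorProduct.includeLeft.toLinearMap ∘ₗ
            Algebra.TensorProduct.includeRight.toLinearMap ∘ₗ TensorAlgebra.ι K
        else
          Algebra.TensorProduct.includeLeft.toLinearMap ∘ₗ
            Algebra.TensorProduct.includeLeft.toLinearMap ∘ₗ TensorAlgebra.ι K))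

/-- The extension of a sequence `F = (F₁, F₂, …)` of weight `Q` multilinear maps to `T(V)`:
`v₁ ⊗ … ⊗ v_p ↦ ∑_{I ∪ J ∪ K = {1, …, p}, I, J < K}
  ε_V(I;J) (-1)^{⟨Q, V_I⟩} V_I ⊗ F_{|J|+1}(V_J ⊗ v_{k₁}) ⊗ V_{K ∖ k₁}`.
The sum runs over `k = k₁` and the subset `J` of `{1, …, k-1}`, which determine `I` and `K`. -/
noncomputable def ext (𝒱 : Deg n → Submodule K V) [DirectSum.Decomposition 𝒱] (Q : Deg n)
    (F : MultSeq K V) : Module.End K (T K V) :=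
  onWords (fun c => ∑ k : Fin (c + 1), ∑ J ∈ (Finset.Iio k).powerset,
    twist 𝒱 (fun d => koszul (Finset.Iio k \ J) J d + pair Q (∑ i ∈ Finset.Iio k \ J, d i))
      (insertWord F k J))

end Graded

section Brackets

variable {n : ℕ} [NeZero n] {K V : Type*} [Field K] [AddCommGroup V] [Module K V]

/-- `σ⁻¹`: the sequence `(-1)^{p(p-1)/2} ↓ ∘ F_p ∘ ↑^{⊗p}` of multilinear maps on `↓V`, where
`↑^{⊗p}(w₁ ⊗ … ⊗ w_p) = (-1)^{∑ₛ (p-s) ⟨e₁, wₛ⟩} ↑w₁ ⊗ … ⊗ ↑w_p` and `wₛ` has its degree in `↓V`.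
Here `p = c + 1`. -/
noncomputable def sigmaInv (𝒱 : Deg n → Submodule K V) [DirectSum.Decomposition 𝒱]
    (F : MultSeq K V) : MultSeq K V :=
  fun c => sgn ((c * (c + 1) / 2 : ℕ) : ℤ) •
    twist (desusp 𝒱) (fun d => ∑ i : Fin (c + 1), ((c : ℤ) - (i : ℕ)) * pair (e1 n) (d i)) (F c)

/-- `σ`: the sequence `↑ ∘ F_p ∘ ↓^{⊗p}` of multilinear maps on `V`, where
`↓^{⊗p}(v₁ ⊗ … ⊗ v_p) = (-1)^{∑ₛ (p-s) ⟨e₁, vₛ⟩} ↓v₁ ⊗ … ⊗ ↓v_p`. Here `p = c + 1`. -/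
noncomputable def sigma (𝒱 : Deg n → Submodule K V) [DirectSum.Decomposition 𝒱]
    (F : MultSeq K V) : MultSeq K V :=
  fun c =>
    twist 𝒱 (fun d => ∑ i : Fin (c + 1), ((c : ℤ) - (i : ℕ)) * pair (e1 n) (d i)) (F c)

/-- The transfer map `φ = ψ⁻¹ ∘ σ⁻¹` on sequences of multilinear maps on `V`, with values in
endomorphisms of `T(↓V)`; `Q` is the weight of the resulting coderivation. -/
noncomputable def phi (𝒱 : Deg n → Submodule K V) [DirectSum.Decomposition 𝒱] (Q : Deg n)
    (F : MultSeq K V) : Module.End K (T K V) :=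
  ext (desusp 𝒱) Q (sigmaInv 𝒱 F)

/-- The transfer map `φ⁻¹ = σ ∘ ψ` from endomorphisms of `T(↓V)` to sequences of multilinear maps
on `V`. -/
noncomputable def phiInv (𝒱 : Deg n → Submodule K V) [DirectSum.Decomposition 𝒱]
    (f : Module.End K (T K V)) : MultSeq K V :=
  sigma 𝒱 (corestr f)

/-- The graded commutator `f g - (-1)^{⟨Q, R⟩} g f` of endomorphisms of weights `Q` and `R`. -/
def comm (Q R : Deg n) (f g : Module.End K (T K V)) : Module.End K (T K V) :=
  f * g - sgn (pair Q R) • (g * f)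

/-- The component `M_r^{(A,a)}(V)`, `(A, a) ∈ ℤⁿ × ℤ`: the weight `A` multilinear maps in `a + 1`
arguments, as sequences concentrated in one place (and `0` for `a < 0`). -/
def Mr (𝒱 : Deg n → Submodule K V) (d : Deg n × ℤ) : Submodule K (MultSeq K V) where
  carrier := {F | ∀ c : ℕ, F c ∈ Weight 𝒱 d.1 ∧ ((c : ℤ) ≠ d.2 → F c = 0)}
  add_mem' hf hg c := ⟨add_mem (hf c).1 (hg c).1, fun h => by simp [(hf c).2 h, (hg c).2 h]⟩
  zero_mem' _ := ⟨zero_mem _, fun _ => rfl⟩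
  smul_mem' r _ hf c := ⟨Submodule.smul_mem _ r (hf c).1, fun h => by simp [(hf c).2 h]⟩

/-- The component `C^Q(V) = ∏_{p ≥ 1} M^{(Q + (1-p)e₁, p-1)}(V)` of `C(V)`. -/
def C (𝒱 : Deg n → Submodule K V) (Q : Deg n) : Submodule K (MultSeq K V) where
  carrier := {F | ∀ c : ℕ, F c ∈ Weight 𝒱 (Q - (c : ℤ) • e1 n)}
  add_mem' hf hg c := add_mem (hf c) (hg c)
  zero_mem' _ := zero_mem _
  smul_mem' r _ hf c := Submodule.smul_mem _ r (hf c)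

/-- The weight `A + a e₁` of the coderivation associated with a map of degree `(A, a)`. -/
def totalDeg (d : Deg n × ℤ) : Deg n := d.1 + d.2 • e1 n

/-- The exponent `1 + ⟨a e₁, b e₁ + B⟩`. -/
def stemExp (d d' : Deg n × ℤ) : ℤ := 1 + pair (d.2 • e1 n) (d'.2 • e1 n + d'.1)

/-- The stem bracket `[A, B]^⊗ = (-1)^{1 + ⟨a e₁, b e₁ + B⟩} φ⁻¹[φ A, φ B]` of `f` of degree
`d = (A, a)` and `g` of degree `d' = (B, b)`. -/
noncomputable def stem (𝒱 : Deg n → Submodule K V) [DirectSum.Decomposition 𝒱]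
    (d d' : Deg n × ℤ) (f g : MultSeq K V) : MultSeq K V :=
  sgn (stemExp d d') • phiInv 𝒱
    (comm (totalDeg d) (totalDeg d') (phi 𝒱 (totalDeg d) f) (phi 𝒱 (totalDeg d') g))

/-- The bracket `φ⁻¹[φ π, φ ρ]` of elements of `C(V)` of degrees `Q` and `R`. -/
noncomputable def stemBar (𝒱 : Deg n → Submodule K V) [DirectSum.Decomposition 𝒱]
    (Q R : Deg n) (π ρ : MultSeq K V) : MultSeq K V :=
  phiInv 𝒱 (comm Q R (phi 𝒱 Q π) (phi 𝒱 R ρ))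

end Brackets

/-- `⨁ᵢ L i` is a `G`-graded Lie algebra for the weight `0` bracket whose restriction to
`L i × L j` is `br i j`, with signs `(-1)^{χ i j}`. The components `L i` are given in a common
ambient space, in which their sum is direct. -/
structure IsGradedLie {G K E : Type*} [AddCommGroup G] [Field K] [AddCommGroup E] [Module K E]
    (χ : G → G → ℤ) (L : G → Submodule K E) (br : G → G → E → E → E) : Prop where
  indep : iSupIndep L
  mem : ∀ i j, ∀ x ∈ L i, ∀ y ∈ L j, br i j x y ∈ L (i + j)
  add_left : ∀ i j, ∀ x ∈ L i, ∀ x' ∈ L i, ∀ y ∈ L j, br i j (x + x') y = br i j x y + br i j x' y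
  smul_left : ∀ i j, ∀ r : K, ∀ x ∈ L i, ∀ y ∈ L j, br i j (r • x) y = r • br i j x y
  add_right : ∀ i j, ∀ x ∈ L i, ∀ y ∈ L j, ∀ y' ∈ L j,
    br i j x (y + y') = br i j x y + br i j x y'
  smul_right : ∀ i j, ∀ r : K, ∀ x ∈ L i, ∀ y ∈ L j, br i j x (r • y) = r • br i j x y
  antisymm : ∀ i j, ∀ x ∈ L i, ∀ y ∈ L j, br i j x y = -(sgn (χ i j) • br j i y x)
  jacobi : ∀ i j k, ∀ x ∈ L i, ∀ y ∈ L j, ∀ z ∈ L k,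
    br i (j + k) x (br j k y z) =
      br (i + j) k (br i j x y) z + sgn (χ i j) • br j (i + k) y (br i k x z)

end Stem

/-! The computations take place in the full tensor algebra, with the unshuffle coproduct `δ x = ∑ x'
⊗ x''` (`unshuffle`), which is coassociative, counital and cocommutative up to Koszul signs. The
dual Leibniz coproduct keeps the last letter on the right, so on `x v` it is `∑ x' ⊗ x'' v` with the
scalar part of `x'` discarded (`coprod_toRed_mul_ι`). Likewise the sum over `I, J, K` that defines
`ext` comes from the operator `D(x v) = D(x) v + ∑ ± x' F(x'' v)` (`coderA`, `ext_toRed`).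

Existence: `D` is a coderivation of `δ` (`unshuffle_coderA`), by induction on the number of letters.
When `δ` is applied to `x' F(x'' v)`, the letter `F(x'' v)` goes right or left; the first part is
handled by coassociativity, the second by coassociativity and cocommutativity. Projecting to `T K V`
gives `ext_mem_CoDer`, and the counit gives `corestr_ext`.

Uniqueness: an element of `T K V` can be recovered from its coproduct and its projection to `V`
(`coprodRetract_coprod`). The coproduct of a word involves only shorter words, so by induction on
length a coderivation without corestrictions is zero (`eq_zero_of_pr_comp_eq_zero`). Hence
coderivations correspond to sequences of maps on `↓V`. Passing from `↓V` to `V` is a sign operator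
that is its own inverse (`sigma_eq_sigmaInv`).

Brackets: graded commutators satisfy antisymmetry and Jacobi for any endomorphisms and preserve
coderivations, so the structure on `C` is transported. For `Mr`, `stemExp` is a constant plus a
biadditive form, hence a cocycle (`stemExp_cocycle`), and its antisymmetrization turns the sign of
the total degrees into that of `ℤⁿ⁺¹` (`sgn_stemExp_swap`). The component formula is a count of word
lengths (`stemBar_apply_eq_sum`). -/

namespace Stem

/-! ### Arithmetic of the pairing and of signs. -/

section Signs

variable {n : ℕ}

theorem pair_add_left (A B D : Deg n) : pair (A + B) D = pair A D + pair B D := by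
  simp [pair, add_mul, Finset.sum_add_distrib]

theorem pair_add_right (A B D : Deg n) : pair A (B + D) = pair A B + pair A D := by
  simp [pair, mul_add, Finset.sum_add_distrib]

theorem pair_comm (A B : Deg n) : pair A B = pair B A := by
  simp [pair, mul_comm]

@[simp] theorem pair_zero_left (A : Deg n) : pair 0 A = 0 := by simp [pair]

@[simp] theorem pair_zero_right (A : Deg n) : pair A 0 = 0 := by simp [pair]

theorem pair_smul_left (a : ℤ) (A B : Deg n) : pair (a • A) B = a * pair A B := by
  simp [pair, Finset.mul_sum, mul_assoc]

theorem pair_smul_right (a : ℤ) (A B : Deg n) : pair A (a • B) = a * pair A B := by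
  rw [pair_comm, pair_smul_left, pair_comm]

theorem pair_sum_right {ι : Type*} (A : Deg n) (s : Finset ι) (d : ι → Deg n) :
    pair A (∑ i ∈ s, d i) = ∑ i ∈ s, pair A (d i) := by
  classical
  induction s using Finset.induction_on with
  | empty => simp
  | insert a s ha ih => rw [Finset.sum_insert ha, Finset.sum_insert ha, pair_add_right, ih]

theorem pair_neg_right (A B : Deg n) : pair A (-B) = -pair A B := by
  simp [pair]

theorem pair_sub_right (A B D : Deg n) : pair A (B - D) = pair A B - pair A D := by
  rw [sub_eq_add_neg, pair_add_right, pair_neg_right, sub_eq_add_neg]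

theorem sgn_add (a b : ℤ) : sgn (a + b) = sgn a * sgn b := Int.negOnePow_add a b

theorem sgn_mul_self (a : ℤ) : sgn a * sgn a = 1 := Int.units_mul_self _

theorem sgn_eq_of_even_sub {a b : ℤ} (h : Even (a - b)) : sgn a = sgn b :=
  (Int.negOnePow_eq_iff a b).2 h

variable {K : Type*} [Field K]

theorem sgn_smul_mem {M : Type*} [AddCommGroup M] [Module K M] (S : Submodule K M) (u : ℤˣ)
    {x : M} (hx : x ∈ S) : u • x ∈ S := by
  rcases Int.units_eq_one_or u with rfl | rfl <;> simpa

theorem map_units_smul {M N : Type*} [AddCommGroup M] [Module K M] [AddCommGroup N] [Module K N]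
    (f : M →ₗ[K] N) (u : ℤˣ) (x : M) : f (u • x) = u • f x := by
  simp [Units.smul_def]

theorem units_smul_tmul {M N : Type*} [AddCommGroup M] [Module K M] [AddCommGroup N] [Module K N]
    (u : ℤˣ) (x : M) (y : N) : (u • x) ⊗ₜ[K] y = u • (x ⊗ₜ[K] y) := by
  rcases Int.units_eq_one_or u with rfl | rfl <;> simp [TensorProduct.neg_tmul]

theorem tmul_units_smul {M N : Type*} [AddCommGroup M] [Module K M] [AddCommGroup N] [Module K N]
    (u : ℤˣ) (x : M) (y : N) : x ⊗ₜ[K] (u • y) = u • (x ⊗ₜ[K] y) := by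
  rcases Int.units_eq_one_or u with rfl | rfl <;> simp [TensorProduct.tmul_neg]

end Signs

/-! ### Reduction of identities to homogeneous words. -/

section Homogeneous

variable {n : ℕ} {K V : Type*} [Field K] [AddCommGroup V] [Module K V]
  (𝒱 : Deg n → Submodule K V) [DirectSum.Decomposition 𝒱]

/-- Signs are only explicit on homogeneous arguments; since `V` is the sum of its components,
checking identities there is enough. -/
theorem multilinearMap_ext_hom {X : Type*} [AddCommGroup X] [Module K X] {p : ℕ}
    {f g : MultilinearMap K (fun _ : Fin p => V) X}
    (h : ∀ (d : Fin p → Deg n) (v : Fin p → V), (∀ i, v i ∈ 𝒱 (d i)) → f v = g v) : f = g := by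
  have key : f.compLinearMap (fun _ => (DirectSum.decomposeLinearEquiv 𝒱).symm.toLinearMap) =
      g.compLinearMap (fun _ => (DirectSum.decomposeLinearEquiv 𝒱).symm.toLinearMap) := by
    refine MultilinearMap.directSum_ext fun d => ?_
    ext v
    have hv : ∀ i, (DirectSum.decomposeLinearEquiv 𝒱).symm
        (DirectSum.lof K (Deg n) (fun α => 𝒱 α) (d i) (v i)) = (v i : V) := fun i =>
      DirectSum.decompose_symm_of 𝒱 (v i)
    simp only [MultilinearMap.compLinearMap_apply, LinearEquiv.coe_coe, hv]
    exact h d _ fun i => (v i).2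
  ext v
  have := congrArg (fun F => F fun i => DirectSum.decomposeLinearEquiv 𝒱 (v i)) key
  simpa using this

theorem tprod_succ {p : ℕ} (v : Fin (p + 1) → V) :
    TensorAlgebra.tprod K V (p + 1) v =
      TensorAlgebra.tprod K V p (fun i => v i.castSucc) * TensorAlgebra.ι K (v (Fin.last p)) := by
  simp only [TensorAlgebra.tprod_apply, List.ofFn_succ', List.concat_eq_append, List.prod_append,
    List.prod_cons, List.prod_nil, mul_one]

@[simp] theorem tprod_zero (v : Fin 0 → V) : TensorAlgebra.tprod K V 0 v = 1 := by
  simp [TensorAlgebra.tprod_apply]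

variable {X : Type*} [AddCommGroup X] [Module K X]

theorem tensorAlgebra_ext_tprod {f g : TensorAlgebra K V →ₗ[K] X}
    (h : ∀ (p : ℕ), f.compMultilinearMap (TensorAlgebra.tprod K V p) =
      g.compMultilinearMap (TensorAlgebra.tprod K V p)) : f = g := by
  have key : f ∘ₗ (TensorAlgebra.equivDirectSum (R := K) (M := V)).symm.toLinearMap =
      g ∘ₗ (TensorAlgebra.equivDirectSum (R := K) (M := V)).symm.toLinearMap := by
    refine DirectSum.linearMap_ext _ fun p => PiTensorProduct.ext ?_
    ext v
    have := congrArg (fun F => F v) (h p)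
    have e : (TensorAlgebra.equivDirectSum (R := K) (M := V)).symm
        (DirectSum.lof K ℕ (fun p => ⨂[K]^p V) p (PiTensorProduct.tprod K v)) =
        TensorAlgebra.tprod K V p v := TensorAlgebra.ofDirectSum_of_tprod v
    simpa [e] using this
  ext x
  simpa using congrArg (fun F => F (TensorAlgebra.equivDirectSum x)) key

theorem tensorAlgebra_ext_hom {f g : TensorAlgebra K V →ₗ[K] X}
    (h : ∀ (p : ℕ) (d : Fin p → Deg n) (v : Fin p → V), (∀ i, v i ∈ 𝒱 (d i)) →
      f (TensorAlgebra.tprod K V p v) = g (TensorAlgebra.tprod K V p v)) : f = g :=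
  tensorAlgebra_ext_tprod fun p => multilinearMap_ext_hom 𝒱 (h p)

theorem linearMap_ext_hom {f g : V →ₗ[K] X} (h : ∀ d, ∀ v ∈ 𝒱 d, f v = g v) : f = g := by
  ext v
  induction v using DirectSum.Decomposition.inductionOn 𝒱 with
  | zero => simp
  | homogeneous v => exact h _ _ v.2
  | add a b ha hb => simp [ha, hb]

/-- To prove that two linear maps on the tensor algebra agree, multiply by one homogeneous letter
at a time. -/
theorem tensorAlgebra_ext_mul {f g : TensorAlgebra K V →ₗ[K] X} (h1 : f 1 = g 1)
    (h : ∀ x, f x = g x → ∀ d, ∀ v ∈ 𝒱 d,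
      f (x * TensorAlgebra.ι K v) = g (x * TensorAlgebra.ι K v)) : f = g := by
  refine tensorAlgebra_ext_hom 𝒱 fun p => ?_
  induction p with
  | zero => intro d v _; simpa using h1
  | succ p ih =>
    intro d v hv
    rw [tprod_succ]
    exact h _ (ih (fun i => d i.castSucc) _ fun i => hv _) _ _ (hv _)

end Homogeneous

/-! ### Parity automorphisms and the unshuffle coproduct, built letter by letter. -/

section Operators

variable {n : ℕ} {K V : Type*} [Field K] [AddCommGroup V] [Module K V]
  (𝒱 : Deg n → Submodule K V) [DirectSum.Decomposition 𝒱]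

/-- The linear map `v ↦ (-1)^{⟨e, v⟩} v` on `V`. -/
noncomputable def parV (e : Deg n) : V →ₗ[K] V :=
  DirectSum.toModule K (Deg n) V (fun d => sgn (pair e d) • (𝒱 d).subtype) ∘ₗ
    (DirectSum.decomposeLinearEquiv 𝒱).toLinearMap

theorem decomposeLinearEquiv_of_mem {d : Deg n} {v : V} (hv : v ∈ 𝒱 d) :
    DirectSum.decomposeLinearEquiv 𝒱 v = DirectSum.lof K (Deg n) (fun α => 𝒱 α) d ⟨v, hv⟩ :=
  DirectSum.decompose_of_mem 𝒱 hv

theorem parV_apply (e : Deg n) {d : Deg n} {v : V} (hv : v ∈ 𝒱 d) :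
    parV 𝒱 e v = sgn (pair e d) • v := by
  simp only [parV, LinearMap.comp_apply, LinearEquiv.coe_coe, decomposeLinearEquiv_of_mem 𝒱 hv,
    DirectSum.toModule_lof]
  rfl

/-- The algebra automorphism `x ↦ (-1)^{⟨e, x⟩} x` of the tensor algebra. -/
noncomputable def parA (e : Deg n) : TensorAlgebra K V →ₐ[K] TensorAlgebra K V :=
  TensorAlgebra.lift K (TensorAlgebra.ι K ∘ₗ parV 𝒱 e)

theorem parA_ι (e : Deg n) {d : Deg n} {v : V} (hv : v ∈ 𝒱 d) :
    parA 𝒱 e (TensorAlgebra.ι K v) = sgn (pair e d) • TensorAlgebra.ι K v := by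
  simp [parA, parV_apply 𝒱 e hv, Units.smul_def]

theorem parA_mul_ι (e : Deg n) (x : TensorAlgebra K V) {d : Deg n} {v : V} (hv : v ∈ 𝒱 d) :
    parA 𝒱 e (x * TensorAlgebra.ι K v) =
      sgn (pair e d) • (parA 𝒱 e x * TensorAlgebra.ι K v) := by
  rw [map_mul, parA_ι 𝒱 e hv, mul_smul_comm]

theorem parA_tprod (e : Deg n) {p : ℕ} (d : Fin p → Deg n) (v : Fin p → V)
    (hv : ∀ i, v i ∈ 𝒱 (d i)) :
    parA 𝒱 e (TensorAlgebra.tprod K V p v) =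
      sgn (pair e (∑ i, d i)) • TensorAlgebra.tprod K V p v := by
  induction p with
  | zero => simp
  | succ p ih =>
    rw [tprod_succ, parA_mul_ι 𝒱 e _ (hv _), ih (fun i => d i.castSucc) _ fun i => hv _,
      Fin.sum_univ_castSucc, pair_add_right, sgn_add, smul_mul_assoc, smul_smul, mul_comm]

theorem parA_parA (e e' : Deg n) (x : TensorAlgebra K V) :
    parA 𝒱 e (parA 𝒱 e' x) = parA 𝒱 (e + e') x := by
  have : (parA 𝒱 e).toLinearMap ∘ₗ (parA 𝒱 e').toLinearMap = (parA 𝒱 (e + e')).toLinearMap := by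
    refine tensorAlgebra_ext_hom 𝒱 fun p d v hv => ?_
    simp only [LinearMap.comp_apply, AlgHom.toLinearMap_apply, parA_tprod 𝒱 _ d v hv]
    rw [← AlgHom.toLinearMap_apply, map_units_smul, AlgHom.toLinearMap_apply,
      parA_tprod 𝒱 _ d v hv, smul_smul, ← sgn_add, pair_add_left, add_comm]
  exact congrArg (fun f => f x) this

theorem parA_self (e : Deg n) (x : TensorAlgebra K V) : parA 𝒱 e (parA 𝒱 e x) = x := by
  have : (parA 𝒱 e).toLinearMap ∘ₗ (parA 𝒱 e).toLinearMap = LinearMap.id := by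
    refine tensorAlgebra_ext_hom 𝒱 fun p d v hv => ?_
    simp only [LinearMap.comp_apply, AlgHom.toLinearMap_apply, parA_tprod 𝒱 _ d v hv]
    rw [← AlgHom.toLinearMap_apply, map_units_smul, AlgHom.toLinearMap_apply,
      parA_tprod 𝒱 _ d v hv, smul_smul, sgn_mul_self, one_smul]
    rfl
  exact congrArg (fun f => f x) this

theorem parA_zero (x : TensorAlgebra K V) : parA 𝒱 0 x = x := by
  simpa only [parA_parA, add_zero] using parA_self 𝒱 0 x

theorem algebraMapInv_parA (e : Deg n) (x : TensorAlgebra K V) :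
    TensorAlgebra.algebraMapInv (parA 𝒱 e x) = TensorAlgebra.algebraMapInv x := by
  have : (TensorAlgebra.algebraMapInv.comp (parA 𝒱 e) : TensorAlgebra K V →ₐ[K] K) =
      TensorAlgebra.algebraMapInv := by
    ext v
    simp [parA, TensorAlgebra.algebraMapInv]
  exact congrArg (fun f => f x) this

variable (K V) in
/-- Right multiplication of the tensor algebra by a letter. -/
noncomputable def rmul : V →ₗ[K] Module.End K (TensorAlgebra K V) :=
  (LinearMap.mul K (TensorAlgebra K V)).flip ∘ₗ TensorAlgebra.ι K

@[simp] theorem rmul_apply (v : V) (x : TensorAlgebra K V) :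
    rmul K V v x = x * TensorAlgebra.ι K v := rfl

/-- The operator `a ⊗ b ↦ (-1)^{⟨b, v⟩} a v ⊗ b`. -/
noncomputable def appendLeft :
    V →ₗ[K] Module.End K (TensorAlgebra K V ⊗[K] TensorAlgebra K V) :=
  DirectSum.toModule K (Deg n) _ (fun d =>
    (TensorProduct.mapBilinear (RingHom.id K) (TensorAlgebra K V) (TensorAlgebra K V)
      (TensorAlgebra K V) (TensorAlgebra K V)).flip (parA 𝒱 d).toLinearMap ∘ₗ
      rmul K V ∘ₗ (𝒱 d).subtype) ∘ₗ
    (DirectSum.decomposeLinearEquiv 𝒱).toLinearMap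

theorem appendLeft_of_mem {d : Deg n} {v : V} (hv : v ∈ 𝒱 d) :
    appendLeft 𝒱 v = TensorProduct.map (rmul K V v) (parA 𝒱 d).toLinearMap := by
  simp only [appendLeft, LinearMap.comp_apply, LinearEquiv.coe_coe,
    decomposeLinearEquiv_of_mem 𝒱 hv, DirectSum.toModule_lof]
  rfl

@[simp] theorem appendLeft_tmul {d : Deg n} {v : V} (hv : v ∈ 𝒱 d) (a b : TensorAlgebra K V) :
    appendLeft 𝒱 v (a ⊗ₜ b) = (a * TensorAlgebra.ι K v) ⊗ₜ parA 𝒱 d b := by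
  rw [appendLeft_of_mem 𝒱 hv]; rfl

variable (K V) in
/-- The operator `a ⊗ b ↦ a ⊗ b v`. -/
noncomputable def appendRight :
    V →ₗ[K] Module.End K (TensorAlgebra K V ⊗[K] TensorAlgebra K V) :=
  TensorProduct.mapBilinear (RingHom.id K) (TensorAlgebra K V) (TensorAlgebra K V)
      (TensorAlgebra K V) (TensorAlgebra K V) LinearMap.id ∘ₗ rmul K V

@[simp] theorem appendRight_tmul (v : V) (a b : TensorAlgebra K V) :
    appendRight K V v (a ⊗ₜ b) = a ⊗ₜ (b * TensorAlgebra.ι K v) := rfl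

/-- The unshuffle coproduct of the tensor algebra. -/
noncomputable def unshuffle :
    TensorAlgebra K V →ₗ[K] TensorAlgebra K V ⊗[K] TensorAlgebra K V :=
  LinearMap.applyₗ (1 ⊗ₜ 1) ∘ₗ (MulOpposite.opLinearEquiv K).symm.toLinearMap ∘ₗ
    -- The opposite algebra is the target because in a product `x v` the operator of `x` must act
    -- before that of `v`.
    (TensorAlgebra.lift K ((MulOpposite.opLinearEquiv K).toLinearMap ∘ₗ
      (appendLeft 𝒱 + appendRight K V))).toLinearMap

@[simp] theorem unshuffle_one : unshuffle 𝒱 1 = 1 ⊗ₜ 1 := by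
  simp [unshuffle]

theorem unshuffle_mul_ι (x : TensorAlgebra K V) (v : V) :
    unshuffle 𝒱 (x * TensorAlgebra.ι K v) =
      appendLeft 𝒱 v (unshuffle 𝒱 x) + appendRight K V v (unshuffle 𝒱 x) := by
  simp [unshuffle]

end Operators
-- Coassociativity, counit and graded cocommutativity of the unshuffle coproduct.
section Unshuffle

variable {n : ℕ} {K V : Type*} [Field K] [AddCommGroup V] [Module K V]
  (𝒱 : Deg n → Submodule K V) [DirectSum.Decomposition 𝒱]

theorem unshuffle_parA (e : Deg n) (x : TensorAlgebra K V) :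
    unshuffle 𝒱 (parA 𝒱 e x) =
      TensorProduct.map (parA 𝒱 e).toLinearMap (parA 𝒱 e).toLinearMap (unshuffle 𝒱 x) := by
  have : unshuffle 𝒱 ∘ₗ (parA 𝒱 e).toLinearMap =
      TensorProduct.map (parA 𝒱 e).toLinearMap (parA 𝒱 e).toLinearMap ∘ₗ unshuffle 𝒱 := by
    refine tensorAlgebra_ext_mul 𝒱 (by simp) fun x hx d v hv => ?_
    simp only [LinearMap.comp_apply, AlgHom.toLinearMap_apply] at hx ⊢
    rw [parA_mul_ι 𝒱 e x hv, map_units_smul, unshuffle_mul_ι, unshuffle_mul_ι, hx]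
    generalize unshuffle 𝒱 x = z
    induction z using TensorProduct.induction_on with
    | zero => simp
    | add a b ha hb => simp only [map_add, smul_add] at ha hb ⊢; rw [add_add_add_comm, ha, hb,
        add_add_add_comm]
    | tmul a b =>
      simp only [TensorProduct.map_tmul, AlgHom.toLinearMap_apply, appendLeft_tmul 𝒱 hv,
        appendRight_tmul, map_add, parA_mul_ι 𝒱 e _ hv, smul_add, units_smul_tmul,
        tmul_units_smul, parA_parA, add_comm]
  exact congrArg (fun f => f x) this

/-- Both iterated coproducts satisfy one recursion: a new letter acts by the operator `Θ`, which
appends it to one of the three factors with the Koszul sign of the factors to the right. -/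
theorem unshuffle_coassoc (x : TensorAlgebra K V) :
    TensorProduct.assoc K _ _ _
        (TensorProduct.map (unshuffle 𝒱) LinearMap.id (unshuffle 𝒱 x)) =
      TensorProduct.map LinearMap.id (unshuffle 𝒱) (unshuffle 𝒱 x) := by
  have : (TensorProduct.assoc K (TensorAlgebra K V) (TensorAlgebra K V)
        (TensorAlgebra K V)).toLinearMap ∘ₗ
        TensorProduct.map (unshuffle 𝒱) LinearMap.id ∘ₗ unshuffle 𝒱 =
      TensorProduct.map LinearMap.id (unshuffle 𝒱) ∘ₗ unshuffle 𝒱 := by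
    refine tensorAlgebra_ext_mul 𝒱 (by simp) fun x hx d v hv => ?_
    simp only [LinearMap.comp_apply, LinearEquiv.coe_coe] at hx ⊢
    rw [unshuffle_mul_ι]
    let Θ : Module.End K (TensorAlgebra K V ⊗[K] (TensorAlgebra K V ⊗[K] TensorAlgebra K V)) :=
      TensorProduct.map (rmul K V v)
        (TensorProduct.map (parA 𝒱 d).toLinearMap (parA 𝒱 d).toLinearMap) +
      TensorProduct.map LinearMap.id (appendLeft 𝒱 v + appendRight K V v)
    have h1 : ∀ z, TensorProduct.assoc K _ _ _ (TensorProduct.map (unshuffle 𝒱) LinearMap.id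
        (appendLeft 𝒱 v z + appendRight K V v z)) = Θ (TensorProduct.assoc K _ _ _
          (TensorProduct.map (unshuffle 𝒱) LinearMap.id z)) := by
      intro z
      induction z using TensorProduct.induction_on with
      | zero => simp
      | add a b ha hb => simp only [map_add] at ha hb ⊢; rw [add_add_add_comm, ha, hb]
      | tmul a b =>
        simp only [appendLeft_tmul 𝒱 hv, appendRight_tmul, map_add, TensorProduct.map_tmul,
          LinearMap.id_apply, unshuffle_mul_ι, TensorProduct.add_tmul]
        generalize unshuffle 𝒱 a = w
        induction w using TensorProduct.induction_on with
        | zero => simp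
        | add a b ha hb =>
          simp only [map_add, TensorProduct.add_tmul] at ha hb ⊢
          rw [← ha, ← hb]; abel
        | tmul a' a'' =>
          simp [Θ, appendLeft_tmul 𝒱 hv, TensorProduct.tmul_add, add_assoc]
    have h2 : ∀ z, TensorProduct.map LinearMap.id (unshuffle 𝒱)
        (appendLeft 𝒱 v z + appendRight K V v z) =
          Θ (TensorProduct.map LinearMap.id (unshuffle 𝒱) z) := by
      intro z
      induction z using TensorProduct.induction_on with
      | zero => simp
      | add a b ha hb => simp only [map_add] at ha hb ⊢; rw [add_add_add_comm, ha, hb]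
      | tmul a b =>
        simp [Θ, appendLeft_tmul 𝒱 hv, unshuffle_mul_ι, unshuffle_parA]
    rw [h1, h2, hx]
  exact congrArg (fun f => f x) this

theorem counit_unshuffle (x : TensorAlgebra K V) :
    TensorProduct.rid K _ (TensorProduct.map LinearMap.id
      (TensorAlgebra.algebraMapInv : TensorAlgebra K V →ₐ[K] K).toLinearMap
        (unshuffle 𝒱 x)) = x := by
  have : (TensorProduct.rid K (TensorAlgebra K V)).toLinearMap ∘ₗ TensorProduct.map LinearMap.id
      (TensorAlgebra.algebraMapInv : TensorAlgebra K V →ₐ[K] K).toLinearMap ∘ₗ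
        unshuffle 𝒱 = LinearMap.id := by
    refine tensorAlgebra_ext_mul 𝒱 (by simp) fun x hx d v hv => ?_
    simp only [LinearMap.comp_apply, LinearEquiv.coe_coe, LinearMap.id_apply] at hx ⊢
    rw [unshuffle_mul_ι]
    conv_rhs => rw [← hx]
    generalize unshuffle 𝒱 x = z
    induction z using TensorProduct.induction_on with
    | zero => simp
    | add a b ha hb => simp only [map_add, add_mul] at ha hb ⊢; rw [add_add_add_comm, ha, hb]
    | tmul a b =>
      have : TensorAlgebra.algebraMapInv (TensorAlgebra.ι K v) = (0 : K) := by
        simp [TensorAlgebra.algebraMapInv]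
      simp [appendLeft_tmul 𝒱 hv, algebraMapInv_parA, this]
  exact congrArg (fun f => f x) this

/-- The algebra map that sends a word to the operator appending its letters on the left factor. -/
noncomputable def appendLeftA : TensorAlgebra K V →ₐ[K]
    (Module.End K (TensorAlgebra K V ⊗[K] TensorAlgebra K V))ᵐᵒᵖ :=
  TensorAlgebra.lift K ((MulOpposite.opLinearEquiv K).toLinearMap ∘ₗ appendLeft 𝒱)

/-- The signed swap `a ⊗ b ↦ (-1)^{⟨a, b⟩} b ⊗ a`. -/
noncomputable def braid :
    Module.End K (TensorAlgebra K V ⊗[K] TensorAlgebra K V) :=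
  TensorProduct.lift (LinearMap.mk₂ K (fun a b => (appendLeftA 𝒱 b).unop (1 ⊗ₜ a))
    (by intros; simp [TensorProduct.tmul_add]) (by intros; simp)
    (by intros; simp) (by intros; simp))

theorem braid_tmul_one (a : TensorAlgebra K V) : braid 𝒱 (a ⊗ₜ 1) = 1 ⊗ₜ a := by
  simp [braid]

theorem braid_tmul_mul_ι (a b : TensorAlgebra K V) (v : V) :
    braid 𝒱 (a ⊗ₜ (b * TensorAlgebra.ι K v)) = appendLeft 𝒱 v (braid 𝒱 (a ⊗ₜ b)) := by
  simp [braid, appendLeftA]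

theorem braid_tmul_tprod (a : TensorAlgebra K V) {p : ℕ} (d : Fin p → Deg n) (v : Fin p → V)
    (hv : ∀ i, v i ∈ 𝒱 (d i)) :
    braid 𝒱 (a ⊗ₜ TensorAlgebra.tprod K V p v) =
      TensorAlgebra.tprod K V p v ⊗ₜ parA 𝒱 (∑ i, d i) a := by
  induction p with
  | zero => simp [braid_tmul_one, parA_zero]
  | succ p ih =>
    rw [tprod_succ, braid_tmul_mul_ι, ih (fun i => d i.castSucc) _ fun i => hv _,
      appendLeft_tmul 𝒱 (hv _), parA_parA, Fin.sum_univ_castSucc, add_comm]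

theorem tensor_ext_hom {M X : Type*} [AddCommGroup M] [Module K M] [AddCommGroup X] [Module K X]
    {f g : M ⊗[K] TensorAlgebra K V →ₗ[K] X}
    (h : ∀ (a : M) (p : ℕ) (d : Fin p → Deg n) (v : Fin p → V), (∀ i, v i ∈ 𝒱 (d i)) →
      f (a ⊗ₜ TensorAlgebra.tprod K V p v) = g (a ⊗ₜ TensorAlgebra.tprod K V p v)) : f = g := by
  refine TensorProduct.ext (LinearMap.ext fun a => ?_)
  exact tensorAlgebra_ext_hom 𝒱 fun p d v hv => h a p d v hv

/-- The sign for moving `v` past the right factor occurs once in `appendLeft` and once in `braid`,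
and cancels. -/
theorem braid_appendLeft {d : Deg n} {v : V} (hv : v ∈ 𝒱 d)
    (z : TensorAlgebra K V ⊗[K] TensorAlgebra K V) :
    braid 𝒱 (appendLeft 𝒱 v z) = appendRight K V v (braid 𝒱 z) := by
  have : braid 𝒱 ∘ₗ appendLeft 𝒱 v = appendRight K V v ∘ₗ braid 𝒱 := by
    refine tensor_ext_hom 𝒱 fun a p d' w hw => ?_
    simp only [LinearMap.comp_apply, appendLeft_tmul 𝒱 hv, parA_tprod 𝒱 _ d' w hw,
      tmul_units_smul, map_units_smul, braid_tmul_tprod 𝒱 _ d' w hw, parA_mul_ι 𝒱 _ _ hv,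
      appendRight_tmul, smul_smul]
    rw [pair_comm, sgn_mul_self, one_smul]
  exact congrArg (fun f => f z) this

theorem braid_appendRight (v : V) (z : TensorAlgebra K V ⊗[K] TensorAlgebra K V) :
    braid 𝒱 (appendRight K V v z) = appendLeft 𝒱 v (braid 𝒱 z) := by
  induction z using TensorProduct.induction_on with
  | zero => simp
  | add a b ha hb => simp only [map_add, ha, hb]
  | tmul a b => rw [appendRight_tmul, braid_tmul_mul_ι]

/-- Cocommutativity: the swap exchanges the two appending operators, and a new letter acts on the
coproduct by their sum. -/
theorem braid_unshuffle (x : TensorAlgebra K V) :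
    braid 𝒱 (unshuffle 𝒱 x) = unshuffle 𝒱 x := by
  have : braid 𝒱 ∘ₗ unshuffle 𝒱 = unshuffle 𝒱 := by
    refine tensorAlgebra_ext_mul 𝒱 (by simp [braid_tmul_one]) fun x hx d v hv => ?_
    simp only [LinearMap.comp_apply] at hx ⊢
    rw [unshuffle_mul_ι, map_add, braid_appendLeft 𝒱 hv, braid_appendRight, hx, add_comm]
  exact congrArg (fun f => f x) this

end Unshuffle

/-! ### The extension of a map to the tensor algebra, and the coproduct of its new terms. -/

section Coder

variable {n : ℕ} {K V : Type*} [Field K] [AddCommGroup V] [Module K V]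
  (𝒱 : Deg n → Submodule K V) [DirectSum.Decomposition 𝒱] (Q : Deg n)
  (F : TensorAlgebra K V →ₗ[K] V)

/-- The map `a ⊗ b ↦ (-1)^{⟨Q, a⟩} a F(b)`. -/
noncomputable def contract :
    TensorAlgebra K V ⊗[K] TensorAlgebra K V →ₗ[K] TensorAlgebra K V :=
  LinearMap.mul' K (TensorAlgebra K V) ∘ₗ
    TensorProduct.map (parA 𝒱 Q).toLinearMap (TensorAlgebra.ι K ∘ₗ F)

@[simp] theorem contract_tmul (a b : TensorAlgebra K V) :
    contract 𝒱 Q F (a ⊗ₜ b) = parA 𝒱 Q a * TensorAlgebra.ι K (F b) := by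
  simp [contract]

/-- The extension of `F` to the tensor algebra determined by
`D(x v) = D(x) v + ∑ (-1)^{⟨Q, x'⟩} x' F(x'' v)`, where `∑ x' ⊗ x''` is the unshuffle coproduct
of `x`. -/
noncomputable def coderA : Module.End K (TensorAlgebra K V) :=
  -- The recursion for `D` needs the coproduct of the word read so far, so the state is the pair `(D
  -- x, δ x)`, starting from `(0, 1 ⊗ 1)`.
  LinearMap.fst K _ _ ∘ₗ
    LinearMap.applyₗ ((0 : TensorAlgebra K V), (1 : TensorAlgebra K V) ⊗ₜ (1 : TensorAlgebra K V))
    ∘ₗ (MulOpposite.opLinearEquiv K).symm.toLinearMap ∘ₗ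
    (TensorAlgebra.lift K ((MulOpposite.opLinearEquiv K).toLinearMap ∘ₗ
      LinearMap.mk₂ K (fun (v : V)
          (s : TensorAlgebra K V × (TensorAlgebra K V ⊗[K] TensorAlgebra K V)) =>
        (s.1 * TensorAlgebra.ι K v + contract 𝒱 Q F (appendRight K V v s.2),
          appendLeft 𝒱 v s.2 + appendRight K V v s.2))
        (by intros; simp only [map_add, mul_add, LinearMap.add_apply, Prod.mk_add_mk]
            congr 1 <;> abel)
        (by intros; simp)
        (by intros; simp only [map_add, add_mul, Prod.fst_add, Prod.snd_add, Prod.mk_add_mk]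
            congr 1 <;> abel)
        (by intros; simp))).toLinearMap

theorem coderA_one : coderA 𝒱 Q F 1 = 0 := by
  simp [coderA]

theorem coderA_mul_ι (x : TensorAlgebra K V) (v : V) :
    coderA 𝒱 Q F (x * TensorAlgebra.ι K v) = coderA 𝒱 Q F x * TensorAlgebra.ι K v +
      contract 𝒱 Q F (appendRight K V v (unshuffle 𝒱 x)) := by
  set op := (TensorAlgebra.lift K ((MulOpposite.opLinearEquiv K).toLinearMap ∘ₗ
      LinearMap.mk₂ K (fun (v : V)
          (s : TensorAlgebra K V × (TensorAlgebra K V ⊗[K] TensorAlgebra K V)) =>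
        (s.1 * TensorAlgebra.ι K v + contract 𝒱 Q F (appendRight K V v s.2),
          appendLeft 𝒱 v s.2 + appendRight K V v s.2))
        (by intros; simp only [map_add, mul_add, LinearMap.add_apply, Prod.mk_add_mk]
            congr 1 <;> abel)
        (by intros; simp)
        (by intros; simp only [map_add, add_mul, Prod.fst_add, Prod.snd_add, Prod.mk_add_mk]
            congr 1 <;> abel)
        (by intros; simp))) with hop
  have h : LinearMap.snd K _ _ ∘ₗ
    LinearMap.applyₗ ((0 : TensorAlgebra K V), (1 : TensorAlgebra K V) ⊗ₜ (1 : TensorAlgebra K V))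
    ∘ₗ (MulOpposite.opLinearEquiv K).symm.toLinearMap ∘ₗ op.toLinearMap = unshuffle 𝒱 := by
    refine tensorAlgebra_ext_mul 𝒱 (by simp) fun x hx d v hv => ?_
    rw [unshuffle_mul_ι, ← hx]
    simp [op]
  rw [← h]
  simp [coderA, op]

/-- `F(b)` is a single new last letter, so it goes either left or right. Both parts are written
through `δ a ⊗ b`, the form to which coassociativity applies. -/
theorem unshuffle_contract (z : TensorAlgebra K V ⊗[K] TensorAlgebra K V) :
    unshuffle 𝒱 (contract 𝒱 Q F z) =
      TensorProduct.lift ((appendLeft 𝒱 ∘ₗ F).flip ∘ₗ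
          TensorProduct.map (parA 𝒱 Q).toLinearMap (parA 𝒱 Q).toLinearMap)
        (TensorProduct.map (unshuffle 𝒱) LinearMap.id z) +
      TensorProduct.lift ((appendRight K V ∘ₗ F).flip ∘ₗ
          TensorProduct.map (parA 𝒱 Q).toLinearMap (parA 𝒱 Q).toLinearMap)
        (TensorProduct.map (unshuffle 𝒱) LinearMap.id z) := by
  induction z using TensorProduct.induction_on with
  | zero => simp
  | add a b ha hb => simp only [map_add, ha, hb]; abel
  | tmul a b => simp [unshuffle_mul_ι, unshuffle_parA]

theorem map_unshuffle_appendRight (v : V) (z : TensorAlgebra K V ⊗[K] TensorAlgebra K V) :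
    TensorProduct.map (unshuffle 𝒱) LinearMap.id (appendRight K V v z) =
      TensorProduct.map LinearMap.id (rmul K V v)
        (TensorProduct.map (unshuffle 𝒱) LinearMap.id z) := by
  induction z using TensorProduct.induction_on with
  | zero => simp
  | add a b ha hb => simp only [map_add, ha, hb]
  | tmul a b => simp

/-- The part of `δ(a F(b))` in which `F(b)` goes to the right factor. -/
theorem contract_right (v : V) (x : TensorAlgebra K V) :
    TensorProduct.lift ((appendRight K V ∘ₗ F).flip ∘ₗ
          TensorProduct.map (parA 𝒱 Q).toLinearMap (parA 𝒱 Q).toLinearMap)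
        (TensorProduct.map (unshuffle 𝒱) LinearMap.id (appendRight K V v (unshuffle 𝒱 x))) =
      TensorProduct.map (parA 𝒱 Q).toLinearMap
        (contract 𝒱 Q F ∘ₗ appendRight K V v ∘ₗ unshuffle 𝒱) (unshuffle 𝒱 x) := by
  have h : ∀ z, TensorProduct.lift ((appendRight K V ∘ₗ F).flip ∘ₗ
          TensorProduct.map (parA 𝒱 Q).toLinearMap (parA 𝒱 Q).toLinearMap)
        (TensorProduct.map LinearMap.id (rmul K V v) z) =
      TensorProduct.map (parA 𝒱 Q).toLinearMap (contract 𝒱 Q F ∘ₗ appendRight K V v)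
        (TensorProduct.assoc K _ _ _ z) := by
    intro z
    refine congrArg (fun f => f z) (?_ : TensorProduct.lift ((appendRight K V ∘ₗ F).flip ∘ₗ
          TensorProduct.map (parA 𝒱 Q).toLinearMap (parA 𝒱 Q).toLinearMap) ∘ₗ
        (TensorProduct.map LinearMap.id (rmul K V v)) =
      TensorProduct.map (parA 𝒱 Q).toLinearMap (contract 𝒱 Q F ∘ₗ appendRight K V v) ∘ₗ
        (TensorProduct.assoc K _ _ _).toLinearMap)
    ext a' a'' b
    simp
  -- Coassociativity regroups the three pieces of `x` so that the contraction takes place inside the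
  -- right factor.
  rw [map_unshuffle_appendRight, h, unshuffle_coassoc, ← LinearMap.comp_apply,
    ← TensorProduct.map_comp]
  rfl

variable {F} in
/-- The part of `δ(a F(b))` in which `F(b)` goes to the left factor. -/
theorem contract_left
    (hF : ∀ (p : ℕ) (d : Fin p → Deg n) (v : Fin p → V), (∀ i, v i ∈ 𝒱 (d i)) →
      F (TensorAlgebra.tprod K V p v) ∈ 𝒱 (Q + ∑ i, d i))
    {d : Deg n} {v : V} (hv : v ∈ 𝒱 d) (x : TensorAlgebra K V) :
    TensorProduct.lift ((appendLeft 𝒱 ∘ₗ F).flip ∘ₗ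
          TensorProduct.map (parA 𝒱 Q).toLinearMap (parA 𝒱 Q).toLinearMap)
        (TensorProduct.map (unshuffle 𝒱) LinearMap.id (appendRight K V v (unshuffle 𝒱 x))) =
      TensorProduct.map (contract 𝒱 Q F ∘ₗ appendRight K V v ∘ₗ unshuffle 𝒱)
        (parA 𝒱 d).toLinearMap (unshuffle 𝒱 x) := by
  have h : ∀ z, TensorProduct.lift ((appendLeft 𝒱 ∘ₗ F).flip ∘ₗ
          TensorProduct.map (parA 𝒱 Q).toLinearMap (parA 𝒱 Q).toLinearMap)
        (TensorProduct.map LinearMap.id (rmul K V v) z) =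
      TensorProduct.map (contract 𝒱 Q F ∘ₗ appendRight K V v) (parA 𝒱 d).toLinearMap
        ((TensorProduct.assoc K _ _ _).symm
          (TensorProduct.map LinearMap.id (braid 𝒱) (TensorProduct.assoc K _ _ _ z))) := by
    intro z
    refine congrArg (fun f => f z) (?_ : TensorProduct.lift ((appendLeft 𝒱 ∘ₗ F).flip ∘ₗ
          TensorProduct.map (parA 𝒱 Q).toLinearMap (parA 𝒱 Q).toLinearMap) ∘ₗ
        (TensorProduct.map LinearMap.id (rmul K V v)) =
      TensorProduct.map (contract 𝒱 Q F ∘ₗ appendRight K V v) (parA 𝒱 d).toLinearMap ∘ₗ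
        (TensorProduct.assoc K _ _ _).symm.toLinearMap ∘ₗ
          TensorProduct.map LinearMap.id (braid 𝒱) ∘ₗ (TensorProduct.assoc K _ _ _).toLinearMap)
    refine tensor_ext_hom 𝒱 fun w p d' u hu => ?_
    induction w using TensorProduct.induction_on with
    | zero => simp
    | add a b ha hb => simp only [TensorProduct.add_tmul, map_add, ha, hb]
    | tmul a' a'' =>
      have hFv : F (TensorAlgebra.tprod K V p u * TensorAlgebra.ι K v) ∈
          𝒱 (Q + (∑ i, d' i + d)) := by
        have := hF (p + 1) (Fin.snoc d' d) (Fin.snoc u v) (fun i => by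
          refine Fin.lastCases ?_ (fun i => ?_) i <;> simp [hv, hu])
        rw [tprod_succ, Fin.sum_univ_castSucc] at this
        simpa using this
      simp only [LinearMap.comp_apply, LinearEquiv.coe_coe, TensorProduct.map_tmul,
        TensorProduct.assoc_tmul, LinearMap.id_apply, braid_tmul_tprod 𝒱 _ d' u hu,
        TensorProduct.assoc_symm_tmul, appendRight_tmul, contract_tmul, AlgHom.toLinearMap_apply,
        TensorProduct.lift.tmul, LinearMap.flip_apply, rmul_apply, appendLeft_tmul 𝒱 hFv,
        parA_parA]
      -- The parity `Q` acts on the right factor twice, from the sign in `contract` and from the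
      -- weight of `F`, and drops out.
      have : (Q + (∑ i, d' i + d) + Q) = (d + ∑ i, d' i) + (Q + Q) := by abel
      rw [this, ← parA_parA, ← parA_parA 𝒱 Q Q, parA_self]
  -- Coassociativity puts a coproduct in the last two pieces, where cocommutativity absorbs the
  -- swap; coassociativity read backwards then groups the first two.
  rw [map_unshuffle_appendRight, h, unshuffle_coassoc, ← LinearMap.comp_apply (TensorProduct.map _ _)
    (TensorProduct.map _ _), ← TensorProduct.map_comp]
  have hb : braid 𝒱 ∘ₗ unshuffle 𝒱 = unshuffle 𝒱 := LinearMap.ext (braid_unshuffle 𝒱)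
  rw [hb, LinearMap.comp_id, ← unshuffle_coassoc, LinearEquiv.symm_apply_apply,
    ← LinearMap.comp_apply, ← TensorProduct.map_comp]
  rfl

end Coder
-- Gradings of the tensor algebra by a group, used for weights and for word lengths.
section Grading

variable {n : ℕ} {K V : Type*} [Field K] [AddCommGroup V] [Module K V]
  (𝒱 : Deg n → Submodule K V) [DirectSum.Decomposition 𝒱]
  {G : Type*} [AddCommGroup G] (𝒲 : G → Submodule K V)

/-- The span of the words of total degree `γ` in letters from the `𝒲 g`. -/
def gradA (γ : G) : Submodule K (TensorAlgebra K V) :=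
  Submodule.span K {x | ∃ (p : ℕ) (g : Fin p → G) (v : Fin p → V),
    (∀ i, v i ∈ 𝒲 (g i)) ∧ ∑ i, g i = γ ∧ x = TensorAlgebra.tprod K V p v}

/-- The span of the tensors of two words of total degree `γ`. -/
def gradA₂ (γ : G) : Submodule K (TensorAlgebra K V ⊗[K] TensorAlgebra K V) :=
  Submodule.span K {z | ∃ (α β : G) (a b : TensorAlgebra K V),
    a ∈ gradA 𝒲 α ∧ b ∈ gradA 𝒲 β ∧ α + β = γ ∧ z = a ⊗ₜ b}

theorem tprod_mem_gradA {p : ℕ} (g : Fin p → G) (v : Fin p → V) (hv : ∀ i, v i ∈ 𝒲 (g i)) :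
    TensorAlgebra.tprod K V p v ∈ gradA 𝒲 (∑ i, g i) :=
  Submodule.subset_span ⟨p, g, v, hv, rfl, rfl⟩

variable {𝒲}

theorem mul_ι_mem_gradA {γ g : G} {x : TensorAlgebra K V} (hx : x ∈ gradA 𝒲 γ) {v : V}
    (hv : v ∈ 𝒲 g) : x * TensorAlgebra.ι K v ∈ gradA 𝒲 (γ + g) := by
  induction hx using Submodule.span_induction with
  | zero => simp
  | add x y _ _ hx hy => rw [add_mul]; exact add_mem hx hy
  | smul r x _ hx => rw [smul_mul_assoc]; exact Submodule.smul_mem _ r hx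
  | mem x hx =>
    obtain ⟨p, d, w, hw, rfl, rfl⟩ := hx
    have := tprod_mem_gradA (K := K) 𝒲 (Fin.snoc d g : Fin (p + 1) → G)
      (Fin.snoc w v : Fin (p + 1) → V) (fun i => by
          refine Fin.lastCases ?_ (fun i => ?_) i <;> simp [hv, hw])
    rw [tprod_succ, Fin.sum_univ_castSucc] at this
    simpa using this

theorem parA_mem_gradA (hpar : ∀ e g, ∀ v ∈ 𝒲 g, parV 𝒱 e v ∈ 𝒲 g) (e : Deg n) {γ : G}
    {x : TensorAlgebra K V} (hx : x ∈ gradA 𝒲 γ) : parA 𝒱 e x ∈ gradA 𝒲 γ := by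
  induction hx using Submodule.span_induction with
  | zero => simp
  | add x y _ _ hx hy => rw [map_add]; exact add_mem hx hy
  | smul r x _ hx => rw [map_smul]; exact Submodule.smul_mem _ r hx
  | mem x hx =>
    obtain ⟨p, d, w, hw, rfl, rfl⟩ := hx
    have : parA 𝒱 e (TensorAlgebra.tprod K V p w) =
        TensorAlgebra.tprod K V p (fun i => parV 𝒱 e (w i)) := by
      simp [TensorAlgebra.tprod_apply, map_list_prod, List.map_ofFn, Function.comp_def, parA]
    rw [this]
    exact tprod_mem_gradA 𝒲 _ _ fun i => hpar _ _ _ (hw i)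

/-- The letter carries two degrees: `d` governs the signs, `g` the auxiliary grading, and `hpar`
says that signs respect the latter. -/
theorem appendLeft_mem_gradA₂ (hpar : ∀ e g, ∀ v ∈ 𝒲 g, parV 𝒱 e v ∈ 𝒲 g) {γ g : G}
    {z : TensorAlgebra K V ⊗[K] TensorAlgebra K V} (hz : z ∈ gradA₂ 𝒲 γ) {d : Deg n} {v : V}
    (hvd : v ∈ 𝒱 d) (hv : v ∈ 𝒲 g) : appendLeft 𝒱 v z ∈ gradA₂ 𝒲 (γ + g) := by
  induction hz using Submodule.span_induction with
  | zero => simp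
  | add x y _ _ hx hy => rw [map_add]; exact add_mem hx hy
  | smul r x _ hx => rw [map_smul]; exact Submodule.smul_mem _ r hx
  | mem x hx =>
    obtain ⟨α, β, a, b, ha, hb, rfl, rfl⟩ := hx
    rw [appendLeft_tmul 𝒱 hvd]
    exact Submodule.subset_span ⟨α + g, β, _, _, mul_ι_mem_gradA ha hv,
      parA_mem_gradA 𝒱 hpar d hb, by abel, rfl⟩

theorem appendRight_mem_gradA₂ {γ g : G}
    {z : TensorAlgebra K V ⊗[K] TensorAlgebra K V} (hz : z ∈ gradA₂ 𝒲 γ) {v : V}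
    (hv : v ∈ 𝒲 g) : appendRight K V v z ∈ gradA₂ 𝒲 (γ + g) := by
  induction hz using Submodule.span_induction with
  | zero => simp
  | add x y _ _ hx hy => rw [map_add]; exact add_mem hx hy
  | smul r x _ hx => rw [map_smul]; exact Submodule.smul_mem _ r hx
  | mem x hx =>
    obtain ⟨α, β, a, b, ha, hb, rfl, rfl⟩ := hx
    exact Submodule.subset_span ⟨α, β + g, _, _, ha, mul_ι_mem_gradA hb hv, by abel, rfl⟩

theorem unshuffle_tprod_mem_gradA₂ (hpar : ∀ e g, ∀ v ∈ 𝒲 g, parV 𝒱 e v ∈ 𝒲 g) {p : ℕ}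
    (d : Fin p → Deg n) (g : Fin p → G) (v : Fin p → V) (hvd : ∀ i, v i ∈ 𝒱 (d i))
    (hv : ∀ i, v i ∈ 𝒲 (g i)) :
    unshuffle 𝒱 (TensorAlgebra.tprod K V p v) ∈ gradA₂ 𝒲 (∑ i, g i) := by
  induction p with
  | zero =>
    have : (1 : TensorAlgebra K V) ∈ gradA 𝒲 0 := by
      simpa using tprod_mem_gradA (K := K) 𝒲 g v hv
    rw [tprod_zero, unshuffle_one, Fin.sum_univ_zero]
    exact Submodule.subset_span ⟨0, 0, 1, 1, this, this, add_zero 0, rfl⟩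
  | succ p ih =>
    have := ih (fun i => d i.castSucc) (fun i => g i.castSucc) (fun i => v i.castSucc)
      (fun i => hvd _) fun i => hv _
    rw [tprod_succ, unshuffle_mul_ι, Fin.sum_univ_castSucc]
    exact add_mem (appendLeft_mem_gradA₂ 𝒱 hpar this (hvd _) (hv _))
      (appendRight_mem_gradA₂ this (hv _))

variable (Q : Deg n) {F : TensorAlgebra K V →ₗ[K] V}

theorem contract_mem_gradA (hpar : ∀ e g, ∀ v ∈ 𝒲 g, parV 𝒱 e v ∈ 𝒲 g) {q : G}
    (hF : ∀ (p : ℕ) (g : Fin p → G) (v : Fin p → V), (∀ i, v i ∈ 𝒲 (g i)) →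
      F (TensorAlgebra.tprod K V p v) ∈ 𝒲 (q + ∑ i, g i))
    {γ : G} {z : TensorAlgebra K V ⊗[K] TensorAlgebra K V} (hz : z ∈ gradA₂ 𝒲 γ) :
    contract 𝒱 Q F z ∈ gradA 𝒲 (q + γ) := by
  have hF' : ∀ γ, ∀ b ∈ gradA 𝒲 γ, F b ∈ 𝒲 (q + γ) := by
    intro γ b hb
    induction hb using Submodule.span_induction with
    | zero => simp
    | add x y _ _ hx hy => rw [map_add]; exact add_mem hx hy
    | smul r x _ hx => rw [map_smul]; exact Submodule.smul_mem _ r hx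
    | mem x hx =>
      obtain ⟨p, d, w, hw, rfl, rfl⟩ := hx
      exact hF p d w hw
  induction hz using Submodule.span_induction with
  | zero => simp
  | add x y _ _ hx hy => rw [map_add]; exact add_mem hx hy
  | smul r x _ hx => rw [map_smul]; exact Submodule.smul_mem _ r hx
  | mem x hx =>
    obtain ⟨α, β, a, b, ha, hb, rfl, rfl⟩ := hx
    have : q + (α + β) = α + (q + β) := by abel
    rw [contract_tmul, this]
    exact mul_ι_mem_gradA (parA_mem_gradA 𝒱 hpar Q ha) (hF' _ _ hb)

theorem coderA_tprod_mem_gradA (hpar : ∀ e g, ∀ v ∈ 𝒲 g, parV 𝒱 e v ∈ 𝒲 g) {q : G}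
    (hF : ∀ (p : ℕ) (g : Fin p → G) (v : Fin p → V), (∀ i, v i ∈ 𝒲 (g i)) →
      F (TensorAlgebra.tprod K V p v) ∈ 𝒲 (q + ∑ i, g i)) {p : ℕ}
    (d : Fin p → Deg n) (g : Fin p → G) (v : Fin p → V) (hvd : ∀ i, v i ∈ 𝒱 (d i))
    (hv : ∀ i, v i ∈ 𝒲 (g i)) :
    coderA 𝒱 Q F (TensorAlgebra.tprod K V p v) ∈ gradA 𝒲 (q + ∑ i, g i) := by
  induction p with
  | zero => simp [coderA_one]
  | succ p ih =>
    rw [tprod_succ, coderA_mul_ι, Fin.sum_univ_castSucc]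
    refine add_mem ?_ (contract_mem_gradA 𝒱 Q hpar hF (appendRight_mem_gradA₂
      (unshuffle_tprod_mem_gradA₂ 𝒱 hpar (fun i => d i.castSucc) (fun i => g i.castSucc)
        (fun i => v i.castSucc) (fun i => hvd _) fun i => hv _) (hv _)))
    rw [← add_assoc]
    exact mul_ι_mem_gradA (ih (fun i => d i.castSucc) (fun i => g i.castSucc) _
      (fun i => hvd _) fun i => hv _) (hv _)

theorem parV_mem (e : Deg n) (d : Deg n) (v : V) (hv : v ∈ 𝒱 d) : parV 𝒱 e v ∈ 𝒱 d := by
  rw [parV_apply 𝒱 e hv]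
  exact sgn_smul_mem _ _ hv

theorem parA_of_mem_gradA (e : Deg n) {γ : Deg n} {x : TensorAlgebra K V}
    (hx : x ∈ gradA 𝒱 γ) : parA 𝒱 e x = sgn (pair e γ) • x := by
  induction hx using Submodule.span_induction with
  | zero => simp
  | add x y _ _ hx hy => rw [map_add, hx, hy, smul_add]
  | smul r x _ hx => rw [map_smul, hx, smul_comm]
  | mem x hx =>
    obtain ⟨p, d, w, hw, rfl, rfl⟩ := hx
    exact parA_tprod 𝒱 e d w hw

end Grading

/-! ### The extension is a coderivation of the unshuffle coproduct. -/

section CoderIdentity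

/-- The operator `D ⊗ id + P ⊗ D`. -/
noncomputable def leibniz {K M : Type*} [Field K] [AddCommGroup M] [Module K M]
    (P D : Module.End K M) : Module.End K (M ⊗[K] M) :=
  TensorProduct.map D LinearMap.id + TensorProduct.map P D

@[simp] theorem leibniz_tmul {K M : Type*} [Field K] [AddCommGroup M] [Module K M]
    (P D : Module.End K M) (a b : M) : leibniz P D (a ⊗ₜ b) = D a ⊗ₜ b + P a ⊗ₜ D b := rfl

variable {n : ℕ} {K V : Type*} [Field K] [AddCommGroup V] [Module K V]
  (𝒱 : Deg n → Submodule K V) [DirectSum.Decomposition 𝒱] (Q : Deg n)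
  {F : TensorAlgebra K V →ₗ[K] V}
  (hF : ∀ (p : ℕ) (d : Fin p → Deg n) (v : Fin p → V), (∀ i, v i ∈ 𝒱 (d i)) →
      F (TensorAlgebra.tprod K V p v) ∈ 𝒱 (Q + ∑ i, d i))

/-- At `z = δ x`, the failure of the Leibniz operator to commute with appending a letter is exactly
the term computed in `contract_right`. The version for `appendLeft` matches `contract_left` in the
same way. -/
theorem coderA_coderivation_appendRight (F : TensorAlgebra K V →ₗ[K] V) (v : V)
    (z : TensorAlgebra K V ⊗[K] TensorAlgebra K V) :
    leibniz (parA 𝒱 Q).toLinearMap (coderA 𝒱 Q F) (appendRight K V v z) =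
      appendRight K V v (leibniz (parA 𝒱 Q).toLinearMap (coderA 𝒱 Q F) z) +
      TensorProduct.map (parA 𝒱 Q).toLinearMap
        (contract 𝒱 Q F ∘ₗ appendRight K V v ∘ₗ unshuffle 𝒱) z := by
  induction z using TensorProduct.induction_on with
  | zero => simp
  | add a b ha hb => rw [map_add, map_add, ha, hb]; simp only [map_add]; abel
  | tmul a b =>
    simp only [leibniz_tmul, appendRight_tmul, TensorProduct.map_tmul,
      coderA_mul_ι, AlgHom.toLinearMap_apply, map_add, LinearMap.comp_apply,
      TensorProduct.tmul_add]
    abel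

include hF

theorem coderA_parA (e : Deg n) (x : TensorAlgebra K V) :
    coderA 𝒱 Q F (parA 𝒱 e x) = sgn (pair e Q) • parA 𝒱 e (coderA 𝒱 Q F x) := by
  have : coderA 𝒱 Q F ∘ₗ (parA 𝒱 e).toLinearMap =
      sgn (pair e Q) • ((parA 𝒱 e).toLinearMap ∘ₗ coderA 𝒱 Q F) := by
    refine tensorAlgebra_ext_hom 𝒱 fun p d v hv => ?_
    simp only [LinearMap.comp_apply, AlgHom.toLinearMap_apply, LinearMap.smul_apply]
    rw [parA_tprod 𝒱 e d v hv, parA_of_mem_gradA 𝒱 e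
      (coderA_tprod_mem_gradA 𝒱 Q (parV_mem 𝒱) hF d d v hv hv), map_units_smul, smul_smul,
      ← sgn_add, pair_add_right, ← add_assoc]
    congr 1
    exact sgn_eq_of_even_sub ⟨-pair e Q, by ring⟩
  exact congrArg (fun f => f x) this

/-- Here the weight of `F` is essential: the sign `⟨d, Q⟩` from moving `v` past `D` cancels the one
from the parity of `a v`. -/
theorem coderA_coderivation_appendLeft {d : Deg n} {v : V} (hv : v ∈ 𝒱 d)
    (z : TensorAlgebra K V ⊗[K] TensorAlgebra K V) :
    leibniz (parA 𝒱 Q).toLinearMap (coderA 𝒱 Q F) (appendLeft 𝒱 v z) =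
      appendLeft 𝒱 v (leibniz (parA 𝒱 Q).toLinearMap (coderA 𝒱 Q F) z) +
      TensorProduct.map (contract 𝒱 Q F ∘ₗ appendRight K V v ∘ₗ unshuffle 𝒱)
        (parA 𝒱 d).toLinearMap z := by
  induction z using TensorProduct.induction_on with
  | zero => simp
  | add a b ha hb => rw [map_add, map_add, ha, hb]; simp only [map_add]; abel
  | tmul a b =>
    simp only [leibniz_tmul, appendLeft_tmul 𝒱 hv, TensorProduct.map_tmul,
      coderA_mul_ι, AlgHom.toLinearMap_apply, map_add, LinearMap.comp_apply,
      TensorProduct.add_tmul, parA_mul_ι 𝒱 Q a hv, coderA_parA 𝒱 Q hF, tmul_units_smul,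
      units_smul_tmul, smul_smul, pair_comm Q d, sgn_mul_self, one_smul]
    abel

/-- The extension of `F` is a coderivation of the unshuffle coproduct. -/
theorem unshuffle_coderA (x : TensorAlgebra K V) :
    unshuffle 𝒱 (coderA 𝒱 Q F x) = leibniz (parA 𝒱 Q).toLinearMap (coderA 𝒱 Q F)
      (unshuffle 𝒱 x) := by
  have : unshuffle 𝒱 ∘ₗ coderA 𝒱 Q F =
      leibniz (parA 𝒱 Q).toLinearMap (coderA 𝒱 Q F) ∘ₗ unshuffle 𝒱 := by
    refine tensorAlgebra_ext_mul 𝒱 (by simp [coderA_one]) fun x hx d v hv => ?_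
    simp only [LinearMap.comp_apply] at hx ⊢
    rw [coderA_mul_ι, map_add, unshuffle_mul_ι, unshuffle_contract, contract_right,
      contract_left 𝒱 Q hF hv, hx, unshuffle_mul_ι, map_add,
      coderA_coderivation_appendLeft 𝒱 Q hF hv, coderA_coderivation_appendRight 𝒱 Q F v]
    abel
  exact congrArg (fun f => f x) this

end CoderIdentity
-- Subsets of an interval with one more element, and their Koszul exponents.
section Subsets

variable {n p : ℕ}

theorem sum_powerset_map_castSucc {X : Type*} [AddCommMonoid X] (S : Finset (Fin p))
    (f : Finset (Fin (p + 1)) → X) :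
    ∑ I ∈ (S.map Fin.castSuccEmb).powerset, f I =
      ∑ I ∈ S.powerset, f (I.map Fin.castSuccEmb) := by
  symm
  refine Finset.sum_nbij (fun I : Finset (Fin p) => I.map Fin.castSuccEmb) ?_ ?_ ?_ fun _ _ => rfl
  · intro I hI
    simpa using hI
  · exact (Finset.map_injective _).injOn
  · intro I hI
    obtain ⟨J, hJ, rfl⟩ := Finset.subset_map_iff.1 (Finset.mem_powerset.1 hI)
    exact ⟨J, by simpa using hJ, rfl⟩

theorem univ_eq_insert_last :
    (Finset.univ : Finset (Fin (p + 1))) =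
      insert (Fin.last p) (Finset.univ.map Fin.castSuccEmb) := by
  rw [Fin.univ_castSuccEmb, Finset.cons_eq_insert]

theorem last_notMem_map (I : Finset (Fin p)) : Fin.last p ∉ I.map Fin.castSuccEmb := by
  simp [Fin.castSucc_ne_last]

theorem sum_finset_fin_succ {X : Type*} [AddCommMonoid X] (f : Finset (Fin (p + 1)) → X) :
    ∑ I, f I = ∑ I : Finset (Fin p),
      (f (I.map Fin.castSuccEmb) + f (insert (Fin.last p) (I.map Fin.castSuccEmb))) := by
  rw [← Finset.powerset_univ, univ_eq_insert_last,
    Finset.sum_powerset_insert (last_notMem_map _), sum_powerset_map_castSucc,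
    sum_powerset_map_castSucc, Finset.powerset_univ, Finset.sum_add_distrib]

theorem eq_map_or_eq_insert (I : Finset (Fin (p + 1))) :
    ∃ J : Finset (Fin p), I = J.map Fin.castSuccEmb ∨
      I = insert (Fin.last p) (J.map Fin.castSuccEmb) := by
  refine ⟨Finset.univ.filter fun i => i.castSucc ∈ I, ?_⟩
  by_cases h : Fin.last p ∈ I
  · right
    ext i
    refine Fin.lastCases ?_ (fun i => ?_) i <;> simp [h, Fin.castSucc_ne_last]
  · left
    ext i
    refine Fin.lastCases ?_ (fun i => ?_) i <;> simp [h, Fin.castSucc_ne_last]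

theorem compl_map_castSucc (I : Finset (Fin p)) :
    (I.map Fin.castSuccEmb)ᶜ = insert (Fin.last p) (Iᶜ.map Fin.castSuccEmb) := by
  ext i
  refine Fin.lastCases ?_ (fun i => ?_) i
  · simp [Fin.castSucc_ne_last]
  · simp [Fin.castSucc_ne_last]

theorem compl_insert_map_castSucc (I : Finset (Fin p)) :
    (insert (Fin.last p) (I.map Fin.castSuccEmb))ᶜ = Iᶜ.map Fin.castSuccEmb := by
  rw [← compl_compl (Iᶜ.map Fin.castSuccEmb), compl_map_castSucc, compl_compl]

theorem koszul_map (I J : Finset (Fin p)) (d : Fin (p + 1) → Deg n) :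
    koszul (I.map Fin.castSuccEmb) (J.map Fin.castSuccEmb) d =
      koszul I J (fun i => d i.castSucc) := by
  simp [koszul, Finset.filter_map, Function.comp_def]

theorem koszul_insert_left (I J : Finset (Fin p)) (d : Fin (p + 1) → Deg n) :
    koszul (insert (Fin.last p) (I.map Fin.castSuccEmb)) (J.map Fin.castSuccEmb) d =
      koszul I J (fun i => d i.castSucc) +
        pair (d (Fin.last p)) (∑ j ∈ J, d j.castSucc) := by
  rw [← koszul_map, koszul, Finset.sum_insert (last_notMem_map _), add_comm, pair_sum_right,
    Finset.filter_true_of_mem]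
  · simp [koszul]
  · simp [Fin.castSucc_lt_last]

theorem koszul_insert_right (I J : Finset (Fin p)) (d : Fin (p + 1) → Deg n) :
    koszul (I.map Fin.castSuccEmb) (insert (Fin.last p) (J.map Fin.castSuccEmb)) d =
      koszul I J (fun i => d i.castSucc) := by
  rw [← koszul_map, koszul, koszul]
  refine Finset.sum_congr rfl fun i _ => ?_
  rw [Finset.filter_insert, if_neg (not_lt.2 (Fin.le_last i))]

end Subsets

/-! ### The unshuffle coproduct as a sum over subsets; the product in the tensor square is unsigned,
so signs are kept apart. -/

section Split

variable {n : ℕ} {K V : Type*} [Field K] [AddCommGroup V] [Module K V]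
  (𝒱 : Deg n → Submodule K V) [DirectSum.Decomposition 𝒱] {p : ℕ}

variable (K) in
/-- `v_I ⊗ v_{Iᶜ}` in the tensor square of the tensor algebra. -/
noncomputable def splitA (I : Finset (Fin p)) (v : Fin p → V) :
    TensorAlgebra K V ⊗[K] TensorAlgebra K V :=
  (List.ofFn fun i => if i ∈ I then TensorAlgebra.ι K (v i) ⊗ₜ[K] (1 : TensorAlgebra K V)
    else (1 : TensorAlgebra K V) ⊗ₜ[K] TensorAlgebra.ι K (v i)).prod

theorem splitWord_apply (I : Finset (Fin p)) (v : Fin p → V) :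
    splitWord I v = TensorProduct.map (toRed K V) (toRed K V) (splitA K I v) := by
  simp only [splitWord, LinearMap.compMultilinearMap_apply, MultilinearMap.compLinearMap_apply,
    MultilinearMap.mkPiAlgebraFin_apply, splitA]
  congr 3
  funext i
  split_ifs <;> rfl

theorem splitA_map (I : Finset (Fin p)) (v : Fin (p + 1) → V) :
    splitA K (I.map Fin.castSuccEmb) v =
      splitA K I (fun i => v i.castSucc) * 1 ⊗ₜ TensorAlgebra.ι K (v (Fin.last p)) := by
  simp only [splitA, List.ofFn_succ', List.concat_eq_append, List.prod_append, List.prod_cons,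
    List.prod_nil, mul_one, if_neg (last_notMem_map I)]
  simp

theorem splitA_insert (I : Finset (Fin p)) (v : Fin (p + 1) → V) :
    splitA K (insert (Fin.last p) (I.map Fin.castSuccEmb)) v =
      splitA K I (fun i => v i.castSucc) * TensorAlgebra.ι K (v (Fin.last p)) ⊗ₜ 1 := by
  simp only [splitA, List.ofFn_succ', List.concat_eq_append, List.prod_append, List.prod_cons,
    List.prod_nil, mul_one, if_pos (Finset.mem_insert_self _ _)]
  simp [Fin.castSucc_ne_last]

theorem mul_one_tmul_ι (z : TensorAlgebra K V ⊗[K] TensorAlgebra K V) (v : V) :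
    z * 1 ⊗ₜ TensorAlgebra.ι K v = appendRight K V v z := by
  induction z using TensorProduct.induction_on with
  | zero => simp
  | add a b ha hb => rw [add_mul, ha, hb, map_add]
  | tmul a b => simp

theorem map_parA_splitA (e e' : Deg n) (I : Finset (Fin p)) (d : Fin p → Deg n) (v : Fin p → V)
    (hv : ∀ i, v i ∈ 𝒱 (d i)) :
    TensorProduct.map (parA 𝒱 e).toLinearMap (parA 𝒱 e').toLinearMap (splitA K I v) =
      sgn (pair e (∑ i ∈ I, d i) + pair e' (∑ i ∈ Iᶜ, d i)) • splitA K I v := by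
  have key : ∀ z w : TensorAlgebra K V ⊗[K] TensorAlgebra K V,
      TensorProduct.map (parA 𝒱 e).toLinearMap (parA 𝒱 e').toLinearMap (z * w) =
        TensorProduct.map (parA 𝒱 e).toLinearMap (parA 𝒱 e').toLinearMap z *
        TensorProduct.map (parA 𝒱 e).toLinearMap (parA 𝒱 e').toLinearMap w :=
    fun z w => map_mul (Algebra.TensorProduct.map (parA 𝒱 e) (parA 𝒱 e')) z w
  induction p with
  | zero =>
    have : I = ∅ := Subsingleton.elim _ _
    subst this
    simp [splitA, Algebra.TensorProduct.one_def]
  | succ p ih =>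
    have ih' := fun J => ih J (fun i => d i.castSucc) (fun i => v i.castSucc) fun i => hv _
    obtain ⟨J, rfl | rfl⟩ := eq_map_or_eq_insert I
    · rw [splitA_map, key, ih', compl_map_castSucc, Finset.sum_insert (last_notMem_map _)]
      simp only [TensorProduct.map_tmul, AlgHom.toLinearMap_apply, map_one, parA_ι 𝒱 _ (hv _),
        tmul_units_smul, Finset.sum_map, smul_mul_smul_comm, ← sgn_add, Fin.castSuccEmb_apply,
        pair_add_right]
      congr 2
      ring
    · rw [splitA_insert, key, ih', compl_insert_map_castSucc,
        Finset.sum_insert (last_notMem_map _)]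
      simp only [TensorProduct.map_tmul, AlgHom.toLinearMap_apply, map_one, parA_ι 𝒱 _ (hv _),
        units_smul_tmul, Finset.sum_map, smul_mul_smul_comm, ← sgn_add, Fin.castSuccEmb_apply,
        pair_add_right]
      congr 2
      ring

/-- The unshuffle coproduct of a word as a sum over subsets. -/
theorem unshuffle_tprod (d : Fin p → Deg n) (v : Fin p → V) (hv : ∀ i, v i ∈ 𝒱 (d i)) :
    unshuffle 𝒱 (TensorAlgebra.tprod K V p v) =
      ∑ I, sgn (koszul I Iᶜ d) • splitA K I v := by
  induction p with
  | zero =>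
    rw [Fintype.sum_unique]
    simp [splitA, koszul, Algebra.TensorProduct.one_def, Finset.eq_empty_of_isEmpty]
  | succ p ih =>
    -- Signed appending is a parity on the right factor followed by the unsigned product with `v ⊗
    -- 1`. The identity is written as `parA 𝒱 0` to fit `map_parA_splitA`.
    have hmul : ∀ z : TensorAlgebra K V ⊗[K] TensorAlgebra K V,
        appendLeft 𝒱 (v (Fin.last p)) z =
          TensorProduct.map (parA 𝒱 0).toLinearMap (parA 𝒱 (d (Fin.last p))).toLinearMap z *
            TensorAlgebra.ι K (v (Fin.last p)) ⊗ₜ 1 := by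
      intro z
      induction z using TensorProduct.induction_on with
      | zero => simp
      | add a b ha hb => rw [map_add, map_add, ha, hb, add_mul]
      | tmul a b =>
        simp [appendLeft_tmul 𝒱 (hv _), parA_zero]
    rw [tprod_succ, unshuffle_mul_ι, ih (fun i => d i.castSucc) _ fun i => hv _,
      sum_finset_fin_succ, map_sum, map_sum, ← Finset.sum_add_distrib]
    refine Finset.sum_congr rfl fun I _ => ?_
    rw [map_units_smul, map_units_smul, compl_map_castSucc, compl_insert_map_castSucc,
      koszul_insert_right, koszul_insert_left, splitA_map, splitA_insert, mul_one_tmul_ι, hmul,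
      map_parA_splitA 𝒱 _ _ I (fun i => d i.castSucc) _ fun i => hv _, add_comm]
    congr 1
    rw [smul_mul_assoc, smul_smul, ← sgn_add, pair_zero_left, zero_add]

end Split

/-! ### The operations on the reduced tensor space in terms of the tensor algebra. -/

section Bridge

variable {n : ℕ} {K V : Type*} [Field K] [AddCommGroup V] [Module K V]
  (𝒱 : Deg n → Submodule K V) [DirectSum.Decomposition 𝒱]

theorem toRed_tprod (c : ℕ) (v : Fin (c + 1) → V) :
    toRed K V (TensorAlgebra.tprod K V (c + 1) v) = word K V c v := by
  have : TensorAlgebra.equivDirectSum (R := K) (M := V) (TensorAlgebra.tprod K V (c + 1) v) =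
      DirectSum.lof K ℕ (fun p => ⨂[K]^p V) (c + 1) (PiTensorProduct.tprod K v) :=
    TensorAlgebra.toDirectSum_tensorPower_tprod v
  simp only [toRed, LinearMap.comp_apply, AlgEquiv.toLinearMap_apply, this,
    DirectSum.toModule_lof]
  rfl

@[simp] theorem toRed_one : toRed K V 1 = 0 := by
  have : TensorAlgebra.equivDirectSum (R := K) (M := V) (TensorAlgebra.tprod K V 0 Fin.elim0) =
      DirectSum.lof K ℕ (fun p => ⨂[K]^p V) 0 (PiTensorProduct.tprod K Fin.elim0) :=
    TensorAlgebra.toDirectSum_tensorPower_tprod (Fin.elim0 : Fin 0 → V)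
  rw [← tprod_zero (K := K) (V := V) Fin.elim0]
  simp only [toRed, LinearMap.comp_apply, AlgEquiv.toLinearMap_apply, this,
    DirectSum.toModule_lof]
  rfl

theorem toRed_tprod_mul_ι {c : ℕ} (v : Fin (c + 1) → V) :
    toRed K V (TensorAlgebra.tprod K V c (fun i => v i.castSucc) *
      TensorAlgebra.ι K (v (Fin.last c))) = word K V c v := by
  rw [← tprod_succ, toRed_tprod]

theorem erase_last (c : ℕ) : (Finset.univ : Finset (Fin (c + 1))).erase (Fin.last c) =
    Finset.univ.map Fin.castSuccEmb := by
  rw [univ_eq_insert_last, Finset.erase_insert (last_notMem_map _)]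

theorem splitA_empty {p : ℕ} (v : Fin p → V) :
    splitA K ∅ v = 1 ⊗ₜ TensorAlgebra.tprod K V p v := by
  induction p with
  | zero => simp [splitA, Algebra.TensorProduct.one_def]
  | succ p ih =>
    rw [← Finset.map_empty Fin.castSuccEmb, splitA_map, ih, mul_one_tmul_ι, tprod_succ]
    rfl

theorem map_toRed_units_smul (u : ℤˣ) (z : TensorAlgebra K V ⊗[K] TensorAlgebra K V) :
    TensorProduct.map (toRed K V) (toRed K V) (u • z) =
      u • TensorProduct.map (toRed K V) (toRed K V) z :=
  map_units_smul (M := TensorAlgebra K V ⊗[K] TensorAlgebra K V) (N := T K V ⊗[K] T K V) _ u z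

/-- The dual Leibniz coproduct in terms of the unshuffle coproduct. -/
theorem coprod_toRed_mul_ι (x : TensorAlgebra K V) (v : V) :
    coprod 𝒱 (toRed K V (x * TensorAlgebra.ι K v)) =
      TensorProduct.map (toRed K V) (toRed K V) (appendRight K V v (unshuffle 𝒱 x)) := by
  have h1 : ∀ d', ∀ v ∈ 𝒱 d', ∀ (c : ℕ) (d : Fin c → Deg n) (w : Fin c → V),
      (∀ i, w i ∈ 𝒱 (d i)) →
      coprod 𝒱 (toRed K V (TensorAlgebra.tprod K V c w * TensorAlgebra.ι K v)) =
        TensorProduct.map (toRed K V) (toRed K V)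
          (appendRight K V v (unshuffle 𝒱 (TensorAlgebra.tprod K V c w))) := by
    intro d' v hv c d w hw
    have hs := fun i => show (Fin.snoc w v : Fin (c + 1) → V) i ∈
        𝒱 ((Fin.snoc d d' : Fin (c + 1) → Deg n) i) by
      refine Fin.lastCases ?_ (fun i => ?_) i <;> simp [hv, hw]
    have e := toRed_tprod_mul_ι (K := K) (Fin.snoc w v : Fin (c + 1) → V)
    simp only [Fin.snoc_castSucc, Fin.snoc_last] at e
    rw [e, coprod, onWords_word, unshuffle_tprod 𝒱 d w hw, map_sum, map_sum,
      sum_apply, Finset.sum_filter, erase_last, sum_powerset_map_castSucc,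
      Finset.powerset_univ]
    refine Finset.sum_congr rfl fun I _ => ?_
    rw [map_units_smul (appendRight K V v), map_toRed_units_smul]
    split_ifs with hI
    · rw [twist_apply 𝒱 _ _ _ _ hs, splitWord_apply, splitA_map, mul_one_tmul_ι,
        ← Finset.map_sdiff, koszul_map, Finset.compl_eq_univ_sdiff]
      simp
    -- The empty subset is absent from `coprod`; on the other side its left factor `1` is killed by
    -- `toRed`.
    · have : I = ∅ := by simpa using hI
      subst this
      simp [splitA_empty]
  have h2 : ∀ d, ∀ v ∈ 𝒱 d, ∀ x, coprod 𝒱 (toRed K V (x * TensorAlgebra.ι K v)) =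
      TensorProduct.map (toRed K V) (toRed K V) (appendRight K V v (unshuffle 𝒱 x)) := by
    intro d v hv x
    refine congrArg (fun f => f x) (?_ : coprod 𝒱 ∘ₗ toRed K V ∘ₗ rmul K V v =
      TensorProduct.map (toRed K V) (toRed K V) ∘ₗ appendRight K V v ∘ₗ unshuffle 𝒱)
    exact tensorAlgebra_ext_hom (X := T K V ⊗[K] T K V) 𝒱 fun p d' w hw => h1 d v hv p d' w hw
  refine congrArg (fun f => f v) (?_ : coprod 𝒱 ∘ₗ toRed K V ∘ₗ LinearMap.mulLeft K x ∘ₗ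
    TensorAlgebra.ι K = TensorProduct.map (toRed K V) (toRed K V) ∘ₗ
      LinearMap.applyₗ (unshuffle 𝒱 x) ∘ₗ appendRight K V)
  exact linearMap_ext_hom (X := T K V ⊗[K] T K V) 𝒱 fun d v hv => h2 d v hv x

theorem toRed_parA (e : Deg n) (x : TensorAlgebra K V) :
    toRed K V (parA 𝒱 e x) = parity 𝒱 e (toRed K V x) := by
  refine congrArg (fun f => f x) (?_ : toRed K V ∘ₗ (parA 𝒱 e).toLinearMap =
    parity 𝒱 e ∘ₗ toRed K V)
  refine tensorAlgebra_ext_hom 𝒱 fun p d v hv => ?_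
  cases p with
  | zero => simp
  | succ c =>
    simp only [LinearMap.comp_apply, AlgHom.toLinearMap_apply]
    rw [parA_tprod 𝒱 e d v hv, map_units_smul, toRed_tprod, parity, onWords_word,
      twist_apply 𝒱 _ _ d v hv]

variable (Q : Deg n) (F : TensorAlgebra K V →ₗ[K] V) {p : ℕ}

/-- The linear map `x ⊗ y ⊗ z ↦ x F(y) z`. -/
noncomputable def insertA :
    (TensorAlgebra K V ⊗[K] TensorAlgebra K V) ⊗[K] TensorAlgebra K V →ₗ[K] TensorAlgebra K V :=
  LinearMap.mul' K (TensorAlgebra K V) ∘ₗ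
    TensorProduct.map
      (LinearMap.mul' K (TensorAlgebra K V) ∘ₗ
        TensorProduct.map LinearMap.id (TensorAlgebra.ι K ∘ₗ F))
      LinearMap.id

theorem insertA_mul_ι
    (z : (TensorAlgebra K V ⊗[K] TensorAlgebra K V) ⊗[K] TensorAlgebra K V) (v : V) :
    insertA F (z * 1 ⊗ₜ TensorAlgebra.ι K v) = insertA F z * TensorAlgebra.ι K v := by
  induction z using TensorProduct.induction_on with
  | zero => simp
  | add a b ha hb => rw [add_mul, map_add, ha, hb, map_add, add_mul]
  | tmul a b => simp [insertA, mul_assoc]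

theorem insertA_tmul_one (z : TensorAlgebra K V ⊗[K] TensorAlgebra K V) :
    insertA F (z ⊗ₜ 1) = contract 𝒱 0 F z := by
  induction z using TensorProduct.induction_on with
  | zero => simp
  | add a b ha hb => rw [TensorProduct.add_tmul, map_add, ha, hb, map_add]
  | tmul a b => simp [insertA, parA_zero]

/-- Separates the sign from the contraction, so that it can be evaluated subset by subset with
`map_parA_splitA`. -/
theorem contract_appendRight (v : V) (z : TensorAlgebra K V ⊗[K] TensorAlgebra K V) :
    contract 𝒱 Q F (appendRight K V v z) = contract 𝒱 0 F (appendRight K V v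
      (TensorProduct.map (parA 𝒱 Q).toLinearMap (parA 𝒱 0).toLinearMap z)) := by
  induction z using TensorProduct.induction_on with
  | zero => simp
  | add a b ha hb => simp only [map_add, ha, hb]
  | tmul a b => simp [parA_zero]

variable (K) in
/-- `v_I ⊗ (v_J ⊗ v_k) ⊗ (v_{k+1} ⊗ … ⊗ v_p)` in the triple tensor product of the tensor algebra,
where `I` is the complement of `J` in `{1, …, k-1}`. -/
noncomputable def tripleA (k : Fin p) (J : Finset (Fin p)) (v : Fin p → V) :
    (TensorAlgebra K V ⊗[K] TensorAlgebra K V) ⊗[K] TensorAlgebra K V :=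
  (List.ofFn fun i =>
    if k < i then
      (1 : TensorAlgebra K V ⊗[K] TensorAlgebra K V) ⊗ₜ[K] TensorAlgebra.ι K (v i)
    else if i ∈ J ∨ i = k then
      ((1 : TensorAlgebra K V) ⊗ₜ[K] TensorAlgebra.ι K (v i)) ⊗ₜ[K] (1 : TensorAlgebra K V)
    else
      (TensorAlgebra.ι K (v i) ⊗ₜ[K] (1 : TensorAlgebra K V)) ⊗ₜ[K] (1 : TensorAlgebra K V)).prod

theorem insertWord_apply (F : MultSeq K V) (k : Fin p) (J : Finset (Fin p)) (v : Fin p → V) :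
    insertWord F k J v = toRed K V (insertA (onWords F ∘ₗ toRed K V) (tripleA K k J v)) := by
  simp only [insertWord, LinearMap.compMultilinearMap_apply, MultilinearMap.compLinearMap_apply,
    MultilinearMap.mkPiAlgebraFin_apply, tripleA]
  refine congrArg (insertMap F) ?_
  congr 2
  funext i
  split_ifs <;> rfl

theorem tripleA_castSucc (k : Fin p) (J : Finset (Fin p)) (v : Fin (p + 1) → V) :
    tripleA K k.castSucc (J.map Fin.castSuccEmb) v =
      tripleA K k J (fun i => v i.castSucc) * 1 ⊗ₜ TensorAlgebra.ι K (v (Fin.last p)) := by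
  simp only [tripleA, List.ofFn_succ', List.concat_eq_append, List.prod_append, List.prod_cons,
    List.prod_nil, mul_one, if_pos (Fin.castSucc_lt_last k)]
  simp

theorem tripleA_last (J : Finset (Fin p)) (v : Fin (p + 1) → V) :
    tripleA K (Fin.last p) (J.map Fin.castSuccEmb) v =
      appendRight K V (v (Fin.last p)) (splitA K Jᶜ (fun i => v i.castSucc)) ⊗ₜ 1 := by
  have h : (splitA K Jᶜ (fun i => v i.castSucc)) ⊗ₜ[K] (1 : TensorAlgebra K V) =
      (List.ofFn fun i : Fin p => if i ∈ J then
      ((1 : TensorAlgebra K V) ⊗ₜ[K] TensorAlgebra.ι K (v i.castSucc)) ⊗ₜ[K]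
        (1 : TensorAlgebra K V)
    else (TensorAlgebra.ι K (v i.castSucc) ⊗ₜ[K] (1 : TensorAlgebra K V)) ⊗ₜ[K]
        (1 : TensorAlgebra K V)).prod := by
    change Algebra.TensorProduct.includeLeft (R := K) (S := K) (splitA K Jᶜ _) = _
    rw [splitA, map_list_prod, List.map_ofFn]
    congr 2
    funext i
    by_cases hi : i ∈ J <;> simp [hi]
  rw [← mul_one_tmul_ι]
  have : ∀ z w : TensorAlgebra K V ⊗[K] TensorAlgebra K V,
    (z * w) ⊗ₜ[K] (1 : TensorAlgebra K V) = z ⊗ₜ 1 * w ⊗ₜ 1 := by simp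
  rw [this, h]
  simp only [tripleA, List.ofFn_succ', List.concat_eq_append, List.prod_append, List.prod_cons,
    List.prod_nil, mul_one, if_neg (not_lt.2 (Fin.le_last _)), or_true,
    if_true, Fin.castSucc_ne_last, or_false]
  simp

theorem Iio_castSucc_eq_map (k : Fin p) :
    Finset.Iio k.castSucc = (Finset.Iio k).map Fin.castSuccEmb := by
  ext i
  refine Fin.lastCases ?_ (fun i => ?_) i
  · simp
  · simp

theorem Iio_last_eq_map : Finset.Iio (Fin.last p) = Finset.univ.map Fin.castSuccEmb := by
  ext i
  refine Fin.lastCases ?_ (fun i => ?_) i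
  · simp [Fin.castSucc_ne_last]
  · simp

/-- Unrolls the recursion: the terms with `k` last are the new contraction, and in the others the
last letter is multiplied on untouched. -/
theorem coderA_tprod (d : Fin p → Deg n) (v : Fin p → V) (hv : ∀ i, v i ∈ 𝒱 (d i)) :
    coderA 𝒱 Q F (TensorAlgebra.tprod K V p v) =
      ∑ k : Fin p, ∑ J ∈ (Finset.Iio k).powerset,
        sgn (koszul (Finset.Iio k \ J) J d + pair Q (∑ i ∈ Finset.Iio k \ J, d i)) •
          insertA F (tripleA K k J v) := by
  induction p with
  | zero => simp [coderA_one]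
  | succ p ih =>
    rw [tprod_succ, coderA_mul_ι, ih (fun i => d i.castSucc) _ fun i => hv _,
      Fin.sum_univ_castSucc, Finset.sum_mul]
    congr 1
    · refine Finset.sum_congr rfl fun k _ => ?_
      rw [Iio_castSucc_eq_map, sum_powerset_map_castSucc, Finset.sum_mul]
      refine Finset.sum_congr rfl fun J _ => ?_
      rw [tripleA_castSucc, insertA_mul_ι, ← Finset.map_sdiff, koszul_map, Finset.sum_map,
        smul_mul_assoc]
      rfl
    · rw [Iio_last_eq_map, sum_powerset_map_castSucc, Finset.powerset_univ,
        unshuffle_tprod 𝒱 (fun i => d i.castSucc) _ fun i => hv _, map_sum, map_sum,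
        
        -- `unshuffle_tprod` sums over the subset sent to the left, the explicit formula over its
        -- complement `J`.
        ← (Function.Involutive.toPerm (compl : Finset (Fin p) → _) compl_involutive).sum_comp
          _ _ (by simp)]
      refine Finset.sum_congr rfl fun I _ => ?_
      rw [map_units_smul (appendRight K V _), map_units_smul (contract 𝒱 Q F),
        contract_appendRight, map_parA_splitA 𝒱 _ _ _ (fun i => d i.castSucc) _ fun i => hv _,
        map_units_smul (appendRight K V _), map_units_smul (contract 𝒱 0 F), tripleA_last,
        insertA_tmul_one 𝒱, ← Finset.map_sdiff, koszul_map, Finset.sum_map, smul_smul,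
        ← sgn_add, pair_zero_left, add_zero, ← Finset.compl_eq_univ_sdiff]
      simp

theorem ext_toRed (F : MultSeq K V) (x : TensorAlgebra K V) :
    ext 𝒱 Q F (toRed K V x) = toRed K V (coderA 𝒱 Q (onWords F ∘ₗ toRed K V) x) := by
  refine congrArg (fun f => f x) (?_ : ext 𝒱 Q F ∘ₗ toRed K V =
    toRed K V ∘ₗ coderA 𝒱 Q (onWords F ∘ₗ toRed K V))
  refine tensorAlgebra_ext_hom 𝒱 fun p d v hv => ?_
  cases p with
  | zero => simp [coderA_one]
  | succ c =>
    simp only [LinearMap.comp_apply]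
    rw [toRed_tprod, coderA_tprod 𝒱 Q _ d v hv, ext, onWords_word]
    simp only [map_sum, sum_apply, twist_apply 𝒱 _ _ d v hv, insertWord_apply, map_units_smul]

end Bridge
-- Extensions are coderivations of the dual Leibniz coproduct.
section Reduced

variable {n : ℕ} {K V : Type*} [Field K] [AddCommGroup V] [Module K V]
  (𝒱 : Deg n → Submodule K V) [DirectSum.Decomposition 𝒱]

theorem T_ext {X : Type*} [AddCommGroup X] [Module K X] {f g : T K V →ₗ[K] X}
    (h : ∀ c, f.compMultilinearMap (word K V c) = g.compMultilinearMap (word K V c)) : f = g :=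
  DirectSum.linearMap_ext _ fun c => PiTensorProduct.ext (h c)

theorem T_ext_hom {X : Type*} [AddCommGroup X] [Module K X] {f g : T K V →ₗ[K] X}
    (h : ∀ c (d : Fin (c + 1) → Deg n) (v : Fin (c + 1) → V), (∀ i, v i ∈ 𝒱 (d i)) →
      f (word K V c v) = g (word K V c v)) : f = g :=
  T_ext fun c => multilinearMap_ext_hom 𝒱 (h c)

/-- Every word of `T K V` has a last letter, and the recursive descriptions of `coprod`, `pr` and
`ext` all start from it. -/
theorem T_ext_toRed {X : Type*} [AddCommGroup X] [Module K X] {f g : T K V →ₗ[K] X}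
    (h : ∀ (x : TensorAlgebra K V) (v : V), f (toRed K V (x * TensorAlgebra.ι K v)) =
      g (toRed K V (x * TensorAlgebra.ι K v))) : f = g := by
  refine T_ext fun c => MultilinearMap.ext fun v => ?_
  have := h (TensorAlgebra.tprod K V c fun i => v i.castSucc) (v (Fin.last c))
  rwa [toRed_tprod_mul_ι] at this

theorem parity_of_mem_TDeg (e : Deg n) {α : Deg n} {x : T K V} (hx : x ∈ TDeg 𝒱 α) :
    parity 𝒱 e x = sgn (pair e α) • x := by
  induction hx using Submodule.span_induction with
  | zero => simp
  | add x y _ _ hx hy => rw [map_add, hx, hy, smul_add]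
  | smul r x _ hx => rw [map_smul, hx, smul_comm]
  | mem x hx =>
    obtain ⟨c, d, v, hv, rfl, rfl⟩ := hx
    rw [parity, onWords_word, twist_apply 𝒱 _ _ d v hv]

theorem parity_parity (e e' : Deg n) :
    parity 𝒱 e ∘ₗ parity 𝒱 e' = parity 𝒱 (e + e') := by
  refine T_ext_toRed fun x v => ?_
  rw [LinearMap.comp_apply, ← toRed_parA, ← toRed_parA, ← toRed_parA, parA_parA]

omit [DirectSum.Decomposition 𝒱] in
theorem word_mem_TDeg {c : ℕ} (d : Fin (c + 1) → Deg n) (v : Fin (c + 1) → V)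
    (hv : ∀ i, v i ∈ 𝒱 (d i)) : word K V c v ∈ TDeg 𝒱 (∑ i, d i) :=
  Submodule.subset_span ⟨c, d, v, hv, rfl, rfl⟩

omit [DirectSum.Decomposition 𝒱] in
theorem toRed_mem_TDeg {γ : Deg n} {x : TensorAlgebra K V} (hx : x ∈ gradA 𝒱 γ) :
    toRed K V x ∈ TDeg 𝒱 γ := by
  induction hx using Submodule.span_induction with
  | zero => simp
  | add x y _ _ hx hy => rw [map_add]; exact add_mem hx hy
  | smul r x _ hx => rw [map_smul]; exact Submodule.smul_mem _ r hx
  | mem x hx =>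
    obtain ⟨p, d, w, hw, rfl, rfl⟩ := hx
    cases p with
    | zero => simp
    | succ c => rw [toRed_tprod]; exact word_mem_TDeg 𝒱 d w hw

theorem onWords_toRed_tprod {X : Type*} [AddCommGroup X] [Module K X]
    (F : (c : ℕ) → MultilinearMap K (fun _ : Fin (c + 1) => V) X) {c : ℕ} (v : Fin (c + 1) → V) :
    (onWords F ∘ₗ toRed K V) (TensorAlgebra.tprod K V (c + 1) v) = F c v := by
  rw [LinearMap.comp_apply, toRed_tprod, onWords_word]

omit [DirectSum.Decomposition 𝒱] in
theorem onWords_toRed_weight {Q : Deg n} {F : MultSeq K V} (hF : ∀ c, F c ∈ Weight 𝒱 Q)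
    (p : ℕ) (d : Fin p → Deg n) (v : Fin p → V) (hv : ∀ i, v i ∈ 𝒱 (d i)) :
    (onWords F ∘ₗ toRed K V) (TensorAlgebra.tprod K V p v) ∈ 𝒱 (Q + ∑ i, d i) := by
  cases p with
  | zero => simp
  | succ c =>
    rw [onWords_toRed_tprod]
    exact hF c d v hv

/-- The dual Leibniz coproduct keeps the last letter `F(b)` on the right, so only the second half of
`unshuffle_contract` survives. -/
theorem coprod_toRed_contract (Q : Deg n) (F : TensorAlgebra K V →ₗ[K] V)
    (z : TensorAlgebra K V ⊗[K] TensorAlgebra K V) :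
    coprod 𝒱 (toRed K V (contract 𝒱 Q F z)) =
      TensorProduct.map (toRed K V) (toRed K V)
        (TensorProduct.lift ((appendRight K V ∘ₗ F).flip ∘ₗ
          TensorProduct.map (parA 𝒱 Q).toLinearMap (parA 𝒱 Q).toLinearMap)
        (TensorProduct.map (unshuffle 𝒱) LinearMap.id z)) := by
  induction z using TensorProduct.induction_on with
  | zero => simp
  | add a b ha hb => simp only [map_add, ha, hb]
  | tmul a b => simp [coprod_toRed_mul_ι, unshuffle_parA]

theorem map_toRed_leibniz (Q : Deg n) (F : MultSeq K V)
    (z : TensorAlgebra K V ⊗[K] TensorAlgebra K V) :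
    TensorProduct.map (toRed K V) (toRed K V) (leibniz (parA 𝒱 Q).toLinearMap
      (coderA 𝒱 Q (onWords F ∘ₗ toRed K V)) z) =
    (TensorProduct.map (ext 𝒱 Q F) LinearMap.id + TensorProduct.map (parity 𝒱 Q) (ext 𝒱 Q F) :
        T K V ⊗[K] T K V →ₗ[K] T K V ⊗[K] T K V)
      (TensorProduct.map (toRed K V) (toRed K V) z) := by
  induction z using TensorProduct.induction_on with
  | zero => simp
  | add a b ha hb => simp only [map_add, ha, hb]
  | tmul a b =>
    simp only [leibniz_tmul, map_add, TensorProduct.map_tmul, LinearMap.add_apply, ext_toRed,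
      LinearMap.id_apply, AlgHom.toLinearMap_apply, toRed_parA]

/-- The extension of a sequence of weight `Q` maps is a coderivation of weight `Q`. -/
theorem ext_mem_CoDer {Q : Deg n} {F : MultSeq K V} (hF : ∀ c, F c ∈ Weight 𝒱 Q) :
    ext 𝒱 Q F ∈ CoDer 𝒱 Q := by
  have hF' := onWords_toRed_weight 𝒱 hF
  constructor
  · intro α x hx
    induction hx using Submodule.span_induction with
    | zero => simp
    | add x y _ _ hx hy => rw [map_add]; exact add_mem hx hy
    | smul r x _ hx => rw [map_smul]; exact Submodule.smul_mem _ r hx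
    | mem x hx =>
      obtain ⟨c, d, v, hv, rfl, rfl⟩ := hx
      rw [← toRed_tprod, ext_toRed, add_comm]
      exact toRed_mem_TDeg 𝒱 (coderA_tprod_mem_gradA 𝒱 Q (parV_mem 𝒱) hF' d d v hv hv)
  · refine T_ext_toRed (X := T K V ⊗[K] T K V) fun x v => ?_
    rw [LinearMap.comp_apply, LinearMap.comp_apply, ext_toRed, coderA_mul_ι, map_add, map_add,
      coprod_toRed_mul_ι, coprod_toRed_contract, contract_right, unshuffle_coderA 𝒱 Q hF',
      ← map_add, ← coderA_coderivation_appendRight, map_toRed_leibniz, coprod_toRed_mul_ι]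

end Reduced

/-! ### Corestrictions of an extension, and recovery of an element from its coproduct. -/

section Corestriction

variable {n : ℕ} {K V : Type*} [Field K] [AddCommGroup V] [Module K V]
  (𝒱 : Deg n → Submodule K V) [DirectSum.Decomposition 𝒱]

@[simp] theorem algebraMapInv_ι (v : V) :
    TensorAlgebra.algebraMapInv (TensorAlgebra.ι K v) = (0 : K) := by
  simp [TensorAlgebra.algebraMapInv]

theorem unshuffle_counit_left (x : TensorAlgebra K V) :
    TensorProduct.lid K _ (TensorProduct.map
      (TensorAlgebra.algebraMapInv : TensorAlgebra K V →ₐ[K] K).toLinearMap LinearMap.id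
        (unshuffle 𝒱 x)) = x := by
  have : (TensorProduct.lid K (TensorAlgebra K V)).toLinearMap ∘ₗ TensorProduct.map
      (TensorAlgebra.algebraMapInv : TensorAlgebra K V →ₐ[K] K).toLinearMap LinearMap.id ∘ₗ
        unshuffle 𝒱 = LinearMap.id := by
    refine tensorAlgebra_ext_mul 𝒱 (by simp) fun x hx d v hv => ?_
    simp only [LinearMap.comp_apply, LinearEquiv.coe_coe, LinearMap.id_apply] at hx ⊢
    rw [unshuffle_mul_ι]
    conv_rhs => rw [← hx]
    generalize unshuffle 𝒱 x = z
    induction z using TensorProduct.induction_on with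
    | zero => simp
    | add a b ha hb => simp only [map_add, add_mul] at ha hb ⊢; rw [add_add_add_comm, ha, hb]
    | tmul a b => simp [appendLeft_tmul 𝒱 hv]
  exact congrArg (fun f => f x) this

theorem pr_word_zero (v : Fin 1 → V) : pr K V (word K V 0 v) = v 0 := by
  simp [pr, word, DirectSum.component.lof_self]

theorem pr_word_succ (c : ℕ) (v : Fin (c + 1 + 1) → V) : pr K V (word K V (c + 1) v) = 0 := by
  simp only [pr, word, LinearMap.comp_apply, LinearMap.compMultilinearMap_apply]
  rw [DirectSum.component.of, dif_neg (by simp)]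
  simp

/-- `x v` has length one only in the part where `x` is a scalar, which the counit `algebraMapInv`
reads off. -/
theorem pr_toRed_mul_ι (x : TensorAlgebra K V) (v : V) :
    pr K V (toRed K V (x * TensorAlgebra.ι K v)) =
      (TensorAlgebra.algebraMapInv x : K) • v := by
  refine congrArg (fun f => f x) (?_ : pr K V ∘ₗ toRed K V ∘ₗ rmul K V v =
    (TensorAlgebra.algebraMapInv : TensorAlgebra K V →ₐ[K] K).toLinearMap.smulRight v)
  refine tensorAlgebra_ext_tprod fun p => MultilinearMap.ext fun w => ?_
  have e := toRed_tprod_mul_ι (K := K) (Fin.snoc w v : Fin (p + 1) → V)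
  simp only [Fin.snoc_castSucc, Fin.snoc_last] at e
  simp only [LinearMap.compMultilinearMap_apply, LinearMap.comp_apply, rmul_apply,
    LinearMap.smulRight_apply, AlgHom.toLinearMap_apply]
  rw [e]
  cases p with
  | zero =>
    rw [pr_word_zero, tprod_zero, map_one, one_smul]
    exact Fin.snoc_last (α := fun _ : Fin 1 => V) v w
  | succ p => rw [pr_word_succ, tprod_succ, map_mul, algebraMapInv_ι, mul_zero, zero_smul]

theorem algebraMapInv_coderA (Q : Deg n) (F : TensorAlgebra K V →ₗ[K] V)
    (x : TensorAlgebra K V) :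
    (TensorAlgebra.algebraMapInv (coderA 𝒱 Q F x) : K) = 0 := by
  have h : ∀ z, (TensorAlgebra.algebraMapInv (contract 𝒱 Q F z) : K) = 0 := by
    intro z
    induction z using TensorProduct.induction_on with
    | zero => simp
    | add a b ha hb => simp only [map_add, ha, hb, add_zero]
    | tmul a b => simp
  refine congrArg (fun f => f x)
    (?_ : (TensorAlgebra.algebraMapInv : TensorAlgebra K V →ₐ[K] K).toLinearMap ∘ₗ
      coderA 𝒱 Q F = 0)
  refine tensorAlgebra_ext_mul 𝒱 (by simp [coderA_one]) fun x _ d v _ => ?_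
  simp [coderA_mul_ι, h]

theorem pr_toRed_contract (Q : Deg n) (F : TensorAlgebra K V →ₗ[K] V)
    (z : TensorAlgebra K V ⊗[K] TensorAlgebra K V) :
    pr K V (toRed K V (contract 𝒱 Q F z)) = F (TensorProduct.lid K _ (TensorProduct.map
      (TensorAlgebra.algebraMapInv : TensorAlgebra K V →ₐ[K] K).toLinearMap LinearMap.id z)) := by
  induction z using TensorProduct.induction_on with
  | zero => simp
  | add a b ha hb => simp only [map_add, ha, hb]
  | tmul a b => simp [pr_toRed_mul_ι, algebraMapInv_parA]

/-- In `D(x v)` only the contraction with scalar `x'` has length one, and by the counit property it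
is `F(x v)`. -/
theorem pr_comp_ext (Q : Deg n) (F : MultSeq K V) : pr K V ∘ₗ ext 𝒱 Q F = onWords F := by
  refine T_ext_toRed fun x v => ?_
  have h : ∀ z : TensorAlgebra K V ⊗[K] TensorAlgebra K V,
      TensorProduct.lid K _ (TensorProduct.map
      (TensorAlgebra.algebraMapInv : TensorAlgebra K V →ₐ[K] K).toLinearMap LinearMap.id
        (appendRight K V v z)) = TensorProduct.lid K _ (TensorProduct.map
      (TensorAlgebra.algebraMapInv : TensorAlgebra K V →ₐ[K] K).toLinearMap LinearMap.id z) *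
        TensorAlgebra.ι K v := by
    intro z
    induction z using TensorProduct.induction_on with
    | zero => simp
    | add a b ha hb => simp only [map_add, add_mul, ha, hb]
    | tmul a b => simp
  rw [LinearMap.comp_apply, ext_toRed, coderA_mul_ι, map_add, map_add, pr_toRed_mul_ι,
    algebraMapInv_coderA, zero_smul, zero_add, pr_toRed_contract, h, unshuffle_counit_left]
  rfl

theorem corestr_ext (Q : Deg n) (F : MultSeq K V) : corestr (ext 𝒱 Q F) = F := by
  funext c
  refine MultilinearMap.ext fun v => ?_
  change (pr K V ∘ₗ ext 𝒱 Q F) (word K V c v) = _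
  rw [pr_comp_ext, onWords_word]

theorem corestr_ext_mul (Q : Deg n) (F : MultSeq K V) (g : Module.End K (T K V)) (c : ℕ)
    (v : Fin (c + 1) → V) : corestr (ext 𝒱 Q F * g) c v = onWords F (g (word K V c v)) := by
  change (pr K V ∘ₗ ext 𝒱 Q F) (g (word K V c v)) = _
  rw [pr_comp_ext]

variable (K V) in
/-- The inclusion of `T(V)` in the tensor algebra. -/
noncomputable def ofRed : T K V →ₗ[K] TensorAlgebra K V :=
  onWords fun c => TensorAlgebra.tprod K V (c + 1)

theorem ofRed_toRed (x : TensorAlgebra K V) :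
    ofRed K V (toRed K V x) =
      x - algebraMap K _ (TensorAlgebra.algebraMapInv x : K) := by
  refine congrArg (fun f => f x) (?_ : ofRed K V ∘ₗ toRed K V = LinearMap.id -
    Algebra.linearMap K _ ∘ₗ (TensorAlgebra.algebraMapInv : TensorAlgebra K V →ₐ[K] K).toLinearMap)
  refine tensorAlgebra_ext_tprod fun p => MultilinearMap.ext fun w => ?_
  simp only [LinearMap.compMultilinearMap_apply, LinearMap.comp_apply, LinearMap.sub_apply,
    AlgHom.toLinearMap_apply, LinearMap.id_apply]
  cases p with
  | zero => simp
  | succ p => rw [toRed_tprod, ofRed, onWords_word]; simp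

variable (K V) in
/-- The map `x ⊗ y ↦ x ⊗ pr(y)` from `T(V) ⊗ T(V)` to `T(V)`. -/
noncomputable def coprodRetract : T K V ⊗[K] T K V →ₗ[K] T K V :=
  toRed K V ∘ₗ LinearMap.mul' K (TensorAlgebra K V) ∘ₗ
    TensorProduct.map (ofRed K V) (TensorAlgebra.ι K ∘ₗ pr K V)

/-- In `∑ x' ⊗ x'' v` the projection of `x'' v` to `V` retains only the scalar part of `x''`, so
multiplying back returns `x v`. Lost is the case of scalar `x`, a single letter, which the second
summand restores. Hence `coprod` and `pr` have no common kernel. -/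
theorem coprodRetract_coprod (y : T K V) :
    coprodRetract K V (coprod 𝒱 y) + toRed K V (TensorAlgebra.ι K (pr K V y)) = y := by
  refine congrArg (fun f => f y) (?_ : coprodRetract K V ∘ₗ coprod 𝒱 +
    toRed K V ∘ₗ TensorAlgebra.ι K ∘ₗ pr K V = LinearMap.id)
  refine T_ext_toRed fun x v => ?_
  have h : ∀ z : TensorAlgebra K V ⊗[K] TensorAlgebra K V,
      coprodRetract K V (TensorProduct.map (toRed K V) (toRed K V) (appendRight K V v z)) =
        toRed K V ((TensorProduct.rid K _ (TensorProduct.map LinearMap.id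
          (TensorAlgebra.algebraMapInv : TensorAlgebra K V →ₐ[K] K).toLinearMap z) -
          algebraMap K _ (TensorAlgebra.algebraMapInv (TensorProduct.rid K _ (TensorProduct.map
            LinearMap.id (TensorAlgebra.algebraMapInv : TensorAlgebra K V →ₐ[K] K).toLinearMap
              z)) : K)) * TensorAlgebra.ι K v) := by
    intro z
    induction z using TensorProduct.induction_on with
    | zero => simp
    | add a b ha hb =>
      simp only [map_add, ha, hb]
      rw [← map_add, ← add_mul]
      congr 2
      abel
    | tmul a b =>
      simp only [coprodRetract, LinearMap.comp_apply, appendRight_tmul, TensorProduct.map_tmul,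
        LinearMap.mul'_apply, pr_toRed_mul_ι, ofRed_toRed, LinearMap.id_apply,
        AlgHom.toLinearMap_apply, TensorProduct.rid_tmul, map_smul, Algebra.algebraMap_eq_smul_one,
        smul_assoc, ← smul_sub, smul_mul_assoc, mul_smul_comm]
  simp only [LinearMap.add_apply, LinearMap.comp_apply, LinearMap.id_apply]
  rw [coprod_toRed_mul_ι, h, counit_unshuffle, pr_toRed_mul_ι, map_smul, map_smul, sub_mul,
    map_sub, ← Algebra.smul_def, map_smul, sub_add_cancel]

end Corestriction
-- Bounds on word lengths by auxiliary integer degrees.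
section Length

variable {n : ℕ} {K V : Type*} [Field K] [AddCommGroup V] [Module K V]

variable (K V) in
open Classical in
/-- The grading of the letters in which every letter has all the degrees in `S`. -/
noncomputable def letterGr (S : Set ℤ) (m : ℤ) : Submodule K V := if m ∈ S then ⊤ else ⊥

theorem mem_letterGr {S : Set ℤ} {m : ℤ} {v : V} :
    v ∈ letterGr K V S m ↔ m ∈ S ∨ v = 0 := by
  by_cases h : m ∈ S <;> simp [letterGr, h]

/-- A linear map that vanishes on the words with degrees in `S` of sum `γ`, vanishes on the
component of degree `γ`. -/
theorem map_eq_zero_of_mem_gradA {X : Type*} [AddCommGroup X] [Module K X] {S : Set ℤ} {γ : ℤ}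
    (f : TensorAlgebra K V →ₗ[K] X)
    (h : ∀ (p : ℕ) (v : Fin p → V) (k : Fin p → ℤ), (∀ i, k i ∈ S) → ∑ i, k i = γ →
      f (TensorAlgebra.tprod K V p v) = 0)
    {a : TensorAlgebra K V} (ha : a ∈ gradA (letterGr K V S) γ) : f a = 0 := by
  induction ha using Submodule.span_induction with
  | zero => simp
  | add x y _ _ hx hy => rw [map_add, hx, hy, add_zero]
  | smul r x _ hx => rw [map_smul, hx, smul_zero]
  | mem x hx =>
    obtain ⟨p, k, v, hv, rfl, rfl⟩ := hx
    by_cases hk : ∀ i, k i ∈ S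
    · exact h p v k hk rfl
    · obtain ⟨i, hi⟩ := not_forall.1 hk
      rw [MultilinearMap.map_coord_zero _ i ((mem_letterGr.1 (hv i)).resolve_left hi), map_zero]

variable (𝒱 : Deg n → Submodule K V) [DirectSum.Decomposition 𝒱]

theorem parV_mem_letterGr (S : Set ℤ) (e : Deg n) (m : ℤ) (v : V) (hv : v ∈ letterGr K V S m) :
    parV 𝒱 e v ∈ letterGr K V S m := by
  rcases mem_letterGr.1 hv with h | rfl
  · exact mem_letterGr.2 (Or.inl h)
  · simp

/-- Input letters are given degree `1` and `F` is treated as a map of degree `q`; output words then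
have letters of degrees in `S` and total degree `q + c + 1`. With `S = {1}` this counts letters
exactly; with `S = Set.Ici 1` the value of `F` can remember how many letters it consumed. -/
theorem map_ext_word_eq_zero {X : Type*} [AddCommGroup X] [Module K X] {S : Set ℤ}
    (h1 : (1 : ℤ) ∈ S) {Q : Deg n} {F : MultSeq K V} {q : ℤ}
    (hF : ∀ c, F c ≠ 0 → ∀ k : Fin (c + 1) → ℤ, (∀ i, k i ∈ S) → q + ∑ i, k i ∈ S)
    (f : T K V →ₗ[K] X) {c : ℕ}
    (h : ∀ (b : ℕ) (u : Fin (b + 1) → V) (k : Fin (b + 1) → ℤ), (∀ i, k i ∈ S) →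
      ∑ i, k i = q + (c + 1) → f (word K V b u) = 0)
    (v : Fin (c + 1) → V) : f (ext 𝒱 Q F (word K V c v)) = 0 := by
  have hF' : ∀ (p : ℕ) (g : Fin p → ℤ) (v : Fin p → V), (∀ i, v i ∈ letterGr K V S (g i)) →
      (onWords F ∘ₗ toRed K V) (TensorAlgebra.tprod K V p v) ∈
        letterGr K V S (q + ∑ i, g i) := by
    intro p g v hv
    rw [mem_letterGr]
    cases p with
    | zero => right; simp
    | succ c =>
      rw [onWords_toRed_tprod]
      by_cases hc : F c = 0
      · right; simp [hc]
      by_cases hg : ∀ i, g i ∈ S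
      · exact Or.inl (hF c hc g hg)
      · obtain ⟨i, hi⟩ := not_forall.1 hg
        right
        exact MultilinearMap.map_coord_zero _ i ((mem_letterGr.1 (hv i)).resolve_left hi)
  have key : (f ∘ₗ ext 𝒱 Q F).compMultilinearMap (word K V c) = 0 := by
    refine multilinearMap_ext_hom 𝒱 fun d v hv => ?_
    simp only [LinearMap.compMultilinearMap_apply, LinearMap.comp_apply, zero_apply]
    rw [← toRed_tprod, ext_toRed]
    have hD := coderA_tprod_mem_gradA 𝒱 Q (parV_mem_letterGr 𝒱 S) hF' d (fun _ => 1) v hv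
      fun i => mem_letterGr.2 (Or.inl h1)
    refine map_eq_zero_of_mem_gradA (f ∘ₗ toRed K V) (fun p u k hk hs => ?_) hD
    cases p with
    | zero => simp
    | succ b =>
      rw [LinearMap.comp_apply, toRed_tprod]
      exact h b u k hk (by simpa using hs)
  exact congrArg (fun F => F v) key

/-- Inserting a `(b+1)`-linear map shortens each word by `b` letters, whence `q = -b`; the
`(a+1)`-linear map then needs `c = a + b`. -/
theorem corestr_ext_single_mul (Q R : Deg n) {a b c : ℕ} (h : a + b ≠ c)
    (F : MultilinearMap K (fun _ : Fin (a + 1) => V) V)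
    (G : MultilinearMap K (fun _ : Fin (b + 1) => V) V) :
    corestr (ext 𝒱 Q (Pi.single a F) * ext 𝒱 R (Pi.single b G)) c = 0 := by
  refine MultilinearMap.ext fun v => ?_
  rw [corestr_ext_mul]
  refine map_ext_word_eq_zero 𝒱 (S := {1}) rfl (q := -b) (fun c hc k hk => ?_) _
    (fun b' u k hk hs => ?_) v
  · obtain rfl : c = b := by
      by_contra hcb
      exact hc (Pi.single_eq_of_ne hcb _)
    simp only [Set.mem_singleton_iff] at hk
    simp [hk]
  · simp only [Set.mem_singleton_iff] at hk
    simp only [hk, Finset.sum_const, Finset.card_univ, Fintype.card_fin] at hs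
    push_cast [nsmul_eq_mul] at hs
    rw [onWords_word, Pi.single_eq_of_ne (by omega)]
    rfl

theorem le_sum_of_one_le {b : ℕ} {k : Fin (b + 1) → ℤ} (hk : ∀ i, k i ∈ Set.Ici (1 : ℤ)) :
    (b : ℤ) + 1 ≤ ∑ i, k i := by
  have := Finset.sum_le_sum fun i (_ : i ∈ Finset.univ) => Set.mem_Ici.1 (hk i)
  simpa using this

/-- Extensions never lengthen words. With `q = 0` the total degree stays `c + 1`, while a word of `b
+ 1` letters has degree at least `b + 1`. -/
theorem onWords_ext_word_eq_zero (R : Deg n) {F : MultSeq K V} (G : MultSeq K V) {c : ℕ}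
    (hF : ∀ b ≤ c, F b = 0) (v : Fin (c + 1) → V) :
    onWords F (ext 𝒱 R G (word K V c v)) = 0 := by
  refine map_ext_word_eq_zero 𝒱 (S := Set.Ici 1) (Set.mem_Ici.2 le_rfl) (q := 0)
    (fun c hc k hk => ?_) _ (fun b u k hk hs => ?_) v
  · have := le_sum_of_one_le hk
    rw [Set.mem_Ici]
    omega
  · have := le_sum_of_one_le hk
    rw [onWords_word, hF b (by omega)]
    rfl

/-- There are too few letters to feed any nonzero `G b`. The choice `q = -c - 1` makes the total
degree zero, which no nonempty word with letters of positive degree has; a nonzero `G c'` has `c' >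
c`, so its values still get degree at least one. -/
theorem ext_word_eq_zero (R : Deg n) {G : MultSeq K V} {c : ℕ}
    (hG : ∀ b ≤ c, G b = 0) (v : Fin (c + 1) → V) :
    ext 𝒱 R G (word K V c v) = 0 := by
  refine map_ext_word_eq_zero 𝒱 (S := Set.Ici 1) (Set.mem_Ici.2 le_rfl) (q := -c - 1)
    (fun c' hc k hk => ?_) LinearMap.id (fun b u k hk hs => ?_) v
  · have := le_sum_of_one_le hk
    have : c < c' := by
      by_contra hcc
      exact hc (hG c' (not_lt.1 hcc))
    rw [Set.mem_Ici]
    omega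
  · have := le_sum_of_one_le hk
    omega

end Length

/-! ### A coderivation is determined by its corestrictions. -/

section Uniqueness

variable {n : ℕ} {K V : Type*} [Field K] [AddCommGroup V] [Module K V]
  (𝒱 : Deg n → Submodule K V) [DirectSum.Decomposition 𝒱]

theorem sum_eq_of_mem_one {p : ℕ} {k : Fin p → ℤ} (hk : ∀ i, k i ∈ ({1} : Set ℤ)) :
    ∑ i, k i = p := by
  simp only [Set.mem_singleton_iff] at hk
  simp [hk]

theorem coderivation_sub {M : Type*} [AddCommGroup M] [Module K M] {Δ : M →ₗ[K] M ⊗[K] M}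
    {P f g : Module.End K M}
    (hf : Δ ∘ₗ f = (TensorProduct.map f LinearMap.id + TensorProduct.map P f) ∘ₗ Δ)
    (hg : Δ ∘ₗ g = (TensorProduct.map g LinearMap.id + TensorProduct.map P g) ∘ₗ Δ) :
    Δ ∘ₗ (f - g) =
      (TensorProduct.map (f - g) LinearMap.id + TensorProduct.map P (f - g)) ∘ₗ Δ := by
  rw [LinearMap.comp_sub, hf, hg, ← LinearMap.sub_comp]
  congr 1
  refine TensorProduct.ext' fun x y => ?_
  simp only [LinearMap.sub_apply, LinearMap.add_apply, TensorProduct.map_tmul,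
    TensorProduct.sub_tmul, TensorProduct.tmul_sub]
  abel

/-- A coderivation with vanishing corestrictions vanishes. -/
theorem eq_zero_of_pr_comp_eq_zero {Q : Deg n} {f : Module.End K (T K V)}
    (hf : coprod 𝒱 ∘ₗ f =
      (TensorProduct.map f LinearMap.id + TensorProduct.map (parity 𝒱 Q) f) ∘ₗ coprod 𝒱)
    (hpr : pr K V ∘ₗ f = 0) : f = 0 := by
  refine T_ext fun c => ?_
  induction c using Nat.strong_induction_on with | _ c ih
  have hw : ∀ b < c, ∀ u, f (word K V b u) = 0 := fun b hb u => congrArg (fun F => F u) (ih b hb)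
  have hA : ∀ m : ℤ, m ≤ c → ∀ a ∈ gradA (letterGr K V {1}) m, f (toRed K V a) = 0 := by
    intro m hm a ha
    refine map_eq_zero_of_mem_gradA (f ∘ₗ toRed K V) (fun p u k hk hs => ?_) ha
    rw [sum_eq_of_mem_one hk] at hs
    cases p with
    | zero => simp
    | succ b =>
      rw [LinearMap.comp_apply, toRed_tprod]
      exact hw b (by omega) u
  refine multilinearMap_ext_hom 𝒱 fun d v hv => ?_
  have hz : ∀ z ∈ gradA₂ (letterGr K V {1}) (c : ℤ),
      (TensorProduct.map f LinearMap.id + TensorProduct.map (parity 𝒱 Q) f :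
          T K V ⊗[K] T K V →ₗ[K] T K V ⊗[K] T K V)
        (TensorProduct.map (toRed K V) (toRed K V) (appendRight K V (v (Fin.last c)) z)) = 0 := by
    intro z hz
    induction hz using Submodule.span_induction with
    | zero => simp
    | add x y _ _ hx hy => simp only [map_add, hx, hy, add_zero]
    | smul r x _ hx => simp only [map_smul, hx, smul_zero]
    | mem x hx =>
      obtain ⟨α, β, a, b, ha, hb, hαβ, rfl⟩ := hx
      simp only [appendRight_tmul, TensorProduct.map_tmul, LinearMap.add_apply,
        LinearMap.id_apply]
      -- Degrees are integers here, so lengths `α ≤ 0` and `β < 0` must be disposed of: the former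
      -- give at most a scalar, killed by `toRed`, the latter nothing.
      by_cases hα : α ≤ 0
      · have : toRed K V a = 0 := by
          refine map_eq_zero_of_mem_gradA (toRed K V) (fun p u k hk hs => ?_) ha
          rw [sum_eq_of_mem_one hk] at hs
          obtain rfl : p = 0 := by omega
          simp
        simp [this]
      by_cases hβ : β < 0
      · have : b = 0 := by
          refine map_eq_zero_of_mem_gradA LinearMap.id (fun p u k hk hs => ?_) hb
          rw [sum_eq_of_mem_one hk] at hs
          omega
        simp [this]
      -- Now `1 ≤ α ≤ c` and `β + 1 ≤ c`, so both factors are shorter than the word of `c + 1`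
      -- letters and the induction hypothesis applies.
      rw [hA α (by omega) a ha, hA (β + 1) (by omega) _
        (mul_ι_mem_gradA hb (mem_letterGr.2 (Or.inl rfl))), TensorProduct.zero_tmul,
        TensorProduct.tmul_zero, add_zero]
  have hδ := unshuffle_tprod_mem_gradA₂ 𝒱 (parV_mem_letterGr 𝒱 {1})
    (fun i : Fin c => d i.castSucc) (fun _ => 1) (fun i => v i.castSucc) (fun i => hv _)
    fun i => mem_letterGr.2 (Or.inl rfl)
  have hcf := congrArg (fun F => F (word K V c v)) hf
  simp only [LinearMap.comp_apply] at hcf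
  rw [← toRed_tprod_mul_ι, coprod_toRed_mul_ι, hz _ (by simpa using hδ)] at hcf
  have h0 : pr K V (f (word K V c v)) = 0 := congrArg (fun F => F (word K V c v)) hpr
  have := coprodRetract_coprod 𝒱 (f (word K V c v))
  rw [h0, ← toRed_tprod_mul_ι, hcf] at this
  rw [toRed_tprod_mul_ι] at this
  simpa using this.symm

theorem CoDer_ext {Q : Deg n} {f g : Module.End K (T K V)} (hf : f ∈ CoDer 𝒱 Q)
    (hg : g ∈ CoDer 𝒱 Q) (h : corestr f = corestr g) : f = g := by
  rw [← sub_eq_zero]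
  refine eq_zero_of_pr_comp_eq_zero 𝒱 (Q := Q) ?_ ?_
  · exact coderivation_sub (M := T K V) hf.2 hg.2
  · refine T_ext fun c => ?_
    have := congrFun h c
    refine MultilinearMap.ext fun v => ?_
    have := congrArg (fun F => F v) this
    simp only [corestr, LinearMap.coe_mk, AddHom.coe_mk, LinearMap.compMultilinearMap_apply,
      LinearMap.comp_apply] at this
    simp [this]

theorem ext_corestr {Q : Deg n} {f : Module.End K (T K V)} (hf : f ∈ CoDer 𝒱 Q)
    (hw : ∀ c, corestr f c ∈ Weight 𝒱 Q) : ext 𝒱 Q (corestr f) = f :=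
  CoDer_ext 𝒱 (ext_mem_CoDer 𝒱 hw) hf (corestr_ext 𝒱 Q _)

end Uniqueness

/-! ### Linearity of the extension. -/

section Linear

variable {n : ℕ} {K V : Type*} [Field K] [AddCommGroup V] [Module K V]
  (𝒱 : Deg n → Submodule K V) [DirectSum.Decomposition 𝒱] (Q : Deg n)

theorem contract_add (F G : TensorAlgebra K V →ₗ[K] V) :
    contract 𝒱 Q (F + G) = contract 𝒱 Q F + contract 𝒱 Q G := by
  refine TensorProduct.ext' fun a b => ?_
  simp [mul_add]

theorem contract_smul (r : K) (F : TensorAlgebra K V →ₗ[K] V) :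
    contract 𝒱 Q (r • F) = r • contract 𝒱 Q F := by
  refine TensorProduct.ext' fun a b => ?_
  simp

theorem coderA_add (F G : TensorAlgebra K V →ₗ[K] V) :
    coderA 𝒱 Q (F + G) = coderA 𝒱 Q F + coderA 𝒱 Q G := by
  refine tensorAlgebra_ext_mul 𝒱 (by simp [coderA_one]) fun x hx d v _ => ?_
  simp only [LinearMap.add_apply, coderA_mul_ι, contract_add] at hx ⊢
  rw [hx, add_mul]
  abel

theorem coderA_smul (r : K) (F : TensorAlgebra K V →ₗ[K] V) :
    coderA 𝒱 Q (r • F) = r • coderA 𝒱 Q F := by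
  refine tensorAlgebra_ext_mul 𝒱 (by simp [coderA_one]) fun x hx d v _ => ?_
  simp only [LinearMap.smul_apply, coderA_mul_ι, contract_smul] at hx ⊢
  rw [hx, smul_mul_assoc, smul_add]

theorem onWords_add (F G : MultSeq K V) : onWords (F + G) = onWords F + onWords G := by
  refine T_ext fun c => MultilinearMap.ext fun v => ?_
  simp [onWords_word]

theorem onWords_smul (r : K) (F : MultSeq K V) : onWords (r • F) = r • onWords F := by
  refine T_ext fun c => MultilinearMap.ext fun v => ?_
  simp [onWords_word]

theorem ext_isLinearMap : IsLinearMap K (ext 𝒱 Q) where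
  map_add F G := by
    refine T_ext_toRed fun x v => ?_
    rw [LinearMap.add_apply, ext_toRed, ext_toRed, ext_toRed, onWords_add, LinearMap.add_comp,
      coderA_add, LinearMap.add_apply, map_add]
  map_smul r F := by
    refine T_ext_toRed fun x v => ?_
    rw [LinearMap.smul_apply, ext_toRed, ext_toRed, onWords_smul, LinearMap.smul_comp,
      coderA_smul, LinearMap.smul_apply, map_smul]

end Linear

/-! ### Graded commutators of endomorphisms and of coderivations. -/

section Commutator

variable {n : ℕ} {K V : Type*} [Field K] [AddCommGroup V] [Module K V]

section GradedCommutator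

variable {M : Type*} [AddCommGroup M] [Module K M]

/-- The commutator `f g - u g f` of endomorphisms of a module. -/
def gcomm (u : ℤˣ) (f g : Module.End K M) : Module.End K M := f * g - u • (g * f)

theorem gcomm_add_left (u : ℤˣ) (f f' g : Module.End K M) :
    gcomm u (f + f') g = gcomm u f g + gcomm u f' g := by
  simp only [gcomm, add_mul, mul_add, smul_add]
  abel

theorem gcomm_add_right (u : ℤˣ) (f g g' : Module.End K M) :
    gcomm u f (g + g') = gcomm u f g + gcomm u f g' := by
  simp only [gcomm, add_mul, mul_add, smul_add]
  abel

theorem gcomm_smul_left (u : ℤˣ) (r : K) (f g : Module.End K M) :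
    gcomm u (r • f) g = r • gcomm u f g := by
  simp only [gcomm, smul_mul_assoc, mul_smul_comm, smul_sub, smul_comm r]

theorem gcomm_smul_right (u : ℤˣ) (r : K) (f g : Module.End K M) :
    gcomm u f (r • g) = r • gcomm u f g := by
  simp only [gcomm, smul_mul_assoc, mul_smul_comm, smul_sub, smul_comm r]

theorem gcomm_antisymm (u : ℤˣ) (f g : Module.End K M) :
    gcomm u f g = (-u) • gcomm u g f := by
  rw [Units.neg_smul, gcomm, gcomm, smul_sub, smul_smul, Int.units_mul_self, one_smul, neg_sub]

/-- `a`, `b`, `c` are the signs of the pairs `(f, g)`, `(f, h)`, `(g, h)`. For each of their eight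
values this is an identity in the free associative ring. -/
theorem gcomm_jacobi (a b c : ℤˣ) (f g h : Module.End K M) :
    gcomm (a * b) f (gcomm c g h) =
      gcomm (b * c) (gcomm a f g) h + a • gcomm (a * c) g (gcomm b f h) := by
  rcases Int.units_eq_one_or a with rfl | rfl <;> rcases Int.units_eq_one_or b with rfl | rfl <;>
    rcases Int.units_eq_one_or c with rfl | rfl <;>
    simp only [gcomm, one_smul, mul_one, Units.neg_smul, mul_neg, neg_neg] <;>
    noncomm_ring

/-- The mixed terms, with `f` on one factor and `g` on the other, occur in both products and cancel
by the sign rules `hP` and `hR`. -/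
theorem coderivation_gcomm {Δ : M →ₗ[K] M ⊗[K] M} {P R f g : Module.End K M} (u : ℤˣ)
    (hf : Δ ∘ₗ f = (TensorProduct.map f LinearMap.id + TensorProduct.map P f) ∘ₗ Δ)
    (hg : Δ ∘ₗ g = (TensorProduct.map g LinearMap.id + TensorProduct.map R g) ∘ₗ Δ)
    (hP : P ∘ₗ g = u • (g ∘ₗ P)) (hR : R ∘ₗ f = u • (f ∘ₗ R)) (hPR : R ∘ₗ P = P ∘ₗ R) :
    Δ ∘ₗ gcomm u f g = (TensorProduct.map (gcomm u f g) LinearMap.id +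
      TensorProduct.map (P ∘ₗ R) (gcomm u f g)) ∘ₗ Δ := by
  have hf' : ∀ x, Δ (f x) = (TensorProduct.map f LinearMap.id + TensorProduct.map P f :
    M ⊗[K] M →ₗ[K] M ⊗[K] M) (Δ x) := fun x => congrArg (fun F => F x) hf
  have hg' : ∀ x, Δ (g x) = (TensorProduct.map g LinearMap.id + TensorProduct.map R g :
    M ⊗[K] M →ₗ[K] M ⊗[K] M) (Δ x) := fun x => congrArg (fun F => F x) hg
  have hP' : ∀ x, P (g x) = u • g (P x) := fun x => congrArg (fun F => F x) hP
  have hR' : ∀ x, R (f x) = u • f (R x) := fun x => congrArg (fun F => F x) hR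
  have hPR' : ∀ x, R (P x) = P (R x) := fun x => congrArg (fun F => F x) hPR
  ext x
  simp only [gcomm, LinearMap.comp_apply, LinearMap.sub_apply, LinearMap.smul_apply,
    Module.End.mul_apply, map_sub, map_units_smul, hf', hg']
  generalize Δ x = z
  induction z using TensorProduct.induction_on with
  | zero => simp
  | add a b ha hb =>
    simp only [map_add, smul_add] at ha hb ⊢
    rw [← ha, ← hb]
    abel
  | tmul a b =>
    simp only [LinearMap.add_apply, TensorProduct.map_tmul, map_add, LinearMap.id_apply, hP', hR',
      hPR', LinearMap.sub_apply, LinearMap.smul_apply, Module.End.mul_apply,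
      LinearMap.comp_apply]
    rcases Int.units_eq_one_or u with rfl | rfl
    · simp only [one_smul, TensorProduct.sub_tmul, TensorProduct.tmul_sub]
      abel
    · simp only [Units.neg_smul, one_smul, TensorProduct.neg_tmul, neg_add, neg_neg, sub_neg_eq_add,
        TensorProduct.add_tmul, TensorProduct.tmul_add]
      abel

end GradedCommutator

theorem comm_add_left (Q R : Deg n) (f f' g : Module.End K (T K V)) :
    comm Q R (f + f') g = comm Q R f g + comm Q R f' g :=
  gcomm_add_left (M := T K V) _ f f' g

theorem comm_add_right (Q R : Deg n) (f g g' : Module.End K (T K V)) :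
    comm Q R f (g + g') = comm Q R f g + comm Q R f g' :=
  gcomm_add_right (M := T K V) _ f g g'

theorem comm_smul_left (Q R : Deg n) (r : K) (f g : Module.End K (T K V)) :
    comm Q R (r • f) g = r • comm Q R f g :=
  gcomm_smul_left (M := T K V) _ r f g

theorem comm_smul_right (Q R : Deg n) (r : K) (f g : Module.End K (T K V)) :
    comm Q R f (r • g) = r • comm Q R f g :=
  gcomm_smul_right (M := T K V) _ r f g

theorem comm_antisymm (Q R : Deg n) (f g : Module.End K (T K V)) :
    comm Q R f g = (-sgn (pair Q R)) • comm R Q g f := by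
  rw [comm.eq_def R Q, pair_comm R Q]
  exact gcomm_antisymm (M := T K V) _ f g

theorem comm_jacobi (Q R S : Deg n) (f g h : Module.End K (T K V)) :
    comm Q (R + S) f (comm R S g h) =
      comm (Q + R) S (comm Q R f g) h + sgn (pair Q R) • comm R (Q + S) g (comm Q S f h) := by
  simp only [comm, pair_add_left, pair_add_right, sgn_add, pair_comm R Q]
  exact gcomm_jacobi (M := T K V) _ _ _ f g h

variable (𝒱 : Deg n → Submodule K V) [DirectSum.Decomposition 𝒱]

theorem parity_comp {Q R : Deg n} {f : Module.End K (T K V)} (hf : f ∈ CoDer 𝒱 R) :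
    parity 𝒱 Q ∘ₗ f = sgn (pair Q R) • (f ∘ₗ parity 𝒱 Q) := by
  refine T_ext_hom 𝒱 fun c d v hv => ?_
  have hv' := word_mem_TDeg (K := K) 𝒱 d v hv
  rw [LinearMap.smul_apply, LinearMap.comp_apply, LinearMap.comp_apply,
    parity_of_mem_TDeg 𝒱 Q hv', parity_of_mem_TDeg 𝒱 Q (hf.1 _ _ hv'), map_units_smul, smul_smul,
    ← sgn_add, pair_add_right, add_comm]

theorem comm_mem_CoDer {Q R : Deg n} {f g : Module.End K (T K V)} (hf : f ∈ CoDer 𝒱 Q)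
    (hg : g ∈ CoDer 𝒱 R) : comm Q R f g ∈ CoDer 𝒱 (Q + R) := by
  constructor
  · intro α x hx
    refine sub_mem ?_ (sgn_smul_mem _ _ ?_)
    · rw [add_comm Q, ← add_assoc]
      exact hf.1 _ _ (hg.1 _ _ hx)
    · rw [← add_assoc]
      exact hg.1 _ _ (hf.1 _ _ hx)
  · rw [← parity_parity]
    refine coderivation_gcomm (M := T K V) _ hf.2 hg.2 (parity_comp 𝒱 hg) ?_ ?_
    · rw [pair_comm]
      exact parity_comp 𝒱 hf
    · rw [parity_parity, parity_parity, add_comm]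

end Commutator
-- Passage between `V` and its desuspension, and the isomorphisms `φ`.
section Transfer

variable {n : ℕ} {K V : Type*} [Field K] [AddCommGroup V] [Module K V]

section Twist

variable (𝒱 : Deg n → Submodule K V) [DirectSum.Decomposition 𝒱]

theorem twist_mem_Weight {p : ℕ} (s : (Fin p → Deg n) → ℤ) {A : Deg n}
    {f : MultilinearMap K (fun _ : Fin p => V) V} (hf : f ∈ Weight 𝒱 A) :
    twist 𝒱 s f ∈ Weight 𝒱 A := by
  intro d v hv
  rw [twist_apply 𝒱 s f d v hv]
  exact sgn_smul_mem _ _ (hf d v hv)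

theorem twist_add {p : ℕ} (s : (Fin p → Deg n) → ℤ)
    (f g : MultilinearMap K (fun _ : Fin p => V) V) :
    twist 𝒱 s (f + g) = twist 𝒱 s f + twist 𝒱 s g := by
  refine multilinearMap_ext_hom 𝒱 fun d v hv => ?_
  rw [add_apply, twist_apply 𝒱 _ _ d v hv, twist_apply 𝒱 _ _ d v hv, twist_apply 𝒱 _ _ d v hv,
    add_apply, smul_add]

theorem twist_smul {p : ℕ} (s : (Fin p → Deg n) → ℤ) (r : K)
    (f : MultilinearMap K (fun _ : Fin p => V) V) :
    twist 𝒱 s (r • f) = r • twist 𝒱 s f := by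
  refine multilinearMap_ext_hom 𝒱 fun d v hv => ?_
  rw [smul_apply, twist_apply 𝒱 _ _ d v hv, twist_apply 𝒱 _ _ d v hv, smul_apply, smul_comm]

omit [DirectSum.Decomposition 𝒱] in
theorem pr_mem {γ : Deg n} {x : T K V} (hx : x ∈ TDeg 𝒱 γ) : pr K V x ∈ 𝒱 γ := by
  induction hx using Submodule.span_induction with
  | zero => simp
  | add x y _ _ hx hy => rw [map_add]; exact add_mem hx hy
  | smul r x _ hx => rw [map_smul]; exact Submodule.smul_mem _ r hx
  | mem x hx =>
    obtain ⟨c, d, v, hv, rfl, rfl⟩ := hx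
    cases c with
    | zero => simpa [pr_word_zero] using hv 0
    | succ c => simp [pr_word_succ]

theorem corestr_mem_Weight {Q : Deg n} {f : Module.End K (T K V)} (hf : f ∈ CoDer 𝒱 Q) (c : ℕ) :
    corestr f c ∈ Weight 𝒱 Q := by
  intro d v hv
  rw [add_comm]
  exact pr_mem 𝒱 (hf.1 _ _ (word_mem_TDeg 𝒱 d v hv))

end Twist

variable [NeZero n] (𝒱 : Deg n → Submodule K V) [DirectSum.Decomposition 𝒱]

theorem pair_e1_e1 : pair (e1 n) (e1 n) = 1 := by
  simp [pair, e1, Pi.single_apply]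

theorem sum_sub_eq (c : ℕ) :
    ∑ i : Fin (c + 1), ((c : ℤ) - (i : ℕ)) = ((c * (c + 1) / 2 : ℕ) : ℤ) := by
  have h : ∑ i : Fin (c + 1), ((c : ℤ) - (i : ℕ)) = ∑ i : Fin (c + 1), ((i : ℕ) : ℤ) := by
    rw [← Fin.revPerm.sum_comp _ _ (by simp)]
    refine Finset.sum_congr rfl fun i _ => ?_
    have := i.is_le
    simp only [Fin.revPerm_apply, Fin.val_rev]
    omega
  rw [h, Fin.sum_univ_eq_sum_range (fun i => (i : ℤ)), ← Nat.cast_sum, Finset.sum_range_id]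
  simp [mul_comm]

theorem sum_add_e1 {c : ℕ} (d : Fin (c + 1) → Deg n) :
    ∑ i, (d i + e1 n) = ∑ i, d i + ((c : ℤ) • e1 n + e1 n) := by
  rw [Finset.sum_add_distrib]
  simp [add_smul]

omit [DirectSum.Decomposition 𝒱] in
theorem mem_desusp_iff (α : Deg n) (v : V) : v ∈ desusp 𝒱 (α - e1 n) ↔ v ∈ 𝒱 α := by
  rw [desusp, sub_add_cancel]

/-- Degrees in `↓V` are lower by `e₁`, which changes the exponent by `∑ (p - s) = p(p-1)/2`; the
prefactor in `sigmaInv` compensates exactly this. -/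
theorem sigmaInv_apply (F : MultSeq K V) {c : ℕ} (d : Fin (c + 1) → Deg n)
    (v : Fin (c + 1) → V) (hv : ∀ i, v i ∈ 𝒱 (d i)) :
    sigmaInv 𝒱 F c v =
      sgn (∑ i : Fin (c + 1), ((c : ℤ) - (i : ℕ)) * pair (e1 n) (d i)) • F c v := by
  rw [sigmaInv, smul_apply, twist_apply (desusp 𝒱) _ _ (fun i => d i - e1 n) v
    fun i => (mem_desusp_iff 𝒱 _ _).2 (hv i), smul_smul, ← sgn_add]
  congr 1
  refine sgn_eq_of_even_sub ⟨0, ?_⟩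
  simp only [pair_sub_right, pair_e1_e1, mul_sub, mul_one]
  rw [Finset.sum_sub_distrib, sum_sub_eq]
  ring

theorem sigma_apply (F : MultSeq K V) {c : ℕ} (d : Fin (c + 1) → Deg n)
    (v : Fin (c + 1) → V) (hv : ∀ i, v i ∈ 𝒱 (d i)) :
    sigma 𝒱 F c v =
      sgn (∑ i : Fin (c + 1), ((c : ℤ) - (i : ℕ)) * pair (e1 n) (d i)) • F c v :=
  twist_apply 𝒱 _ _ d v hv

/-- Read on degrees in `V`, both are the same operator of signs, hence an involution. -/
theorem sigma_eq_sigmaInv : sigma (K := K) 𝒱 = sigmaInv 𝒱 := by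
  funext F c
  refine multilinearMap_ext_hom 𝒱 fun d v hv => ?_
  rw [sigma_apply 𝒱 F d v hv, sigmaInv_apply 𝒱 F d v hv]

theorem sigma_sigmaInv (F : MultSeq K V) : sigma 𝒱 (sigmaInv 𝒱 F) = F := by
  funext c
  refine multilinearMap_ext_hom 𝒱 fun d v hv => ?_
  rw [sigma_apply 𝒱 _ d v hv, sigmaInv_apply 𝒱 F d v hv, smul_smul, sgn_mul_self, one_smul]

theorem sigmaInv_sigma (F : MultSeq K V) : sigmaInv 𝒱 (sigma 𝒱 F) = F := by
  rw [← sigma_eq_sigmaInv, sigma_eq_sigmaInv, ← sigma_eq_sigmaInv]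
  nth_rw 2 [sigma_eq_sigmaInv]
  exact sigma_sigmaInv 𝒱 F

theorem sigma_isLinearMap : IsLinearMap K (sigma (K := K) 𝒱) where
  map_add _ _ := funext fun _ => twist_add 𝒱 _ _ _
  map_smul r _ := funext fun _ => twist_smul 𝒱 _ r _

theorem sigma_apply_eq_zero {F : MultSeq K V} {c : ℕ} (h : F c = 0) : sigma 𝒱 F c = 0 := by
  refine multilinearMap_ext_hom 𝒱 fun d v hv => ?_
  rw [sigma_apply 𝒱 F d v hv, h]
  simp

theorem sigmaInv_mem_Weight {Q : Deg n} {F : MultSeq K V} (hF : F ∈ C 𝒱 Q) (c : ℕ) :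
    sigmaInv 𝒱 F c ∈ Weight (desusp 𝒱) Q := by
  refine sgn_smul_mem _ _ (twist_mem_Weight _ _ fun d v hv => ?_)
  have := hF c (fun i => d i + e1 n) v hv
  rw [sum_add_e1] at this
  rw [desusp]
  convert this using 2
  abel

theorem sigma_mem_C {Q : Deg n} {F : MultSeq K V} (hF : ∀ c, F c ∈ Weight (desusp 𝒱) Q) :
    sigma 𝒱 F ∈ C 𝒱 Q := by
  refine fun c => twist_mem_Weight _ _ fun d v hv => ?_
  have := hF c (fun i => d i - e1 n) v fun i => (mem_desusp_iff 𝒱 _ _).2 (hv i)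
  rw [desusp] at this
  have hs := sum_add_e1 fun i => d i - e1 n
  simp only [sub_add_cancel] at hs
  rw [hs]
  convert this using 2
  abel

theorem sigmaInv_isLinearMap : IsLinearMap K (sigmaInv (K := K) 𝒱) :=
  sigma_eq_sigmaInv (K := K) 𝒱 ▸ sigma_isLinearMap 𝒱

theorem phi_isLinearMap (Q : Deg n) : IsLinearMap K (phi (K := K) 𝒱 Q) where
  map_add F G := (congrArg (ext _ Q) ((sigmaInv_isLinearMap 𝒱).map_add F G)).trans
    ((ext_isLinearMap _ Q).map_add _ _)
  map_smul r F := (congrArg (ext _ Q) ((sigmaInv_isLinearMap 𝒱).map_smul r F)).trans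
    ((ext_isLinearMap _ Q).map_smul r _)

theorem phiInv_isLinearMap : IsLinearMap K (phiInv (K := K) 𝒱) where
  map_add f g := by rw [phiInv, map_add, (sigma_isLinearMap 𝒱).map_add]; rfl
  map_smul r f := by rw [phiInv, map_smul, (sigma_isLinearMap 𝒱).map_smul]; rfl

theorem phiInv_phi (Q : Deg n) (F : MultSeq K V) : phiInv 𝒱 (phi 𝒱 Q F) = F := by
  rw [phiInv, phi, corestr_ext, sigma_sigmaInv]

theorem phi_mem_CoDer {Q : Deg n} {F : MultSeq K V} (hF : F ∈ C 𝒱 Q) :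
    phi 𝒱 Q F ∈ CoDer (desusp 𝒱) Q :=
  ext_mem_CoDer _ (sigmaInv_mem_Weight 𝒱 hF)

theorem phiInv_mem_C {Q : Deg n} {f : Module.End K (T K V)} (hf : f ∈ CoDer (desusp 𝒱) Q) :
    phiInv 𝒱 f ∈ C 𝒱 Q :=
  sigma_mem_C 𝒱 (corestr_mem_Weight _ hf)

theorem phi_phiInv {Q : Deg n} {f : Module.End K (T K V)} (hf : f ∈ CoDer (desusp 𝒱) Q) :
    phi 𝒱 Q (phiInv 𝒱 f) = f := by
  rw [phi, phiInv, sigmaInv_sigma]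
  exact ext_corestr _ hf (corestr_mem_Weight _ hf)

theorem phi_invOn (Q : Deg n) :
    Set.InvOn (phiInv 𝒱) (phi 𝒱 Q) (C 𝒱 Q : Set (MultSeq K V)) (CoDer (desusp 𝒱) Q) :=
  ⟨fun F _ => phiInv_phi 𝒱 Q F, fun _ hf => phi_phiInv 𝒱 hf⟩

theorem phi_bijOn (Q : Deg n) :
    Set.BijOn (phi 𝒱 Q) (C 𝒱 Q : Set (MultSeq K V)) (CoDer (desusp 𝒱) Q) :=
  (phi_invOn 𝒱 Q).bijOn (fun _ hF => phi_mem_CoDer 𝒱 hF) fun _ hf => phiInv_mem_C 𝒱 hf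

omit [DirectSum.Decomposition 𝒱] in
-- At the place `c = a` the weight `A + a e₁ - c e₁` is `A`; at the others the entry is zero and the
-- weight is immaterial.
theorem mem_Mr_iff {d : Deg n × ℤ} {F : MultSeq K V} :
    F ∈ Mr 𝒱 d ↔ F ∈ C 𝒱 (totalDeg d) ∧ ∀ c : ℕ, (c : ℤ) ≠ d.2 → F c = 0 := by
  constructor
  · refine fun h => ⟨fun c => ?_, fun c => (h c).2⟩
    by_cases hc : (c : ℤ) = d.2
    · have := (h c).1
      rwa [totalDeg, hc, add_sub_cancel_right]
    · rw [(h c).2 hc]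
      exact zero_mem _
  · refine fun h c => ⟨?_, h.2 c⟩
    by_cases hc : (c : ℤ) = d.2
    · have := h.1 c
      rwa [totalDeg, hc, add_sub_cancel_right] at this
    · rw [h.2 c hc]
      exact zero_mem _

theorem phi_bijOn_Mr (d : Deg n × ℤ) :
    Set.BijOn (phi 𝒱 (totalDeg d)) (Mr 𝒱 d : Set (MultSeq K V))
      (CoDerAt (desusp 𝒱) (totalDeg d) d.2) := by
  have h : Set.InvOn (phiInv 𝒱) (phi 𝒱 (totalDeg d)) (Mr 𝒱 d : Set (MultSeq K V))
      (CoDerAt (desusp 𝒱) (totalDeg d) d.2) :=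
    ⟨fun F _ => phiInv_phi 𝒱 _ F, fun _ hf => phi_phiInv 𝒱 hf.1⟩
  refine h.bijOn (fun F hF => ?_) fun f hf => ?_
  · have hF' := (mem_Mr_iff 𝒱).1 hF
    refine ⟨phi_mem_CoDer 𝒱 hF'.1, fun c hc => ?_⟩
    rw [phi, corestr_ext, ← sigma_eq_sigmaInv, sigma_apply_eq_zero 𝒱 (hF'.2 c hc)]
  · exact (mem_Mr_iff 𝒱).2 ⟨phiInv_mem_C 𝒱 hf.1,
      fun c hc => sigma_apply_eq_zero 𝒱 (hf.2 c hc)⟩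

end Transfer

/-! ### The transferred bracket and its dependence on the components. -/

section StemBar

variable {n : ℕ} [NeZero n] {K V : Type*} [Field K] [AddCommGroup V] [Module K V]
  (𝒱 : Deg n → Submodule K V) [DirectSum.Decomposition 𝒱] (Q R : Deg n)

/-- The bracket `stemBar` as a bilinear map. -/
noncomputable def stemBarₗ : MultSeq K V →ₗ[K] MultSeq K V →ₗ[K] MultSeq K V :=
  LinearMap.mk₂ K (stemBar 𝒱 Q R)
    (fun _ _ _ => by
      rw [stemBar, (phi_isLinearMap 𝒱 Q).map_add, comm_add_left, (phiInv_isLinearMap 𝒱).map_add]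
      rfl)
    (fun _ _ _ => by
      rw [stemBar, (phi_isLinearMap 𝒱 Q).map_smul, comm_smul_left,
        (phiInv_isLinearMap 𝒱).map_smul]
      rfl)
    (fun _ _ _ => by
      rw [stemBar, (phi_isLinearMap 𝒱 R).map_add, comm_add_right, (phiInv_isLinearMap 𝒱).map_add]
      rfl)
    (fun _ _ _ => by
      rw [stemBar, (phi_isLinearMap 𝒱 R).map_smul, comm_smul_right,
        (phiInv_isLinearMap 𝒱).map_smul]
      rfl)

theorem stemBarₗ_apply (π ρ : MultSeq K V) : stemBarₗ 𝒱 Q R π ρ = stemBar 𝒱 Q R π ρ := rfl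

theorem stemBar_units_smul_left (u : ℤˣ) (π ρ : MultSeq K V) :
    stemBar 𝒱 Q R (u • π) ρ = u • stemBar 𝒱 Q R π ρ := by
  rw [← stemBarₗ_apply, map_units_smul]
  rfl

theorem stemBar_units_smul_right (u : ℤˣ) (π ρ : MultSeq K V) :
    stemBar 𝒱 Q R π (u • ρ) = u • stemBar 𝒱 Q R π ρ := by
  rw [← stemBarₗ_apply, map_units_smul]
  rfl

variable {Q R} in
theorem phi_stemBar {π ρ : MultSeq K V} (hπ : π ∈ C 𝒱 Q) (hρ : ρ ∈ C 𝒱 R) :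
    phi 𝒱 (Q + R) (stemBar 𝒱 Q R π ρ) = comm Q R (phi 𝒱 Q π) (phi 𝒱 R ρ) :=
  phi_phiInv 𝒱 (comm_mem_CoDer _ (phi_mem_CoDer 𝒱 hπ) (phi_mem_CoDer 𝒱 hρ))

variable {Q R} in
theorem stemBar_mem_C {π ρ : MultSeq K V} (hπ : π ∈ C 𝒱 Q) (hρ : ρ ∈ C 𝒱 R) :
    stemBar 𝒱 Q R π ρ ∈ C 𝒱 (Q + R) :=
  phiInv_mem_C 𝒱 (comm_mem_CoDer _ (phi_mem_CoDer 𝒱 hπ) (phi_mem_CoDer 𝒱 hρ))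

theorem phiInv_units_smul (u : ℤˣ) (f : Module.End K (T K V)) :
    phiInv 𝒱 (u • f) = u • phiInv 𝒱 f :=
  map_units_smul (M := Module.End K (T K V)) (phiInv_isLinearMap (K := K) 𝒱).mk' u f

theorem stemBar_antisymm (π ρ : MultSeq K V) :
    stemBar 𝒱 Q R π ρ = -(sgn (pair Q R) • stemBar 𝒱 R Q ρ π) := by
  rw [stemBar, comm_antisymm, phiInv_units_smul, Units.neg_smul]
  rfl

variable {Q R} in
theorem stemBar_jacobi {S : Deg n} {π ρ τ : MultSeq K V} (hπ : π ∈ C 𝒱 Q) (hρ : ρ ∈ C 𝒱 R)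
    (hτ : τ ∈ C 𝒱 S) :
    stemBar 𝒱 Q (R + S) π (stemBar 𝒱 R S ρ τ) =
      stemBar 𝒱 (Q + R) S (stemBar 𝒱 Q R π ρ) τ +
        sgn (pair Q R) • stemBar 𝒱 R (Q + S) ρ (stemBar 𝒱 Q S π τ) := by
  rw [stemBar, phi_stemBar 𝒱 hρ hτ, comm_jacobi, (phiInv_isLinearMap 𝒱).map_add,
    phiInv_units_smul, stemBar.eq_def 𝒱 (Q + R), phi_stemBar 𝒱 hπ hρ,
    stemBar.eq_def 𝒱 R (Q + S), phi_stemBar 𝒱 hπ hτ]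

omit [NeZero n] in
theorem corestr_comm (f g : Module.End K (T K V)) (c : ℕ) :
    corestr (comm Q R f g) c = corestr (f * g) c - sgn (pair Q R) • corestr (g * f) c := by
  refine MultilinearMap.ext fun v => ?_
  change pr K V (f (g (word K V c v)) - sgn (pair Q R) • g (f (word K V c v))) =
    pr K V (f (g (word K V c v))) - sgn (pair Q R) • pr K V (g (f (word K V c v)))
  rw [map_sub, map_units_smul]

theorem stemBar_apply_eq_zero {π ρ : MultSeq K V} {c : ℕ}
    (h1 : corestr (phi 𝒱 Q π * phi 𝒱 R ρ) c = 0) (h2 : corestr (phi 𝒱 R ρ * phi 𝒱 Q π) c = 0) :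
    stemBar 𝒱 Q R π ρ c = 0 := by
  refine sigma_apply_eq_zero 𝒱 ?_
  rw [corestr_comm, h1, h2, smul_zero, sub_zero]

theorem sigmaInv_apply_eq_zero {F : MultSeq K V} {c : ℕ} (h : F c = 0) : sigmaInv 𝒱 F c = 0 := by
  rw [← sigma_eq_sigmaInv, sigma_apply_eq_zero 𝒱 h]

/-- If `π` acts last it meets words no longer than the input, on which it vanishes; if it acts first
its extension already annihilates the input. -/
theorem stemBar_eq_zero_left {π : MultSeq K V} (ρ : MultSeq K V) {c : ℕ}
    (h : ∀ b ≤ c, π b = 0) : stemBar 𝒱 Q R π ρ c = 0 := by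
  have h' : ∀ b ≤ c, sigmaInv 𝒱 π b = 0 := fun b hb => sigmaInv_apply_eq_zero 𝒱 (h b hb)
  refine stemBar_apply_eq_zero 𝒱 Q R (MultilinearMap.ext fun v => ?_)
    (MultilinearMap.ext fun v => ?_)
  · rw [phi, corestr_ext_mul]
    exact onWords_ext_word_eq_zero _ R _ h' v
  · rw [phi, corestr_ext_mul, phi, ext_word_eq_zero _ Q h' v, map_zero]
    rfl

theorem stemBar_eq_zero_right (π : MultSeq K V) {ρ : MultSeq K V} {c : ℕ}
    (h : ∀ b ≤ c, ρ b = 0) : stemBar 𝒱 Q R π ρ c = 0 := by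
  rw [stemBar_antisymm, Pi.neg_apply, Pi.smul_apply, stemBar_eq_zero_left 𝒱 R Q π h, smul_zero,
    neg_zero]

theorem sigmaInv_single (a : ℕ) (F : MultilinearMap K (fun _ : Fin (a + 1) => V) V) :
    sigmaInv 𝒱 (Pi.single a F) = Pi.single a (sigmaInv 𝒱 (Pi.single a F) a) := by
  funext c
  by_cases h : c = a
  · subst h; rw [Pi.single_eq_same]
  · rw [Pi.single_eq_of_ne h, sigmaInv_apply_eq_zero 𝒱 (Pi.single_eq_of_ne h _)]

theorem stemBar_single_single {a b c : ℕ} (h : a + b ≠ c)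
    (F : MultilinearMap K (fun _ : Fin (a + 1) => V) V)
    (G : MultilinearMap K (fun _ : Fin (b + 1) => V) V) :
    stemBar 𝒱 Q R (Pi.single a F) (Pi.single b G) c = 0 := by
  obtain ⟨F', hF⟩ : ∃ F', sigmaInv 𝒱 (Pi.single a F) = Pi.single a F' :=
    ⟨_, sigmaInv_single 𝒱 a F⟩
  obtain ⟨G', hG⟩ : ∃ G', sigmaInv 𝒱 (Pi.single b G) = Pi.single b G' :=
    ⟨_, sigmaInv_single 𝒱 b G⟩
  refine stemBar_apply_eq_zero 𝒱 Q R ?_ ?_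
  · rw [phi, phi, hF, hG]
    exact corestr_ext_single_mul _ Q R h F' G'
  · rw [phi, phi, hF, hG]
    exact corestr_ext_single_mul _ R Q (by omega) G' F'

theorem sub_sum_single (F : MultSeq K V) {b c : ℕ} (h : b ≤ c) :
    (F - ∑ a ∈ Finset.range (c + 1), Pi.single a (F a)) b = 0 := by
  rw [Pi.sub_apply, Finset.sum_apply, Finset.sum_eq_single b, Pi.single_eq_same, sub_self]
  · intro a _ hab
    exact Pi.single_eq_of_ne hab.symm _
  · intro hb
    exact absurd (Finset.mem_range.2 (by omega)) hb

/-- Entries beyond place `c` do not contribute, so both sequences may be truncated to finite sums.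
Bilinearity leaves pairs of places, of which only those with sum `c` survive. -/
theorem stemBar_apply_eq_sum (π ρ : MultSeq K V) (c : ℕ) :
    stemBar 𝒱 Q R π ρ c = ∑ st ∈ Finset.HasAntidiagonal.antidiagonal c,
      stemBar 𝒱 Q R (Pi.single st.1 (π st.1)) (Pi.single st.2 (ρ st.2)) c := by
  have h1 : stemBar 𝒱 Q R π ρ c =
      stemBar 𝒱 Q R (∑ a ∈ Finset.range (c + 1), Pi.single a (π a)) ρ c := by
    have := stemBar_eq_zero_left 𝒱 Q R ρ fun b => sub_sum_single π (b := b) (c := c)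
    rwa [← stemBarₗ_apply, map_sub, LinearMap.sub_apply, Pi.sub_apply, sub_eq_zero] at this
  have h2 : ∀ a, stemBar 𝒱 Q R (Pi.single a (π a)) ρ c = stemBar 𝒱 Q R (Pi.single a (π a))
      (∑ b ∈ Finset.range (c + 1), Pi.single b (ρ b)) c := by
    intro a
    have := stemBar_eq_zero_right 𝒱 Q R (Pi.single a (π a))
      fun b => sub_sum_single ρ (b := b) (c := c)
    rwa [← stemBarₗ_apply, map_sub, Pi.sub_apply, sub_eq_zero] at this
  rw [h1, ← stemBarₗ_apply, map_sum, LinearMap.sum_apply, Finset.sum_apply]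
  simp only [stemBarₗ_apply, h2]
  simp only [← stemBarₗ_apply, map_sum, Finset.sum_apply]
  rw [← Finset.sum_product', ← Finset.sum_subset (s₁ := Finset.HasAntidiagonal.antidiagonal c)]
  · intro st hst
    have := Finset.HasAntidiagonal.mem_antidiagonal.1 hst
    simp only [Finset.mem_product, Finset.mem_range]
    omega
  · intro st _ hst
    exact stemBar_single_single 𝒱 Q R (fun h => hst (Finset.HasAntidiagonal.mem_antidiagonal.2 h)) _ _

end StemBar

/-! ### Independence of the components, the sign cocycle, and the two graded Lie algebras. -/

section Main

variable {n : ℕ} [NeZero n] {K V : Type*} [Field K] [AddCommGroup V] [Module K V]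
  (𝒱 : Deg n → Submodule K V) [DirectSum.Decomposition 𝒱]

/-- Linear maps without common kernel detect independence, as soon as each sends the components into
an independent family. -/
theorem iSupIndep_of_eval {G ι E : Type*} [AddCommGroup E] [Module K E] (L : G → Submodule K E)
    (W : ι → G → Submodule K V) (hW : ∀ t, iSupIndep (W t)) (ev : ι → E →ₗ[K] V)
    (hev : ∀ x, (∀ t, ev t x = 0) → x = 0) (h : ∀ t g, ∀ x ∈ L g, ev t x ∈ W t g) :
    iSupIndep L := by
  rw [iSupIndep_def]
  intro g
  rw [Submodule.disjoint_def]
  intro x hx hx'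
  refine hev x fun t => Submodule.disjoint_def.1 (iSupIndep_def.1 (hW t) g) _ (h t g x hx) ?_
  have : (⨆ j, ⨆ (_ : j ≠ g), L j) ≤ (⨆ j, ⨆ (_ : j ≠ g), W t j).comap (ev t) := by
    refine iSup₂_le fun j hj y hy => ?_
    exact Submodule.mem_iSup_of_mem j (Submodule.mem_iSup_of_mem hj (h t j y hy))
  exact this hx'

omit [NeZero n] in
theorem iSupIndep_component (α : Deg n) : iSupIndep fun β => 𝒱 (β + α) :=
  (DirectSum.Decomposition.isInternal 𝒱).submodule_iSupIndep.comp (add_left_injective α)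

/-- The evaluation of a sequence of multilinear maps at a tuple. -/
noncomputable def evalAt {c : ℕ} (v : Fin (c + 1) → V) : MultSeq K V →ₗ[K] V where
  toFun F := F c v
  map_add' _ _ := rfl
  map_smul' _ _ := rfl

omit [NeZero n] in
theorem eq_zero_of_evalAt_eq_zero (F : MultSeq K V)
    (h : ∀ t : Σ c : ℕ, Σ d : Fin (c + 1) → Deg n, (i : Fin (c + 1)) → 𝒱 (d i),
      evalAt (K := K) (fun i => (t.2.2 i : V)) F = 0) : F = 0 := by
  funext c
  exact multilinearMap_ext_hom 𝒱 fun d v hv => h ⟨c, d, fun i => ⟨v i, hv i⟩⟩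

theorem iSupIndep_C : iSupIndep (C (K := K) 𝒱) := by
  refine iSupIndep_of_eval _
    (fun (t : Σ c : ℕ, Σ d : Fin (c + 1) → Deg n, (i : Fin (c + 1)) → 𝒱 (d i)) (Q : Deg n) =>
      -- At a fixed homogeneous tuple, values of elements of `C 𝒱 Q` have degree `Q` plus a
      -- constant, so different `Q` give different components of `V`.
      𝒱 (Q + (-((t.1 : ℤ) • e1 n) + ∑ i, t.2.1 i)))
    (fun t => iSupIndep_component 𝒱 _) _ (eq_zero_of_evalAt_eq_zero 𝒱) fun t Q F hF => ?_
  have := hF t.1 t.2.1 (fun i => t.2.2 i) fun i => (t.2.2 i).2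
  rwa [sub_eq_add_neg, add_assoc] at this

omit [NeZero n] in
theorem iSupIndep_Mr : iSupIndep (Mr (K := K) 𝒱) := by
  refine iSupIndep_of_eval _
    (fun (t : Σ c : ℕ, Σ d : Fin (c + 1) → Deg n, (i : Fin (c + 1)) → 𝒱 (d i))
      (d : Deg n × ℤ) => if (t.1 : ℤ) = d.2 then 𝒱 (d.1 + ∑ i, t.2.1 i) else ⊥)
    (fun t => ?_) _ (eq_zero_of_evalAt_eq_zero 𝒱) fun t d F hF => ?_
  · rw [iSupIndep_def]
    intro d
    by_cases hd : (t.1 : ℤ) = d.2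
    · refine (iSupIndep_def.1 (iSupIndep_component 𝒱 (∑ i, t.2.1 i)) d.1).mono
        (by rw [if_pos hd]) (iSup₂_le fun d' hd' => ?_)
      by_cases h : (t.1 : ℤ) = d'.2
      · rw [if_pos h]
        refine le_iSup₂_of_le d'.1 (fun h1 => hd' (Prod.ext h1 ?_)) le_rfl
        rw [← h, hd]
      · rw [if_neg h]
        exact bot_le
    · rw [if_neg hd]
      exact disjoint_bot_left
  · split_ifs with h
    · exact (hF t.1).1 t.2.1 (fun i => t.2.2 i) fun i => (t.2.2 i).2
    · rw [Submodule.mem_bot]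
      exact congrArg (fun F => F fun i => (t.2.2 i : V)) ((hF t.1).2 h)

theorem stem_eq (d d' : Deg n × ℤ) (f g : MultSeq K V) :
    stem 𝒱 d d' f g = sgn (stemExp d d') • stemBar 𝒱 (totalDeg d) (totalDeg d') f g := rfl

theorem totalDeg_add (d d' : Deg n × ℤ) : totalDeg (d + d') = totalDeg d + totalDeg d' := by
  simp only [totalDeg, Prod.fst_add, Prod.snd_add, add_smul]
  abel

theorem isGradedLie_C : IsGradedLie pair (C (K := K) 𝒱) (stemBar 𝒱) where
  indep := iSupIndep_C 𝒱
  mem _ _ _ hx _ hy := stemBar_mem_C 𝒱 hx hy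
  add_left i j x _ x' _ y _ := (stemBarₗ 𝒱 i j).map_add₂ x x' y
  smul_left i j r x _ y _ := (stemBarₗ 𝒱 i j).map_smul₂ r x y
  add_right i j x _ y _ y' _ := (stemBarₗ 𝒱 i j x).map_add y y'
  smul_right i j r x _ y _ := (stemBarₗ 𝒱 i j x).map_smul r y
  antisymm i j x _ y _ := stemBar_antisymm 𝒱 i j x y
  jacobi _ _ _ _ hx _ hy _ hz := stemBar_jacobi 𝒱 hx hy hz

variable {𝒱} in
theorem stem_mem_Mr {d d' : Deg n × ℤ} {f g : MultSeq K V} (hf : f ∈ Mr 𝒱 d) (hg : g ∈ Mr 𝒱 d') :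
    stem 𝒱 d d' f g ∈ Mr 𝒱 (d + d') := by
  rw [mem_Mr_iff] at hf hg
  rw [stem_eq]
  refine sgn_smul_mem _ _ ((mem_Mr_iff 𝒱).2 ⟨?_, fun c hc => ?_⟩)
  · rw [totalDeg_add]
    exact stemBar_mem_C 𝒱 hf.1 hg.1
  · rw [stemBar_apply_eq_sum]
    refine Finset.sum_eq_zero fun st hst => ?_
    have hst' := Finset.HasAntidiagonal.mem_antidiagonal.1 hst
    rw [← stemBarₗ_apply]
    -- Since `c` is not `a + b`, one of the two places misses the only nonzero entry of its
    -- sequence.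
    by_cases h : (st.1 : ℤ) = d.2
    · rw [hg.2 st.2 (fun h' => hc (by rw [Prod.snd_add, ← h, ← h', ← hst']; push_cast; rfl)),
        Pi.single_zero, map_zero]
      rfl
    · rw [hf.2 st.1 h, Pi.single_zero, map_zero]
      rfl

/-- `stemExp` is the constant `1` plus a form additive in each degree. The cocycle identity lets the
twisted bracket inherit the Jacobi identity. -/
theorem stemExp_cocycle (i j k : Deg n × ℤ) :
    stemExp i (j + k) + stemExp j k = stemExp (i + j) k + stemExp i j := by
  simp only [stemExp, Prod.fst_add, Prod.snd_add, add_smul, pair_add_left, pair_add_right]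
  ring

/-- `⟨A + a e₁, B + b e₁⟩` exceeds `⟨A, B⟩ + ab` by `a⟨e₁, B⟩ + b⟨e₁, A⟩`, which modulo `2` is the
difference of the two `stemExp`. -/
theorem sgn_stemExp_swap (i j : Deg n × ℤ) :
    sgn (stemExp i j) * sgn (pair (totalDeg i) (totalDeg j)) =
      sgn (pairSucc i j) * sgn (stemExp j i) := by
  rw [← sgn_add, ← sgn_add]
  refine sgn_eq_of_even_sub ⟨pair (i.2 • e1 n) j.1, ?_⟩
  simp only [stemExp, totalDeg, pairSucc, pair_add_left, pair_add_right, pair_smul_left,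
    pair_smul_right, pair_e1_e1, pair_comm i.1 (e1 n)]
  ring

theorem sgn_stemExp_jacobi (i j k : Deg n × ℤ) :
    sgn (stemExp i (j + k)) * sgn (stemExp j k) * sgn (pair (totalDeg i) (totalDeg j)) =
      sgn (pairSucc i j) * (sgn (stemExp j (i + k)) * sgn (stemExp i k)) := by
  rw [← sgn_add (stemExp i (j + k)), stemExp_cocycle, ← sgn_add (stemExp j (i + k)),
    stemExp_cocycle, sgn_add, sgn_add, mul_assoc, sgn_stemExp_swap, add_comm j i]
  exact mul_left_comm _ _ _

theorem isGradedLie_Mr : IsGradedLie pairSucc (Mr (K := K) 𝒱) (stem 𝒱) where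
  indep := iSupIndep_Mr 𝒱
  mem _ _ _ hx _ hy := stem_mem_Mr hx hy
  add_left i j x _ x' _ y _ := by
    rw [stem_eq, ← stemBarₗ_apply, LinearMap.map_add₂, smul_add]
    rfl
  smul_left i j r x _ y _ := by
    rw [stem_eq, ← stemBarₗ_apply, LinearMap.map_smul₂, smul_comm]
    rfl
  add_right i j x _ y _ y' _ := by
    rw [stem_eq, ← stemBarₗ_apply, map_add, smul_add]
    rfl
  smul_right i j r x _ y _ := by
    rw [stem_eq, ← stemBarₗ_apply, map_smul, smul_comm]
    rfl
  antisymm i j x _ y _ := by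
    rw [stem_eq, stem_eq, stemBar_antisymm, smul_neg, smul_smul, smul_smul, sgn_stemExp_swap]
  jacobi i j k x hx y hy z hz := by
    have hx' := ((mem_Mr_iff 𝒱).1 hx).1
    have hy' := ((mem_Mr_iff 𝒱).1 hy).1
    have hz' := ((mem_Mr_iff 𝒱).1 hz).1
    simp only [stem_eq, totalDeg_add, stemBar_units_smul_left, stemBar_units_smul_right,
      smul_smul]
    rw [stemBar_jacobi 𝒱 hx' hy' hz', smul_add, smul_smul, sgn_stemExp_jacobi, ← sgn_add,
      stemExp_cocycle, sgn_add]

theorem phi_stem {d d' : Deg n × ℤ} {f g : MultSeq K V} (hf : f ∈ Mr 𝒱 d) (hg : g ∈ Mr 𝒱 d') :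
    phi 𝒱 (totalDeg (d + d')) (stem 𝒱 d d' f g) =
      sgn (stemExp d d') • comm (totalDeg d) (totalDeg d')
        (phi 𝒱 (totalDeg d) f) (phi 𝒱 (totalDeg d') g) := by
  rw [mem_Mr_iff] at hf hg
  rw [← phi_stemBar 𝒱 hf.1 hg.1, stem_eq, totalDeg_add]
  exact map_units_smul (N := Module.End K (T K V)) (phi_isLinearMap 𝒱 _).mk' _ _

theorem stemBar_apply_eq_sum_stem (Q R : Deg n) (π ρ : MultSeq K V) (c : ℕ) :
    stemBar 𝒱 Q R π ρ c =
      ∑ st ∈ Finset.HasAntidiagonal.antidiagonal c,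
        sgn (1 + (st.1 : ℤ) * pair (e1 n) R) •
          stem 𝒱 (Q - (st.1 : ℤ) • e1 n, (st.1 : ℤ)) (R - (st.2 : ℤ) • e1 n, (st.2 : ℤ))
            (Pi.single st.1 (π st.1)) (Pi.single st.2 (ρ st.2)) c := by
  rw [stemBar_apply_eq_sum]
  refine Finset.sum_congr rfl fun st _ => ?_
  rw [stem_eq, Pi.smul_apply, smul_smul]
  -- The chosen degrees have totals `Q` and `R`, so `stemExp` is `1 + s⟨e₁, R⟩` with `s = st.1`: the
  -- prefactor repeats the sign inside `stem` and cancels it.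
  simp only [totalDeg, stemExp, sub_add_cancel, add_sub_cancel, pair_smul_left]
  rw [sgn_mul_self, one_smul]

end Main
end Stem

theorem mainTheorem5 {K : Type*} [Field K] [CharZero K] {n : ℕ} [NeZero n]
    {V : Type*} [AddCommGroup V] [Module K V]
    (𝒱 : Stem.Deg n → Submodule K V) [DirectSum.Decomposition 𝒱] :
    -- `φ` restricts to linear isomorphisms from `C^Q(V)` to `CoDer^Q(T(↓V))`, with inverse `φ⁻¹`,
    (∀ Q : Stem.Deg n, IsLinearMap K (Stem.phi 𝒱 Q) ∧
      Set.BijOn (Stem.phi 𝒱 Q) (Stem.C 𝒱 Q) (Stem.CoDer (Stem.desusp 𝒱) Q) ∧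
      Set.InvOn (Stem.phiInv 𝒱) (Stem.phi 𝒱 Q) (Stem.C 𝒱 Q)
        (Stem.CoDer (Stem.desusp 𝒱) Q)) ∧
    -- and from `M_r^{(A,a)}(V)` to `CoDer_{a+1}^{A + a e₁}(T(↓V))`.
    (∀ d : Stem.Deg n × ℤ,
      Set.BijOn (Stem.phi 𝒱 (Stem.totalDeg d)) (Stem.Mr 𝒱 d)
        (Stem.CoDerAt (Stem.desusp 𝒱) (Stem.totalDeg d) d.2)) ∧
    -- `M_r(V)` is a `ℤⁿ⁺¹`-graded Lie algebra for the stem bracket,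
    Stem.IsGradedLie Stem.pairSucc (Stem.Mr 𝒱) (Stem.stem 𝒱) ∧
    -- which is the commutator of coderivations, up to the sign, transferred by `φ`.
    (∀ d d' : Stem.Deg n × ℤ, ∀ f ∈ Stem.Mr 𝒱 d, ∀ g ∈ Stem.Mr 𝒱 d',
      Stem.phi 𝒱 (Stem.totalDeg (d + d')) (Stem.stem 𝒱 d d' f g) =
        Stem.sgn (Stem.stemExp d d') •
          Stem.comm (Stem.totalDeg d) (Stem.totalDeg d')
            (Stem.phi 𝒱 (Stem.totalDeg d) f) (Stem.phi 𝒱 (Stem.totalDeg d') g)) ∧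
    -- `C(V)` is a `ℤⁿ`-graded Lie algebra for the transferred commutator,
    Stem.IsGradedLie Stem.pair (Stem.C 𝒱) (Stem.stemBar 𝒱) ∧
    (∀ Q R : Stem.Deg n, ∀ π ∈ Stem.C 𝒱 Q, ∀ ρ ∈ Stem.C 𝒱 R,
      Stem.phi 𝒱 (Q + R) (Stem.stemBar 𝒱 Q R π ρ) =
        Stem.comm Q R (Stem.phi 𝒱 Q π) (Stem.phi 𝒱 R ρ)) ∧
    -- which is expressed through the stem bracket (here `s`, `t`, `c` are shifted by one).
    (∀ Q R : Stem.Deg n, ∀ π ∈ Stem.C 𝒱 Q, ∀ ρ ∈ Stem.C 𝒱 R, ∀ c : ℕ,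
      Stem.stemBar 𝒱 Q R π ρ c =
        ∑ st ∈ Finset.HasAntidiagonal.antidiagonal c,
          Stem.sgn (1 + (st.1 : ℤ) * Stem.pair (Stem.e1 n) R) •
            Stem.stem 𝒱 (Q - (st.1 : ℤ) • Stem.e1 n, (st.1 : ℤ))
              (R - (st.2 : ℤ) • Stem.e1 n, (st.2 : ℤ))
              (Pi.single st.1 (π st.1)) (Pi.single st.2 (ρ st.2)) c) := by
  exact ⟨fun Q => ⟨Stem.phi_isLinearMap 𝒱 Q, Stem.phi_bijOn 𝒱 Q, Stem.phi_invOn 𝒱 Q⟩,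
    Stem.phi_bijOn_Mr 𝒱, Stem.isGradedLie_Mr 𝒱,
    fun _ _ _ hf _ hg => Stem.phi_stem 𝒱 hf hg, Stem.isGradedLie_C 𝒱,
    fun _ _ _ hπ _ hρ => Stem.phi_stemBar 𝒱 hπ hρ,
    fun Q R π _ ρ _ c => Stem.stemBar_apply_eq_sum_stem 𝒱 Q R π ρ c⟩
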